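/- A literal is a propositional variable $x$ or its negation $\neg x$, a clause is a finite set of literals (read as a disjunction), and a CNF formula is a finite set of clauses (read as a conjunction). Consider the following classes of CNF formulas: $\mathrm{Horn}$ (every clause has at most one positive literal), $\mathrm{Krom}$ (every clause has at most two literals), and $\mathrm{ID}$ (every clause has at most one literal, and only positive literals occur). For a CNF formula $\varphi$ and an assignment $\theta\colon B\to\{0,1\}$ on a finite set $B$ of variables, the reduct $\varphi[\theta]$ is obtained by removing all clauses that contain a literal true under $\theta$ and removing all literals false under $\theta$ from the remaining clauses. For a class $\mathcal F$ of CNF formulas, let $\mathrm{BDIMP}(\mathrm{CNF}\to\mathcal F)$ be the following parameterised problem. An instance consists of a finite set $\Phi$ of CNF formulas, a CNF formula $\psi$, and a finite set $B$ of variables that is a strong $\mathcal F$-backdoor, i.e. for every assignment $\theta\colon B\to\{0,1\}$ all formulas $\varphi[\theta]$ with $\varphi\in\Phi$ and also $\psi[\theta]$ belong to $\mathcal F$. The parameter is $k=|B|$. The question is whether $\Phi\models\psi$. Formally, the problem is the set of all pairs $(w,k)\in\Sigma^*\times\mathbb N$ such that $w$ is the code (over a fixed finite alphabet $\Sigma$)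 of some $(\Phi,\psi,B)$ with $B$ a strong $\mathcal F$-backdoor, $|B|=k$ and $\Phi\models\psi$. A parameterised problem $L\subseteq\Sigma^*\times\mathbb N$ is in $\mathrm{FPT}$ $(=\mathrm{para\text{-}P})$ if there are a finite alphabet $\Sigma'$, a computable function $f\colon\mathbb N\to\Sigma'^*$, and a problem $L'\subseteq\Sigma^*\times\Sigma'^*$ that is decidable in polynomial time, such that for all $(w,k)\in\Sigma^*\times\mathbb N$: $(w,k)\in L$ if and only if $(w,f(k))\in L'$. Theorem. For every $\mathcal F\in\{\mathrm{ID},\mathrm{Horn},\mathrm{Krom}\}$, $\mathrm{BDIMP}(\mathrm{CNF}\to\mathcal F)\in\mathrm{FPT}$. -/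

import Mathlib

namespace BackdoorImp

/-! ### Propositional logic -/

/-- Propositional variables are named by words over `{0,1}`, so there is an unbounded supply of
them and the name of a variable is its own binary code. -/
abbrev Var : Type := List Bool

/-- A literal `x` (`positive = true`) or `¬ x` (`positive = false`). -/
@[ext] structure Literal where
  var : Var
  positive : Bool
deriving DecidableEq

/-- A clause is a finite set of literals, read as their disjunction. -/
abbrev Clause : Type := Finset Literal

/-- A CNF formula is a finite set of clauses, read as their conjunction. -/
abbrev CNF : Type := Finset Clause

/-- The valuation `v` satisfies the CNF formula `φ`. -/
def Satisfies (v : Var → Bool) (φ : CNF) : Prop :=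
  ∀ C ∈ φ, ∃ l ∈ C, v l.var = l.positive

/-- `Φ ⊨ ψ`: every valuation that satisfies all formulas in `Φ` satisfies `ψ`. -/
def Entails (Φ : Finset CNF) (ψ : CNF) : Prop :=
  ∀ v : Var → Bool, (∀ φ ∈ Φ, Satisfies v φ) → Satisfies v ψ

/-- Truth assignments `θ : X → {0,1}` on a finite set `X` of variables. -/
abbrev Assignment (X : Finset Var) : Type := {x : Var // x ∈ X} → Bool

/-- `some b` if the variable of `l` lies in `X` and `θ(l) = b`; `none` if it is not in `X`. -/
def Assignment.literalValue {X : Finset Var} (θ : Assignment X) (l : Literal) : Option Bool :=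
  if h : l.var ∈ X then some (if l.positive then θ ⟨l.var, h⟩ else !θ ⟨l.var, h⟩) else none

/-- The reduct `φ[θ]`: remove all clauses that contain a literal true under `θ`, and from the
remaining clauses remove all literals false under `θ`. -/
def CNF.reduct (φ : CNF) {X : Finset Var} (θ : Assignment X) : CNF :=
  (φ.filter fun C => ∀ l ∈ C, θ.literalValue l ≠ some true).image
    fun C => C.filter fun l => θ.literalValue l ≠ some false

/-! ### Target classes -/

/-- Formulas all of whose clauses have at most one positive literal. -/
def Horn : Set CNF :=
  {φ | ∀ C ∈ φ, (C.filter fun l => l.positive = true).card ≤ 1}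

/-- Formulas all of whose clauses have at most two literals. -/
def Krom : Set CNF :=
  {φ | ∀ C ∈ φ, C.card ≤ 2}

/-- Formulas all of whose clauses are positive unit clauses, or empty (the class is closed under
passing to subclauses). -/
def ID : Set CNF :=
  {φ | ∀ C ∈ φ, C.card ≤ 1 ∧ ∀ l ∈ C, l.positive = true}

/-! ### Instances of the implication problem with a backdoor -/

/-- A finite set `Φ` of CNF formulas, a CNF formula `ψ`, and a finite set `B` of variables. -/
structure Inst where
  Φ : Finset CNF
  ψ : CNF
  B : Finset Var

/-- `B` is a strong `F`-backdoor of the instance: under every assignment to `B` the reducts of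
all premises and of the conclusion belong to `F`. -/
def Inst.IsStrongBackdoor (I : Inst) (F : Set CNF) : Prop :=
  ∀ θ : Assignment I.B, (∀ φ ∈ I.Φ, φ.reduct θ ∈ F) ∧ I.ψ.reduct θ ∈ F

/-! ### Words that encode instances -/

/-- The input alphabet. Every item of a listing is preceded by a marker symbol. -/
inductive Symbol
  | zero | one
  | pos | neg
  | clause
  | formula
  | goal
  | backdoor
  | name
deriving DecidableEq

instance : Fintype Symbol where
  elems := {.zero, .one, .pos, .neg, .clause, .formula, .goal, .backdoor, .name}
  complete := by rintro ⟨⟩ <;> decide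

/-- The name of a variable, written with the two bit symbols. -/
def encVar (x : Var) : List Symbol :=
  x.map fun b => if b then Symbol.one else Symbol.zero

def encLiteral (l : Literal) : List Symbol :=
  (if l.positive then Symbol.pos else Symbol.neg) :: encVar l.var

def encClause (c : List Literal) : List Symbol :=
  Symbol.clause :: c.flatMap encLiteral

def encCNF (φ : List (List Literal)) : List Symbol :=
  Symbol.formula :: φ.flatMap encClause

/-- The word that lists the premises, then the conclusion, then the backdoor variables. -/
def encInst (Φ : List (List (List Literal))) (ψ : List (List Literal)) (B : List Var) :
    List Symbol :=
  Φ.flatMap encCNF ++ Symbol.goal :: encCNF ψ ++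
    Symbol.backdoor :: B.flatMap fun x => Symbol.name :: encVar x

/-- The CNF formula listed by a list of lists of literals. -/
def toCNF (φ : List (List Literal)) : CNF :=
  (φ.map fun c => c.toFinset).toFinset

/-- The word `w` encodes the instance `I`: it lists the elements of the sets in `I`, in any
order, possibly with repetitions. -/
def Encodes (w : List Symbol) (I : Inst) : Prop :=
  ∃ (Φ : List (List (List Literal))) (ψ : List (List Literal)) (B : List Var),
    w = encInst Φ ψ B ∧ (Φ.map toCNF).toFinset = I.Φ ∧ toCNF ψ = I.ψ ∧ B.toFinset = I.B

/-! ### Parameterised complexity -/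

/-- A parameterised problem over the alphabet `Γ`: a subset of `Γ* × ℕ`. -/
abbrev ParamProblem (Γ : Type) : Type := Set (List Γ × ℕ)

/-- A pair of words as one word, over the disjoint union of the two alphabets. -/
def encPair {Γ Δ : Type} (p : List Γ × List Δ) : List (Γ ⊕ Δ) :=
  p.1.map Sum.inl ++ p.2.map Sum.inr

open Classical in
/-- The class `P`, for subsets of `Γ* × Δ*`: some multi-stack Turing machine, started on the
pair, halts within polynomially many steps and outputs the one-symbol answer. -/
def InP {Γ Δ : Type} (L : Set (List Γ × List Δ)) : Prop :=
  Nonempty (Turing.TM2ComputableInPolyTime encPair (fun b : Bool => [b])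
    (fun p : List Γ × List Δ => decide (p ∈ L)))

/-- The class `FPT`, that is, `para-P`: there are a finite alphabet (without loss of generality
`Fin n`), a computable function `f` from `ℕ` to words over it, and a problem `L'` in `P` such
that `(x, k) ∈ L` if and only if `(x, f k) ∈ L'`. -/
def IsFPT {Γ : Type} [Fintype Γ] (L : ParamProblem Γ) : Prop :=
  ∃ (n : ℕ) (f : ℕ → List (Fin n)) (L' : Set (List Γ × List (Fin n))),
    Computable f ∧ InP L' ∧ ∀ (x : List Γ) (k : ℕ), (x, k) ∈ L ↔ (x, f k) ∈ L'

/-- The CNF implication problem where a strong `F`-backdoor is given and the parameter is the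
size of the backdoor. -/
def BDIMP (F : Set CNF) : ParamProblem Symbol :=
  {p | ∃ I : Inst, Encodes p.1 I ∧ I.IsStrongBackdoor F ∧ I.B.card = p.2 ∧ Entails I.Φ I.ψ}

end BackdoorImp

/-! The advice f(k) lists all 2^k assignments to k variables, so trying every assignment to the
backdoor takes time polynomial in the length of the input and of the advice. Every valuation extends
exactly one assignment θ of B. Hence Φ ⊨ ψ holds iff for every θ and every clause D of ψ the
premises are unsatisfiable together with the literals of θ and the complements of the literals of D.
Reducts are never computed: the clauses stay as they are, and the literals of θ are added as facts.
The conditions `HornClause`, `KromClause` and `IDClause` express membership of the reduct in the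
class on the unreduced clauses (`reduct_mem_horn_iff` and its analogues), and for the first two this
survives the addition of further facts.

Unsatisfiability is tested by unit propagation. For Horn clauses it is complete, because the
variables that it derives form a model unless there is a conflict (`exists_holds_of_horn`); ID is a
special case. For clauses with at most two literals it suffices that every variable has a literal
whose addition causes no conflict, since the partial models obtained in this way can be glued
(`exists_holds_of_krom`). Both cases are covered by one criterion, `entails_iff_conflict`: there is
a variable both of whose literals lead to a conflict. In the Horn case the split on a variable is
harmless.

Polynomial time is proved by the easy half of the correspondence between P and first-order logic
with least fixed points. Loop programs (`Prog`) move finitely many pointers over the input, and they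
compile to stack machines with polynomial running time (`Prog.reach_code`, `Prog.inP_of_run`). The
relations on tuples of positions that such programs decide (`Def`) are closed under Boolean
operations, quantification over positions and least fixed points (`Def.exists_derivable`).
Reachability and unit propagation are least fixed points. It remains to define two properties of the
word: that it is the code of an instance (`Valid`), and that every block of the advice passes the
tests (`Accepts`). The tests also compare the length of a block with the number of distinct backdoor
variables, which checks |B| = k. The equivalence with the problem is `mem_bdimp_iff`. -/

open Turing StateTransition

namespace BackdoorImp

/-! ### Loop programs -/

/-- Programs that move pointers over a read-only word and operate on four stacks of bits. The only
form of iteration is the repetition of a program `|w| + 1` times, so that every program runs in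
polynomial time. -/
inductive Prog (A : Type) : Type
  | skip : Prog A
  | push : Fin 4 → Bool → Prog A
  | left : ℕ → Prog A
  | right : ℕ → Prog A
  | seq : Prog A → Prog A → Prog A
  | pop : Fin 4 → Prog A → Prog A → Prog A
  | test : ℕ → (Option A → Bool) → Prog A → Prog A → Prog A
  | atStart : ℕ → Prog A → Prog A → Prog A
  | loop : Prog A → Prog A

/-- The contents of the four bit stacks. -/
abbrev Stacks : Type := Fin 4 → List Bool

/-- The state of a program: pointer positions and stacks. -/
@[ext] structure PState where
  head : ℕ → ℕ
  stk : Stacks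

namespace Prog

variable {A : Type}

/-- The state after the execution of a program on the word `w`. -/
def run (w : List A) : Prog A → PState → PState
  | skip, s => s
  | push k b, s => ⟨s.head, Function.update s.stk k (b :: s.stk k)⟩
  | left i, s => ⟨Function.update s.head i (s.head i - 1), s.stk⟩
  | right i, s => ⟨Function.update s.head i (min (s.head i + 1) w.length), s.stk⟩
  | seq p q, s => run w q (run w p s)
  | pop k p q, s =>
    if (s.stk k).head? = some true then run w p ⟨s.head, Function.update s.stk k (s.stk k).tail⟩
    else run w q ⟨s.head, Function.update s.stk k (s.stk k).tail⟩
  | test i f p q, s => if f (w[s.head i]?) = true then run w p s else run w q s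
  | atStart i p q, s => if s.head i = 0 then run w p s else run w q s
  | loop p, s => (run w p)^[w.length + 1] s

theorem run_head_le (w : List A) (p : Prog A) :
    ∀ s : PState, (∀ i, s.head i ≤ w.length) → ∀ i, (run w p s).head i ≤ w.length := by
  induction p with
  | skip => exact fun s h => h
  | push k b => exact fun s h => h
  | left j =>
    intro s h i
    simp only [run, Function.update_apply]
    split_ifs
    · exact (Nat.sub_le _ _).trans (h j)
    · exact h i
  | right j =>
    intro s h i
    simp only [run, Function.update_apply]
    split_ifs
    · exact min_le_right _ _
    · exact h i
  | seq p q hp hq => exact fun s h => hq _ (hp _ h)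
  | pop k p q hp hq =>
    intro s h
    simp only [run]
    split_ifs
    · exact hp _ h
    · exact hq _ h
  | test j f p q hp hq =>
    intro s h
    simp only [run]
    split_ifs
    · exact hp _ h
    · exact hq _ h
  | atStart j p q hp hq =>
    intro s h
    simp only [run]
    split_ifs
    · exact hp _ h
    · exact hq _ h
  | loop p hp =>
    intro s h
    simp only [run]
    generalize w.length + 1 = t
    induction t generalizing s with
    | zero => exact h
    | succ t ih =>
      rw [Function.iterate_succ_apply]
      exact ih _ (hp _ h)

/-- A bound on the number of machine steps, as a polynomial in the length of the word. -/
noncomputable def time : Prog A → Polynomial ℕ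
  | skip => 1
  | push _ _ => 1
  | left _ => 1
  | right _ => 1
  | seq p q => time p + time q
  | pop _ p q => 1 + (time p + time q)
  | test _ _ p q => 1 + (time p + time q)
  | atStart _ p q => 1 + (time p + time q)
  | loop p => (Polynomial.X + 1) * (time p + 1) + (Polynomial.X + 1)

/-- All pointers used, and all loop counters when the nesting starts at `d`, are below `N`. -/
def Bounded (N : ℕ) : ℕ → Prog A → Prop
  | _, skip => True
  | _, push _ _ => True
  | _, left i => i < N
  | _, right i => i < N
  | d, seq p q => Bounded N d p ∧ Bounded N d q
  | d, pop _ p q => Bounded N d p ∧ Bounded N d q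
  | d, test i _ p q => i < N ∧ Bounded N d p ∧ Bounded N d q
  | d, atStart i p q => i < N ∧ Bounded N d p ∧ Bounded N d q
  | d, loop p => d < N ∧ Bounded N (d + 1) p

theorem Bounded.mono {N M : ℕ} (h : N ≤ M) {p : Prog A} :
    ∀ {d : ℕ}, Bounded N d p → Bounded M d p := by
  induction p with
  | skip => exact fun _ => trivial
  | push => exact fun _ => trivial
  | left i => exact fun hp => lt_of_lt_of_le hp h
  | right i => exact fun hp => lt_of_lt_of_le hp h
  | seq p q hp hq => exact fun hb => ⟨hp hb.1, hq hb.2⟩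
  | pop k p q hp hq => exact fun hb => ⟨hp hb.1, hq hb.2⟩
  | test i f p q hp hq => exact fun hb => ⟨lt_of_lt_of_le hb.1 h, hp hb.2.1, hq hb.2.2⟩
  | atStart i p q hp hq => exact fun hb => ⟨lt_of_lt_of_le hb.1 h, hp hb.2.1, hq hb.2.2⟩
  | loop p hp => exact fun hb => ⟨lt_of_lt_of_le hb.1 h, hp hb.2⟩

theorem exists_bounded (p : Prog A) : ∀ d : ℕ, ∃ N, Bounded N d p := by
  induction p with
  | skip => exact fun _ => ⟨0, trivial⟩
  | push => exact fun _ => ⟨0, trivial⟩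
  | left i => exact fun _ => ⟨i + 1, Nat.lt_succ_self i⟩
  | right i => exact fun _ => ⟨i + 1, Nat.lt_succ_self i⟩
  | seq p q hp hq | pop k p q hp hq =>
    intro d
    obtain ⟨N, hN⟩ := hp d
    obtain ⟨M, hM⟩ := hq d
    exact ⟨max N M, hN.mono (le_max_left _ _), hM.mono (le_max_right _ _)⟩
  | test i _ p q hp hq | atStart i p q hp hq =>
    intro d
    obtain ⟨N, hN⟩ := hp d
    obtain ⟨M, hM⟩ := hq d
    exact ⟨max (i + 1) (max N M), lt_of_lt_of_le (Nat.lt_succ_self i) (le_max_left _ _),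
      hN.mono ((le_max_left _ _).trans (le_max_right _ _)),
      hM.mono ((le_max_right _ _).trans (le_max_right _ _))⟩
  | loop p hp =>
    intro d
    obtain ⟨N, hN⟩ := hp (d + 1)
    exact ⟨max (d + 1) N, lt_of_lt_of_le (Nat.lt_succ_self d) (le_max_left _ _),
      hN.mono (le_max_right _ _)⟩

/-! ### Compilation to stack machines -/

/-- The stacks of the machine. Pointers (tag `false`) and loop counters (tag `true`) are zippers
over copies of the input word. -/
inductive Reg (N : ℕ) : Type
  | inp : Reg N
  | out : Reg N
  | before : Bool × Fin N → Reg N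
  | after : Bool × Fin N → Reg N
  | bits : Fin 4 → Reg N
deriving DecidableEq, Fintype

/-- The alphabets of the machine stacks. -/
abbrev RegAlphabet (A : Type) (N : ℕ) : Reg N → Type
  | .inp => A
  | .out => Bool
  | .before _ => A
  | .after _ => A
  | .bits _ => Bool

/-- The labels of the code of a program. -/
def Label : Prog A → Type
  | skip => Unit
  | push _ _ => Unit
  | left _ => Unit
  | right _ => Unit
  | seq p q => Label p ⊕ Label q
  | pop _ p q => Option (Label p ⊕ Label q)
  | test _ _ p q => Option (Label p ⊕ Label q)
  | atStart _ p q => Option (Label p ⊕ Label q)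
  | loop p => Bool ⊕ Label p

noncomputable instance fintypeLabel : ∀ p : Prog A, Fintype (Label p)
  | skip => inferInstanceAs (Fintype Unit)
  | push _ _ => inferInstanceAs (Fintype Unit)
  | left _ => inferInstanceAs (Fintype Unit)
  | right _ => inferInstanceAs (Fintype Unit)
  | seq p q =>
    letI := fintypeLabel p
    letI := fintypeLabel q
    inferInstanceAs (Fintype (Label p ⊕ Label q))
  | pop _ p q =>
    letI := fintypeLabel p
    letI := fintypeLabel q
    inferInstanceAs (Fintype (Option (Label p ⊕ Label q)))
  | test _ _ p q =>
    letI := fintypeLabel p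
    letI := fintypeLabel q
    inferInstanceAs (Fintype (Option (Label p ⊕ Label q)))
  | atStart _ p q =>
    letI := fintypeLabel p
    letI := fintypeLabel q
    inferInstanceAs (Fintype (Option (Label p ⊕ Label q)))
  | loop p =>
    letI := fintypeLabel p
    inferInstanceAs (Fintype (Bool ⊕ Label p))

/-- The label at which the code of a program starts. -/
def entry : (p : Prog A) → Label p
  | skip => ()
  | push _ _ => ()
  | left _ => ()
  | right _ => ()
  | seq p _ => Sum.inl (entry p)
  | pop _ _ _ => none
  | test _ _ _ _ => none
  | atStart _ _ _ => none
  | loop p => Sum.inr (entry p)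

/-- Machine statements. The control state holds a scratch letter and a scratch bit. -/
abbrev MStmt (A : Type) (N : ℕ) (Λ : Type) : Type :=
  TM2.Stmt (RegAlphabet A N) Λ (Option A × Bool)

/-- Move a zipper one cell to the left if possible; then jump depending on the success. -/
def stmtLeft [Inhabited A] {N : ℕ} {Λ : Type} (z : Bool × Fin N) (yes no : Λ) : MStmt A N Λ :=
  .pop (.before z) (fun v x => (x, v.2)) <|
    .branch (fun v => v.1.isSome)
      (.push (.after z) (fun v => v.1.getD default) (.goto fun _ => yes))
      (.goto fun _ => no)

/-- Move a zipper one cell to the right if possible; then jump depending on the success. -/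
def stmtRight [Inhabited A] {N : ℕ} {Λ : Type} (z : Bool × Fin N) (yes no : Λ) : MStmt A N Λ :=
  .pop (.after z) (fun v x => (x, v.2)) <|
    .branch (fun v => v.1.isSome)
      (.push (.before z) (fun v => v.1.getD default) (.goto fun _ => yes))
      (.goto fun _ => no)

/-- The code of a program, with labels embedded by `emb`, leaving through the label `exit`. -/
def code [Inhabited A] (N : ℕ) [NeZero N] {Λ : Type} :
    (p : Prog A) → (d : ℕ) → (emb : Label p → Λ) → (exit : Λ) → Label p → MStmt A N Λ
  | skip, _, _, exit, _ => .goto fun _ => exit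
  | push k b, _, _, exit, _ => .push (.bits k) (fun _ => b) (.goto fun _ => exit)
  | left i, _, _, exit, _ => stmtLeft (false, Fin.ofNat N i) exit exit
  | right i, _, _, exit, _ => stmtRight (false, Fin.ofNat N i) exit exit
  | seq p q, d, emb, exit, x =>
    match x with
    | Sum.inl x => code N p d (fun y => emb (Sum.inl y)) (emb (Sum.inr (entry q))) x
    | Sum.inr x => code N q d (fun y => emb (Sum.inr y)) exit x
  | pop k p q, d, emb, exit, x =>
    match x with
    | none => .pop (.bits k) (fun v x => (v.1, x == some true)) <|
        .goto fun v => if v.2 then emb (some (Sum.inl (entry p)))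
          else emb (some (Sum.inr (entry q)))
    | some (Sum.inl x) => code N p d (fun y => emb (some (Sum.inl y))) exit x
    | some (Sum.inr x) => code N q d (fun y => emb (some (Sum.inr y))) exit x
  | test i f p q, d, emb, exit, x =>
    match x with
    | none => .peek (.after (false, Fin.ofNat N i)) (fun v x => (v.1, f x)) <|
        .goto fun v => if v.2 then emb (some (Sum.inl (entry p)))
          else emb (some (Sum.inr (entry q)))
    | some (Sum.inl x) => code N p d (fun y => emb (some (Sum.inl y))) exit x
    | some (Sum.inr x) => code N q d (fun y => emb (some (Sum.inr y))) exit x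
  | atStart i p q, d, emb, exit, x =>
    match x with
    | none => .peek (.before (false, Fin.ofNat N i)) (fun v x => (v.1, Option.isNone x)) <|
        .goto fun v => if v.2 then emb (some (Sum.inl (entry p)))
          else emb (some (Sum.inr (entry q)))
    | some (Sum.inl x) => code N p d (fun y => emb (some (Sum.inl y))) exit x
    | some (Sum.inr x) => code N q d (fun y => emb (some (Sum.inr y))) exit x
  | loop p, d, emb, exit, x =>
    match x with
    | Sum.inl false => stmtLeft (true, Fin.ofNat N d) (emb (Sum.inr (entry p))) (emb (Sum.inl true))
    | Sum.inl true => stmtRight (true, Fin.ofNat N d) (emb (Sum.inl true)) exit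
    | Sum.inr x => code N p (d + 1) (fun y => emb (Sum.inr y)) (emb (Sum.inl false)) x

/-- The machine stacks that represent pointers at positions `pos` in `w` and bit stacks `S`. -/
def conf (N : ℕ) (w : List A) (pos : Bool → ℕ → ℕ) (S : Stacks) :
    ∀ k : Reg N, List (RegAlphabet A N k)
  | .inp => ([] : List A)
  | .out => ([] : List Bool)
  | .before z => (w.take (pos z.1 z.2)).reverse
  | .after z => w.drop (pos z.1 z.2)
  | .bits k => S k

/-- The positions of pointers and counters as one family. -/
def zipPos (h c : ℕ → ℕ) : Bool → ℕ → ℕ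
  | false => h
  | true => c

/-- From `a`, the machine reaches `b` within `t` steps. -/
def Reach {N : ℕ} {Λ : Type} (M : Λ → MStmt A N Λ) (t : ℕ)
    (a b : TM2.Cfg (RegAlphabet A N) Λ (Option A × Bool)) : Prop :=
  ∃ m ≤ t, (flip bind (TM2.step M))^[m] (some a) = some b

section Reach

variable {N : ℕ} {Λ : Type} {M : Λ → MStmt A N Λ}
  {a b c : TM2.Cfg (RegAlphabet A N) Λ (Option A × Bool)}

theorem Reach.mono {t t' : ℕ} (h : Reach M t a b) (ht : t ≤ t') : Reach M t' a b :=
  let ⟨m, hm, e⟩ := h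
  ⟨m, hm.trans ht, e⟩

theorem Reach.trans {t t' : ℕ} (h : Reach M t a b) (h' : Reach M t' b c) :
    Reach M (t + t') a c := by
  obtain ⟨m, hm, e⟩ := h
  obtain ⟨m', hm', e'⟩ := h'
  exact ⟨m' + m, by omega, by rw [Function.iterate_add_apply, e, e']⟩

theorem Reach.step {l : Λ} {v : Option A × Bool} {S : ∀ k, List (RegAlphabet A N k)}
    (h : TM2.stepAux (M l) v S = b) : Reach M 1 ⟨some l, v, S⟩ b :=
  ⟨1, le_rfl, by subst h; rfl⟩

end Reach

/-! ### Zippers and their elementary moves -/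

section Moves

variable {N : ℕ} {w : List A} {pos : Bool → ℕ → ℕ} {S : Stacks}

theorem conf_update_bits (k : Fin 4) (x : List Bool) :
    Function.update (conf N w pos S) (.bits k) x = conf N w pos (Function.update S k x) := by
  funext r
  cases r with
  | bits j =>
    by_cases h : j = k
    · subst h; simp [conf]
    · simp [conf, h]
  | _ => simp [conf]

/-- Change the position of one zipper. -/
def setPos (pos : Bool → ℕ → ℕ) (t : Bool) (i x : ℕ) : Bool → ℕ → ℕ :=
  Function.update pos t (Function.update (pos t) i x)

theorem setPos_apply (t u : Bool) (i j x : ℕ) :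
    setPos pos t i x u j = if u = t ∧ j = i then x else pos u j := by
  unfold setPos
  by_cases h : u = t
  · subst h; simp [Function.update_apply]
  · simp [h]

theorem conf_setPos (z : Bool × Fin N) (x : ℕ) :
    Function.update (Function.update (conf N w pos S) (.before z) (w.take x).reverse)
      (.after z) (w.drop x) = conf N w (setPos pos z.1 z.2 x) S := by
  funext r
  cases r with
  | inp => simp [conf]
  | out => simp [conf]
  | bits k => simp [conf]
  | before y =>
    by_cases h : y = z
    · subst h; simp [conf, setPos_apply]
    · have : ¬ (y.1 = z.1 ∧ (y.2 : ℕ) = z.2) := fun e => h (Prod.ext e.1 (Fin.ext e.2))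
      simp [conf, setPos_apply, h, this]
  | after y =>
    by_cases h : y = z
    · subst h; simp [conf, setPos_apply]
    · have : ¬ (y.1 = z.1 ∧ (y.2 : ℕ) = z.2) := fun e => h (Prod.ext e.1 (Fin.ext e.2))
      simp [conf, setPos_apply, h, this]

variable [Inhabited A] {Λ : Type}

theorem stepAux_stmtLeft_pos (z : Bool × Fin N) (yes no : Λ) (v : Option A × Bool)
    (h0 : pos z.1 z.2 ≠ 0) (h : pos z.1 z.2 ≤ w.length) :
    ∃ v', TM2.stepAux (stmtLeft z yes no) v (conf N w pos S)
      = ⟨some yes, v', conf N w (setPos pos z.1 z.2 (pos z.1 z.2 - 1)) S⟩ := by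
  obtain ⟨m, hm⟩ := Nat.exists_eq_succ_of_ne_zero h0
  have hlt : m < w.length := by omega
  have e1 : conf N w pos S (.before z) = w[m] :: (w.take m).reverse := by
    simp only [conf, hm, Nat.succ_eq_add_one, ← List.take_concat_get' w m hlt, List.reverse_append]
    rfl
  have e2 : conf N w pos S (.after z) = w.drop (m + 1) := by simp [conf, hm]
  have e3 : w[m] :: w.drop (m + 1) = w.drop m := (List.drop_eq_getElem_cons hlt).symm
  refine ⟨(some w[m], v.2), ?_⟩
  simp only [stmtLeft, TM2.stepAux]
  rw [e1]
  simp only [List.head?_cons, Option.isSome_some, cond_true, List.tail_cons, Option.getD_some]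
  congr 1
  rw [hm, Nat.succ_eq_add_one, Nat.add_sub_cancel, ← conf_setPos]
  congr 1
  rw [Function.update_of_ne (by simp), e2]
  exact e3

theorem stepAux_stmtLeft_zero (z : Bool × Fin N) (yes no : Λ) (v : Option A × Bool)
    (h0 : pos z.1 z.2 = 0) :
    ∃ v', TM2.stepAux (stmtLeft z yes no) v (conf N w pos S)
      = ⟨some no, v', conf N w pos S⟩ := by
  have e1 : conf N w pos S (.before z) = ([] : List A) := by simp [conf, h0]
  refine ⟨(none, v.2), ?_⟩
  simp only [stmtLeft, TM2.stepAux]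
  rw [e1]
  simp only [List.head?_nil, Option.isSome_none, cond_false, List.tail_nil]
  congr 1
  rw [← e1, Function.update_eq_self]

theorem stepAux_stmtRight_lt (z : Bool × Fin N) (yes no : Λ) (v : Option A × Bool)
    (h : pos z.1 z.2 < w.length) :
    ∃ v', TM2.stepAux (stmtRight z yes no) v (conf N w pos S)
      = ⟨some yes, v', conf N w (setPos pos z.1 z.2 (pos z.1 z.2 + 1)) S⟩ := by
  set m := pos z.1 z.2 with hm
  have e1 : conf N w pos S (.before z) = (w.take m).reverse := rfl
  have e2 : conf N w pos S (.after z) = w[m] :: w.drop (m + 1) :=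
    List.drop_eq_getElem_cons h
  have e3 : w[m] :: (w.take m).reverse = (w.take (m + 1)).reverse := by
    rw [← List.take_concat_get' w m h, List.reverse_append]; rfl
  refine ⟨(some w[m], v.2), ?_⟩
  simp only [stmtRight, TM2.stepAux]
  rw [e2]
  simp only [List.head?_cons, Option.isSome_some, cond_true, List.tail_cons, Option.getD_some]
  congr 1
  rw [← conf_setPos, Function.update_comm (by simp)]
  congr 2

theorem stepAux_stmtRight_end (z : Bool × Fin N) (yes no : Λ) (v : Option A × Bool)
    (h0 : pos z.1 z.2 = w.length) :
    ∃ v', TM2.stepAux (stmtRight z yes no) v (conf N w pos S)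
      = ⟨some no, v', conf N w pos S⟩ := by
  have e1 : conf N w pos S (.after z) = ([] : List A) := by simp [conf, h0]
  refine ⟨(none, v.2), ?_⟩
  simp only [stmtRight, TM2.stepAux]
  rw [e1]
  simp only [List.head?_nil, Option.isSome_none, cond_false, List.tail_nil]
  congr 1
  rw [← e1, Function.update_eq_self]

end Moves

theorem setPos_false (h c : ℕ → ℕ) (i x : ℕ) :
    setPos (zipPos h c) false i x = zipPos (Function.update h i x) c := by
  funext u j
  rw [setPos_apply]
  cases u <;> simp [zipPos, Function.update_apply]

theorem setPos_true (h c : ℕ → ℕ) (i x : ℕ) :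
    setPos (zipPos h c) true i x = zipPos h (Function.update c i x) := by
  funext u j
  rw [setPos_apply]
  cases u <;> simp [zipPos, Function.update_apply]

theorem ofNat_val {N i : ℕ} [NeZero N] (h : i < N) : ((Fin.ofNat N i : Fin N) : ℕ) = i :=
  Nat.mod_eq_of_lt h

theorem eval_time_pos (p : Prog A) (n : ℕ) : 1 ≤ (time p).eval n := by
  induction p with
  | seq p q hp hq => simp only [time, Polynomial.eval_add]; omega
  | loop p hp => simp only [time, Polynomial.eval_add, Polynomial.eval_X, Polynomial.eval_one]; omega
  | _ => simp [time]

/-! ### Correctness and running time of compiled programs -/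

section Code

variable [Inhabited A] {N : ℕ} [NeZero N]

/-- Repeating the body of a loop, and then rewinding the counter. -/
theorem reach_loop {Λ : Type} {M : Λ → MStmt A N Λ} {w : List A} {p : Prog A} {d : ℕ}
    (hd : d < N) {start again rewind exit : Λ}
    (hagain : M again = stmtLeft (true, Fin.ofNat N d) start rewind)
    (hrewind : M rewind = stmtRight (true, Fin.ofNat N d) rewind exit)
    (body : ∀ (v : Option A × Bool) (s : PState) (c : ℕ → ℕ), (∀ i, s.head i ≤ w.length) →
      (∀ j ≥ d + 1, c j = w.length) →
      ∃ v', Reach M ((time p).eval w.length) ⟨some start, v, conf N w (zipPos s.head c) s.stk⟩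
        ⟨some again, v', conf N w (zipPos (run w p s).head c) (run w p s).stk⟩)
    (m : ℕ) : ∀ (v : Option A × Bool) (s : PState) (c : ℕ → ℕ), (∀ i, s.head i ≤ w.length) →
      (∀ j ≥ d + 1, c j = w.length) → c d = m → m ≤ w.length →
      ∃ v', Reach M ((m + 1) * ((time p).eval w.length + 1) + (w.length + 1))
        ⟨some start, v, conf N w (zipPos s.head c) s.stk⟩
        ⟨some exit, v', conf N w
          (zipPos ((run w p)^[m + 1] s).head (Function.update c d w.length))
          ((run w p)^[m + 1] s).stk⟩ := by
  -- The counter returns to the right end, so that an enclosing loop finds it there at its next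
  -- pass. From distance r this takes r successful moves and one failing move that exits.
  have rewinding : ∀ r : ℕ, ∀ (v : Option A × Bool) (h c : ℕ → ℕ) (S : Stacks),
      c d + r = w.length → ∃ v', Reach M (r + 1) ⟨some rewind, v, conf N w (zipPos h c) S⟩
        ⟨some exit, v', conf N w (zipPos h (Function.update c d w.length)) S⟩ := by
    intro r
    induction r with
    | zero =>
      intro v h c S hr
      have hz : zipPos h c true (Fin.ofNat N d : Fin N) = w.length := by
        rw [ofNat_val hd]; exact hr
      obtain ⟨v', hv⟩ := stepAux_stmtRight_end (S := S) (true, Fin.ofNat N d) rewind exit v hz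
      refine ⟨v', Reach.step ?_⟩
      rw [hrewind, hv, ← show c d = w.length from hr, Function.update_eq_self]
    | succ r ih =>
      intro v h c S hr
      have hz : zipPos h c true (Fin.ofNat N d : Fin N) < w.length := by
        rw [ofNat_val hd]; simp only [zipPos]; omega
      obtain ⟨v', hv⟩ := stepAux_stmtRight_lt (S := S) (true, Fin.ofNat N d) rewind exit v hz
      simp only [ofNat_val hd, setPos_true] at hv
      obtain ⟨v'', h''⟩ := ih v' h (Function.update c d (c d + 1)) S
        (by rw [Function.update_self]; omega)
      rw [Function.update_idem] at h''
      refine ⟨v'', ((Reach.step ?_).trans h'').mono (Nat.add_comm _ _).le⟩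
      rw [hrewind, hv]
      rfl
  induction m with
  | zero =>
    intro v s c hs hc hm _
    obtain ⟨v1, h1⟩ := body v s c hs hc
    have hz : zipPos (run w p s).head c true (Fin.ofNat N d : Fin N) = 0 := by
      rw [ofNat_val hd]; exact hm
    obtain ⟨v2, h2⟩ := stepAux_stmtLeft_zero (w := w) (S := (run w p s).stk)
      (true, Fin.ofNat N d) start rewind v1 hz
    obtain ⟨v3, h3⟩ := rewinding w.length v2 (run w p s).head c (run w p s).stk (by omega)
    exact ⟨v3, ((h1.trans (Reach.step (by rw [hagain, h2]))).trans h3).mono (by omega)⟩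
  | succ m ih =>
    intro v s c hs hc hm hle
    obtain ⟨v1, h1⟩ := body v s c hs hc
    have hz : zipPos (run w p s).head c true (Fin.ofNat N d : Fin N) = m + 1 := by
      rw [ofNat_val hd]; exact hm
    obtain ⟨v2, h2⟩ := stepAux_stmtLeft_pos (w := w) (S := (run w p s).stk)
      (true, Fin.ofNat N d) start rewind v1 (hz.trans_ne (by omega)) (hz.trans_le hle)
    simp only [ofNat_val hd, setPos_true] at h2
    have e : zipPos (run w p s).head c true d = m + 1 := hm
    rw [e, Nat.add_sub_cancel] at h2
    obtain ⟨v3, h3⟩ := ih v2 (run w p s) (Function.update c d m) (run_head_le w p s hs)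
      (fun j hj => by rw [Function.update_of_ne (by omega)]; exact hc j hj)
      (Function.update_self ..) (by omega)
    refine ⟨v3, ((h1.trans (Reach.step (by rw [hagain, h2]))).trans ?_).mono
      (t := (time p).eval w.length + 1
        + ((m + 1) * ((time p).eval w.length + 1) + (w.length + 1))) (le_of_eq (by ring))⟩
    rw [Function.update_idem] at h3
    rw [Function.iterate_succ_apply]
    exact h3

/-- The invariant that makes the induction work: all counters of depth at least `d` rest at the
right end of the word, and they are there again on exit, since the same `c` occurs in both
configurations. The embedding `emb` lets the code of a subprogram sit inside a larger machine. The
scratch state is left arbitrary because every instruction that reads it sets it beforehand. -/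
theorem reach_code (p : Prog A) : ∀ {Λ : Type} (M : Λ → MStmt A N Λ) (w : List A) (d : ℕ)
    (emb : Label p → Λ) (exit : Λ), (∀ x, M (emb x) = code N p d emb exit x) → p.Bounded N d →
    ∀ (v : Option A × Bool) (s : PState) (c : ℕ → ℕ), (∀ i, s.head i ≤ w.length) →
      (∀ j ≥ d, c j = w.length) →
      ∃ v', Reach M ((time p).eval w.length)
        ⟨some (emb (entry p)), v, conf N w (zipPos s.head c) s.stk⟩
        ⟨some exit, v', conf N w (zipPos (run w p s).head c) (run w p s).stk⟩ := by
  induction p with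
  | skip =>
    intro Λ M w d emb exit hM hb v s c hs hc
    refine ⟨v, (Reach.step ?_).mono (eval_time_pos _ _)⟩
    rw [hM]; rfl
  | push k b =>
    intro Λ M w d emb exit hM hb v s c hs hc
    refine ⟨v, (Reach.step ?_).mono (eval_time_pos _ _)⟩
    rw [hM]
    simp only [code, TM2.stepAux, run]
    rw [conf_update_bits]
    rfl
  | left i =>
    intro Λ M w d emb exit hM hb v s c hs hc
    have hi : i < N := hb
    rcases Nat.eq_zero_or_pos (s.head i) with h0 | h0
    · obtain ⟨v', hv⟩ := stepAux_stmtLeft_zero (w := w) (pos := zipPos s.head c) (S := s.stk)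
        (false, Fin.ofNat N i) exit exit v (by rw [ofNat_val hi]; exact h0)
      refine ⟨v', (Reach.step ?_).mono (eval_time_pos _ _)⟩
      rw [hM]
      simp only [code, run]
      rw [hv, h0, Nat.zero_sub, ← h0, Function.update_eq_self]
    · obtain ⟨v', hv⟩ := stepAux_stmtLeft_pos (w := w) (pos := zipPos s.head c) (S := s.stk)
        (false, Fin.ofNat N i) exit exit v (by rw [ofNat_val hi]; exact h0.ne')
        (by rw [ofNat_val hi]; exact hs i)
      refine ⟨v', (Reach.step ?_).mono (eval_time_pos _ _)⟩
      rw [hM]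
      simp only [code, run]
      rw [hv]
      simp only [ofNat_val hi, setPos_false]
      rfl
  | right i =>
    intro Λ M w d emb exit hM hb v s c hs hc
    have hi : i < N := hb
    rcases Nat.lt_or_ge (s.head i) w.length with h0 | h0
    · obtain ⟨v', hv⟩ := stepAux_stmtRight_lt (w := w) (pos := zipPos s.head c) (S := s.stk)
        (false, Fin.ofNat N i) exit exit v (by rw [ofNat_val hi]; exact h0)
      refine ⟨v', (Reach.step ?_).mono (eval_time_pos _ _)⟩
      rw [hM]
      simp only [code, run]
      rw [hv, min_eq_left h0]
      simp only [ofNat_val hi, setPos_false]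
      rfl
    · have h1 : s.head i = w.length := le_antisymm (hs i) h0
      obtain ⟨v', hv⟩ := stepAux_stmtRight_end (w := w) (pos := zipPos s.head c) (S := s.stk)
        (false, Fin.ofNat N i) exit exit v (by rw [ofNat_val hi]; exact h1)
      refine ⟨v', (Reach.step ?_).mono (eval_time_pos _ _)⟩
      rw [hM]
      simp only [code, run]
      rw [hv, min_eq_right (by omega), ← h1, Function.update_eq_self]
  | seq p q hp hq =>
    intro Λ M w d emb exit hM hb v s c hs hc
    obtain ⟨v1, h1⟩ := hp M w d (fun y => emb (Sum.inl y)) (emb (Sum.inr (entry q)))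
      (fun x => hM (Sum.inl x)) hb.1 v s c hs hc
    obtain ⟨v2, h2⟩ := hq M w d (fun y => emb (Sum.inr y)) exit
      (fun x => hM (Sum.inr x)) hb.2 v1 (run w p s) c (run_head_le w p s hs) hc
    refine ⟨v2, (h1.trans h2).mono ?_⟩
    simp [time]
  | pop k p q hp hq =>
    intro Λ M w d emb exit hM hb v s c hs hc
    have h0 : Reach M 1 ⟨some (emb none), v, conf N w (zipPos s.head c) s.stk⟩
        ⟨some (if (s.stk k).head? = some true then emb (some (Sum.inl (entry p)))
          else emb (some (Sum.inr (entry q)))), (v.1, (s.stk k).head? == some true),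
          conf N w (zipPos s.head c) (Function.update s.stk k (s.stk k).tail)⟩ := by
      refine Reach.step ?_
      rw [hM none]
      simp only [code, TM2.stepAux]
      rw [conf_update_bits]
      simp only [conf, beq_iff_eq]
    by_cases h : (s.stk k).head? = some true
    · rw [if_pos h] at h0
      obtain ⟨v1, h1⟩ := hp M w d (fun y => emb (some (Sum.inl y))) exit
        (fun x => hM (some (Sum.inl x))) hb.1 _
        ⟨s.head, Function.update s.stk k (s.stk k).tail⟩ c hs hc
      simp only [run, if_pos h]
      refine ⟨v1, (h0.trans h1).mono ?_⟩
      simp [time]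
    · rw [if_neg h] at h0
      obtain ⟨v1, h1⟩ := hq M w d (fun y => emb (some (Sum.inr y))) exit
        (fun x => hM (some (Sum.inr x))) hb.2 _
        ⟨s.head, Function.update s.stk k (s.stk k).tail⟩ c hs hc
      simp only [run, if_neg h]
      refine ⟨v1, (h0.trans h1).mono ?_⟩
      simp [time]
  | test i f p q hp hq =>
    intro Λ M w d emb exit hM hb v s c hs hc
    have h0 : Reach M 1 ⟨some (emb none), v, conf N w (zipPos s.head c) s.stk⟩
        ⟨some (if f w[s.head i]? = true then emb (some (Sum.inl (entry p)))
          else emb (some (Sum.inr (entry q)))), (v.1, f w[s.head i]?),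
          conf N w (zipPos s.head c) s.stk⟩ := by
      refine Reach.step ?_
      rw [hM none]
      simp only [code, TM2.stepAux, conf, zipPos, ofNat_val hb.1, List.head?_drop]
    by_cases h : f w[s.head i]? = true
    · rw [if_pos h] at h0
      obtain ⟨v1, h1⟩ := hp M w d (fun y => emb (some (Sum.inl y))) exit
        (fun x => hM (some (Sum.inl x))) hb.2.1 _ s c hs hc
      simp only [run, if_pos h]
      refine ⟨v1, (h0.trans h1).mono ?_⟩
      simp [time]
    · rw [if_neg h] at h0
      obtain ⟨v1, h1⟩ := hq M w d (fun y => emb (some (Sum.inr y))) exit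
        (fun x => hM (some (Sum.inr x))) hb.2.2 _ s c hs hc
      simp only [run, if_neg h]
      refine ⟨v1, (h0.trans h1).mono ?_⟩
      simp [time]
  | atStart i p q hp hq =>
    intro Λ M w d emb exit hM hb v s c hs hc
    have h0 : Reach M 1 ⟨some (emb none), v, conf N w (zipPos s.head c) s.stk⟩
        ⟨some (if s.head i = 0 then emb (some (Sum.inl (entry p)))
          else emb (some (Sum.inr (entry q)))), (v.1, decide (s.head i = 0)),
          conf N w (zipPos s.head c) s.stk⟩ := by
      have e : (w.take (s.head i)).reverse.head?.isNone = decide (s.head i = 0) := by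
        have := hs i
        by_cases h : s.head i = 0
        · simp [h]
        · have hw : w ≠ [] := by rintro rfl; simp_all
          have : (w.take (s.head i)).getLast?.isSome = true := by
            simp [h, hw]
          simp [h, this]
      refine Reach.step ?_
      rw [hM none]
      simp only [code, TM2.stepAux, conf, zipPos, ofNat_val hb.1]
      rw [e]
      simp
    by_cases h : s.head i = 0
    · rw [if_pos h] at h0
      obtain ⟨v1, h1⟩ := hp M w d (fun y => emb (some (Sum.inl y))) exit
        (fun x => hM (some (Sum.inl x))) hb.2.1 _ s c hs hc
      simp only [run, if_pos h]
      refine ⟨v1, (h0.trans h1).mono ?_⟩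
      simp [time]
    · rw [if_neg h] at h0
      obtain ⟨v1, h1⟩ := hq M w d (fun y => emb (some (Sum.inr y))) exit
        (fun x => hM (some (Sum.inr x))) hb.2.2 _ s c hs hc
      simp only [run, if_neg h]
      refine ⟨v1, (h0.trans h1).mono ?_⟩
      simp [time]
  | loop p hp =>
    intro Λ M w d emb exit hM hb v s c hs hc
    obtain ⟨v', h⟩ := reach_loop (p := p) hb.1 (hM (Sum.inl false)) (hM (Sum.inl true))
      (fun v s c hs hc => hp M w (d + 1) (fun y => emb (Sum.inr y)) (emb (Sum.inl false))
        (fun x => hM (Sum.inr x)) hb.2 v s c hs hc) w.length v s c hs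
      (fun j hj => hc j (by omega)) (hc d le_rfl) le_rfl
    refine ⟨v', ?_⟩
    rw [← show c d = w.length from hc d le_rfl, Function.update_eq_self] at h
    simp only [run, time, Polynomial.eval_add, Polynomial.eval_mul, Polynomial.eval_X,
      Polynomial.eval_one]
    rw [hc d le_rfl] at h
    exact h

end Code

/-! ### The complete machine: copying, running, clearing -/

section Machine

variable {N : ℕ}

/-- Push the scratch letter on the given zippers. -/
def pushAll [Inhabited A] {Λ : Type} (q : MStmt A N Λ) : List (Bool × Fin N) → MStmt A N Λ
  | [] => q
  | z :: zs => .push (.before z) (fun v => v.1.getD default) (pushAll q zs)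

/-- Pop all given stacks. -/
def popAll {Λ : Type} (q : MStmt A N Λ) : List (Reg N) → MStmt A N Λ
  | [] => q
  | k :: ks => .pop k (fun v _ => v) (popAll q ks)

theorem stepAux_pushAll [Inhabited A] {Λ : Type} (q : MStmt A N Λ) (v : Option A × Bool)
    (zs : List (Bool × Fin N)) : ∀ (T : ∀ k, List (RegAlphabet A N k)), zs.Nodup →
    ∃ T' : ∀ k, List (RegAlphabet A N k), TM2.stepAux (pushAll q zs) v T = TM2.stepAux q v T' ∧
      (∀ z ∈ zs, T' (.before z) = (v.1.getD default : A) :: T (.before z)) ∧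
      (∀ k, (∀ z ∈ zs, k ≠ .before z) → T' k = T k) := by
  induction zs with
  | nil => exact fun T _ => ⟨T, rfl, by simp, fun _ _ => rfl⟩
  | cons z zs ih =>
    intro T hn
    rw [List.nodup_cons] at hn
    obtain ⟨T', h1, h2, h3⟩ := ih (Function.update T (.before z) ((v.1.getD default : A) ::
      T (.before z))) hn.2
    refine ⟨T', h1, ?_, ?_⟩
    · intro y hy
      by_cases hyz : y = z
      · subst hyz
        rw [h3 _ (fun x hx e => hn.1 (by injection e with e; exact e ▸ hx)), Function.update_self]
      · have hy' : y ∈ zs := (List.mem_cons.1 hy).resolve_left hyz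
        rw [h2 y hy', Function.update_of_ne (by simpa using hyz)]
    · intro k hk
      rw [h3 k (fun x hx => hk x (List.mem_cons_of_mem _ hx)),
        Function.update_of_ne (hk z List.mem_cons_self)]

theorem stepAux_popAll {Λ : Type} (q : MStmt A N Λ) (v : Option A × Bool)
    (ks : List (Reg N)) : ∀ (T : ∀ k, List (RegAlphabet A N k)), ks.Nodup →
    ∃ T' : ∀ k, List (RegAlphabet A N k), TM2.stepAux (popAll q ks) v T = TM2.stepAux q v T' ∧
      (∀ k ∈ ks, T' k = (T k).tail) ∧ (∀ k, k ∉ ks → T' k = T k) := by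
  induction ks with
  | nil => exact fun T _ => ⟨T, rfl, by simp, fun _ _ => rfl⟩
  | cons k ks ih =>
    intro T hn
    rw [List.nodup_cons] at hn
    obtain ⟨T', h1, h2, h3⟩ := ih (Function.update T k (T k).tail) hn.2
    refine ⟨T', h1, ?_, ?_⟩
    · intro y hy
      by_cases hyz : y = k
      · subst hyz
        rw [h3 _ hn.1, Function.update_self]
      · rw [h2 y ((List.mem_cons.1 hy).resolve_left hyz), Function.update_of_ne hyz]
    · intro y hy
      rw [List.mem_cons, not_or] at hy
      rw [h3 y hy.2, Function.update_of_ne hy.1]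

variable [Inhabited A] [NeZero N]

/-- The machine of a program: it copies the input to all zippers, runs the program, and clears all
stacks before it outputs the bit that the program left on its first stack. -/
noncomputable def machineCode (N : ℕ) [NeZero N] (p : Prog A) :
    Fin 3 ⊕ Label p → MStmt A N (Fin 3 ⊕ Label p)
  | Sum.inl 0 => .pop .inp (fun v x => (x, v.2)) <|
      .branch (fun v => v.1.isSome)
        (pushAll (.goto fun _ => Sum.inl 0) (Finset.univ : Finset (Bool × Fin N)).toList)
        (.goto fun _ => Sum.inr (entry p))
  | Sum.inl 1 => .pop (.bits 0) (fun v x => (v.1, x == some true)) (.goto fun _ => Sum.inl 2)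
  | Sum.inl 2 => .peek (.before (true, 0)) (fun v x => (x, v.2)) <|
      .branch (fun v => v.1.isSome)
        (popAll (.goto fun _ => Sum.inl 2) (Finset.univ : Finset (Reg N)).toList)
        (.push .out (fun v => v.2) <| .load (fun _ => (none, false)) .halt)
  | Sum.inr x => code N p 0 Sum.inr (Sum.inl 1) x

/-- The bundled machine of a program. -/
noncomputable def machine [Fintype A] (N : ℕ) [NeZero N] (p : Prog A) : FinTM2 where
  K := Reg N
  k₀ := .inp
  k₁ := .out
  Γ := RegAlphabet A N
  Λ := Fin 3 ⊕ Label p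
  main := Sum.inl 0
  σ := Option A × Bool
  initialState := (none, false)
  Γk₀Fin := inferInstanceAs (Fintype A)
  m := machineCode N p

/-- The stacks while the input is copied: `u` has been read, `x` is left. -/
def copyConf (N : ℕ) (u x : List A) : ∀ k : Reg N, List (RegAlphabet A N k)
  | .inp => x
  | .out => ([] : List Bool)
  | .before _ => u.reverse
  | .after _ => ([] : List A)
  | .bits _ => ([] : List Bool)

/-- Each letter read is pushed on all `before` stacks at once, so every pointer and every counter
starts at the right end of the word, as `reach_code` requires of the counters. -/
theorem reach_copy (p : Prog A) (x : List A) : ∀ (u : List A) (v : Option A × Bool),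
    ∃ v', Reach (machineCode N p) (x.length + 1) ⟨some (Sum.inl 0), v, copyConf N u x⟩
      ⟨some (Sum.inr (entry p)), v', copyConf N (u ++ x) []⟩ := by
  induction x with
  | nil =>
    intro u v
    refine ⟨(none, v.2), Reach.step ?_⟩
    simp only [machineCode, TM2.stepAux, copyConf, List.head?_nil, Option.isSome_none, cond_false,
      List.tail_nil, List.append_nil]
    congr 1
    exact Function.update_eq_self (Reg.inp : Reg N) (copyConf N u ([] : List A))
  | cons a x ih =>
    intro u v
    obtain ⟨v', h⟩ := ih (u ++ [a]) (some a, v.2)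
    rw [List.append_assoc, List.singleton_append] at h
    refine ⟨v', ((Reach.step ?_).trans h).mono (Nat.add_comm _ _).le⟩
    simp only [machineCode, TM2.stepAux, copyConf, List.head?_cons, Option.isSome_some, cond_true,
      List.tail_cons]
    obtain ⟨T', h1, h2, h3⟩ := stepAux_pushAll (Λ := Fin 3 ⊕ Label p)
      (.goto fun _ => Sum.inl 0) (some a, v.2) (Finset.univ : Finset (Bool × Fin N)).toList
      (Function.update (copyConf N u (a :: x)) .inp x) (Finset.nodup_toList _)
    rw [h1]
    simp only [TM2.stepAux]
    congr 1
    funext k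
    cases k with
    | before z => rw [h2 z (by simp)]; simp [copyConf]
    | _ => rw [h3 _ (by simp)]; simp [copyConf]

/-- All stacks are popped in parallel, and a single stack serves as the clock: counter 0 rests at
the right end, so its `before` stack contains the whole word and no other stack is longer. When it
is empty, all are. -/
theorem reach_clear (p : Prog A) (b : Bool) (m : ℕ) :
    ∀ (o : Option A) (T : ∀ k, List (RegAlphabet A N k)), (T (.before (true, 0))).length = m →
      (∀ k, (T k).length ≤ m) →
      Reach (machineCode N p) (m + 1) ⟨some (Sum.inl 2), (o, b), T⟩
        ⟨none, (none, false), Function.update (fun _ => []) .out ([b] : List Bool)⟩ := by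
  induction m with
  | zero =>
    intro o T h0 hle
    have hT : T = fun _ => [] := by
      funext k
      exact List.eq_nil_of_length_eq_zero (Nat.le_zero.1 (hle k))
    subst hT
    refine Reach.step ?_
    simp [machineCode]
  | succ m ih =>
    intro o T h0 hle
    obtain ⟨T', h1, h2, -⟩ := stepAux_popAll (Λ := Fin 3 ⊕ Label p)
      (.goto fun _ => Sum.inl 2) ((T (.before (true, 0))).head?, b)
      (Finset.univ : Finset (Reg N)).toList T (Finset.nodup_toList _)
    have hl : ∀ k, (T' k).length = (T k).length - 1 := fun k => by
      rw [h2 k (by simp), List.length_tail]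
    have := ih (T (.before (true, 0))).head? T' (by rw [hl, h0]; rfl)
      (fun k => by have := hle k; rw [hl]; omega)
    refine ((Reach.step ?_).trans this).mono (Nat.add_comm _ _).le
    have hs : ((T (.before (true, 0))).head?).isSome = true := by
      rw [List.isSome_head?, ← List.length_pos_iff]
      omega
    simp only [machineCode, TM2.stepAux]
    rw [hs, cond_true, h1]
    simp only [TM2.stepAux]

end Machine

/-- A set that is decided by a loop program is in `P`. -/
theorem inP_of_run {Γ Δ : Type} [Fintype Γ] [Fintype Δ] [Inhabited Γ]
    {L : Set (List Γ × List Δ)} (p : Prog (Γ ⊕ Δ))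
    (hp : ∀ x : List Γ × List Δ, ∃ b, (b = true ↔ x ∈ L) ∧
      (run (encPair x) p ⟨fun _ => (encPair x).length, fun _ => []⟩).stk =
        Function.update (fun _ => []) 0 [b]) : InP L := by
  classical
  have : Inhabited (Γ ⊕ Δ) := ⟨Sum.inl default⟩
  obtain ⟨N, hN⟩ := exists_bounded p 0
  have hN' : Bounded (N + 1) 0 p := hN.mono (Nat.le_succ N)
  refine ⟨{
    tm := machine (N + 1) p
    inputAlphabet := Equiv.refl _
    outputAlphabet := Equiv.refl _
    -- The summands are the copying of the input, the program, the step that takes the answer bit,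
    -- and the clearing of the stacks.
    time := (Polynomial.X + 1) + (time p + (1 + (Polynomial.X + 1)))
    outputsFun := ?_ }⟩
  intro x
  refine Classical.choice ?_
  obtain ⟨b, hb, hstk⟩ := hp x
  set w := encPair x with hw
  set s₀ : PState := ⟨fun _ => w.length, fun _ => []⟩
  have hd : (@decide (x ∈ L) (Classical.propDecidable _)) = b := by
    rw [Bool.eq_iff_iff, hb, decide_eq_true_iff]
  obtain ⟨v1, h1⟩ := reach_copy (N := N + 1) p w [] (none, false)
  have hstart : copyConf (N + 1) ([] ++ w) [] =
      conf (N + 1) w (zipPos s₀.head fun _ => w.length) s₀.stk := by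
    funext k
    cases k with
    | before z => cases z with | mk t i => cases t <;> simp [copyConf, conf, zipPos, s₀]
    | after z => cases z with | mk t i => cases t <;> simp [copyConf, conf, zipPos, s₀]
    | _ => simp [copyConf, conf, s₀]
  rw [hstart] at h1
  obtain ⟨v2, h2⟩ := reach_code (N := N + 1) p (machineCode (N + 1) p) w 0 Sum.inr (Sum.inl 1)
    (fun _ => rfl) hN' v1 s₀ (fun _ => w.length) (fun _ => le_rfl) (fun _ _ => rfl)
  set s₁ := run w p s₀
  have h3 : Reach (machineCode (N + 1) p) 1
      ⟨some (Sum.inl 1), v2, conf (N + 1) w (zipPos s₁.head fun _ => w.length) s₁.stk⟩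
      ⟨some (Sum.inl 2), (v2.1, b),
        conf (N + 1) w (zipPos s₁.head fun _ => w.length) (fun _ => [])⟩ := by
    refine Reach.step ?_
    simp only [machineCode, TM2.stepAux]
    rw [conf_update_bits, hstk]
    simp [conf]
  have h4 := reach_clear (N := N + 1) p b w.length v2.1
    (conf (N + 1) w (zipPos s₁.head fun _ => w.length) (fun _ => []))
    (by simp [conf, zipPos]) (fun k => by cases k <;> simp [conf])
  obtain ⟨m, hm, e⟩ := ((h1.trans (h2.trans (h3.trans h4))))
  refine ⟨⟨⟨m, ?_⟩, ?_⟩⟩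
  · have hinit : initList (machine (N + 1) p) (List.map (Equiv.refl _).invFun w) =
        ⟨some (Sum.inl 0), (none, false), copyConf (N + 1) [] w⟩ := by
      unfold initList
      congr 1
      funext k
      cases k with
      | inp => simp [copyConf, machine]; rfl
      | _ => simp [copyConf, machine]
    have hhalt : haltList (machine (N + 1) p) (List.map (Equiv.refl _).invFun [b]) =
        ⟨none, (none, false), Function.update (fun _ => []) .out ([b] : List Bool)⟩ := by
      unfold haltList
      congr 1
      funext k
      cases k with
      | _ => rfl
    rw [hd]
    refine Eq.trans ?_ (e.trans ?_)
    · exact congrArg (fun c => (flip bind (TM2.step (machineCode (N + 1) p)))^[m] (some c)) hinit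
    · exact congrArg some hhalt.symm
  · refine hm.trans (le_of_eq ?_)
    simp

end Prog

/-! ### Tuples of pointers -/

/-- Tuples of pointer positions, laid out in consecutive pointers. -/
class Ctx (C : Type) where
  lvl : ℕ
  get : (ℕ → ℕ) → C
  get_congr : ∀ {h h' : ℕ → ℕ}, (∀ i < lvl, h i = h' i) → get h = get h'

instance : Ctx Unit where
  lvl := 0
  get _ := ()
  get_congr _ := rfl

instance : Ctx ℕ where
  lvl := 1
  get h := h 0
  get_congr h := h 0 Nat.one_pos

instance {C T : Type} [Ctx C] [Ctx T] : Ctx (C × T) where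
  lvl := Ctx.lvl C + Ctx.lvl T
  get h := (Ctx.get h, Ctx.get fun i => h (Ctx.lvl C + i))
  get_congr h := Prod.ext (Ctx.get_congr fun i hi => h i (by omega))
    (Ctx.get_congr fun i hi => h _ (by omega))

/-- Maps that select consecutive components of a tuple. -/
def Proj {C D : Type} [Ctx C] [Ctx D] (f : C → D) : Prop :=
  ∃ k, k + Ctx.lvl D ≤ Ctx.lvl C ∧ ∀ h : ℕ → ℕ, f (Ctx.get h) = Ctx.get fun i => h (k + i)

section Proj

variable {C D E : Type} [Ctx C] [Ctx D] [Ctx E]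

theorem Proj.id : Proj fun c : C => c :=
  ⟨0, by simp, fun h => by simp⟩

theorem Proj.fst {f : C → D × E} (hf : Proj f) : Proj fun c => (f c).1 := by
  obtain ⟨k, hk, h⟩ := hf
  have e : Ctx.lvl (D × E) = Ctx.lvl D + Ctx.lvl E := rfl
  exact ⟨k, by omega, fun g => congrArg Prod.fst (h g)⟩

theorem Proj.snd {f : C → D × E} (hf : Proj f) : Proj fun c => (f c).2 := by
  obtain ⟨k, hk, h⟩ := hf
  have e : Ctx.lvl (D × E) = Ctx.lvl D + Ctx.lvl E := rfl
  refine ⟨k + Ctx.lvl D, by omega, fun g => ?_⟩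
  refine (congrArg Prod.snd (h g)).trans ?_
  simp only [Ctx.get, add_assoc]

theorem Proj.nat {f : C → ℕ} (hf : Proj f) :
    ∃ k < Ctx.lvl C, ∀ h : ℕ → ℕ, f (Ctx.get h) = h k := by
  obtain ⟨k, hk, h⟩ := hf
  exact ⟨k, hk, h⟩

end Proj

/-! ### Stack transformations computed by programs -/

section Computes

variable {A : Type}

/-- Some program transforms the stacks according to `F`, depending on the word and a tuple of
pointer positions, which it leaves unchanged. -/
def Computes (C : Type) [Ctx C] (F : List A → C → Stacks → Stacks) : Prop :=
  ∃ p : Prog A, ∀ (w : List A) (s : PState), (∀ i, s.head i ≤ w.length) →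
    (p.run w s).stk = F w (Ctx.get s.head) s.stk ∧ ∀ i < Ctx.lvl C, (p.run w s).head i = s.head i

variable {C T U : Type} [Ctx C] [Ctx T] [Ctx U] {F G : List A → C → Stacks → Stacks}

theorem Computes.congr (hF : Computes C F) (h : ∀ w c S, F w c S = G w c S) : Computes C G := by
  have : F = G := by
    funext w c S
    exact h w c S
  exact this ▸ hF

theorem Computes.skip : Computes (A := A) C fun _ _ S => S :=
  ⟨.skip, fun _ _ _ => ⟨rfl, fun _ _ => rfl⟩⟩

theorem Computes.push (k : Fin 4) (b : Bool) :
    Computes (A := A) C fun _ _ S => Function.update S k (b :: S k) :=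
  ⟨.push k b, fun _ _ _ => ⟨rfl, fun _ _ => rfl⟩⟩

theorem Computes.seq (hF : Computes C F) (hG : Computes C G) :
    Computes C fun w c S => G w c (F w c S) := by
  obtain ⟨p, hp⟩ := hF
  obtain ⟨q, hq⟩ := hG
  refine ⟨.seq p q, fun w s hs => ?_⟩
  obtain ⟨h1, h2⟩ := hp w s hs
  obtain ⟨h3, h4⟩ := hq w _ (p.run_head_le w s hs)
  refine ⟨?_, fun i hi => (h4 i hi).trans (h2 i hi)⟩
  simp only [Prog.run]
  rw [h3, h1, Ctx.get_congr h2]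

theorem Computes.pop (k : Fin 4) (hF : Computes C F) (hG : Computes C G) :
    Computes C fun w c S => if (S k).head? = some true then F w c (Function.update S k (S k).tail)
      else G w c (Function.update S k (S k).tail) := by
  obtain ⟨p, hp⟩ := hF
  obtain ⟨q, hq⟩ := hG
  refine ⟨.pop k p q, fun w s hs => ?_⟩
  simp only [Prog.run]
  split_ifs
  · exact hp w ⟨s.head, _⟩ hs
  · exact hq w ⟨s.head, _⟩ hs

theorem Computes.test {t : C → ℕ} (ht : Proj t) (f : Option A → Bool) (hF : Computes C F)
    (hG : Computes C G) :
    Computes C fun w c S => if f w[t c]? = true then F w c S else G w c S := by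
  obtain ⟨k, hk, h⟩ := ht.nat
  obtain ⟨p, hp⟩ := hF
  obtain ⟨q, hq⟩ := hG
  refine ⟨.test k f p q, fun w s hs => ?_⟩
  simp only [Prog.run, h]
  split_ifs
  · exact hp w s hs
  · exact hq w s hs

/-- The bound variable lives in the pointer with index `Ctx.lvl C`, the first one that a program for
`C` may change. One loop of left moves brings it to 0; then the body and a right move alternate, so
that the body sees the positions 0, ..., n in turn. The right move after the last body is blocked by
the end of the word. -/
theorem Computes.forNat {F : List A → C × ℕ → Stacks → Stacks} (hF : Computes (C × ℕ) F) :
    Computes C fun w c S => (List.range (w.length + 1)).foldl (fun S x => F w (c, x) S) S := by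
  obtain ⟨p, hp⟩ := hF
  have lvl_eq : Ctx.lvl (C × ℕ) = Ctx.lvl C + 1 := rfl
  set i := Ctx.lvl C with hi
  refine ⟨.seq (.loop (.left i)) (.loop (.seq p (.right i))), fun w s hs => ?_⟩
  have rewind : ∀ t, (Prog.run w (.left i))^[t] s =
      ⟨Function.update s.head i (s.head i - t), s.stk⟩ := by
    intro t
    induction t with
    | zero => simp
    | succ t ih =>
      rw [Function.iterate_succ_apply', ih]
      simp only [Prog.run, Function.update_self, Function.update_idem]
      rw [Nat.sub_sub]
  rw [Prog.run, Prog.run, Prog.run, rewind, Nat.sub_eq_zero_of_le ((hs i).trans (Nat.le_succ _))]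
  set s₀ : PState := ⟨Function.update s.head i 0, s.stk⟩
  have hs₀ : ∀ j, s₀.head j ≤ w.length := by
    intro j
    simp only [s₀, Function.update_apply]
    split_ifs
    · exact Nat.zero_le _
    · exact hs j
  have main : ∀ t, (∀ j, ((Prog.run w (.seq p (.right i)))^[t] s₀).head j ≤ w.length) ∧
      ((Prog.run w (.seq p (.right i)))^[t] s₀).head i = min t w.length ∧
      (∀ j < i, ((Prog.run w (.seq p (.right i)))^[t] s₀).head j = s.head j) ∧
      (t ≤ w.length + 1 → ((Prog.run w (.seq p (.right i)))^[t] s₀).stk =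
        (List.range t).foldl (fun S x => F w (Ctx.get s.head, x) S) s.stk) := by
    intro t
    induction t with
    | zero =>
      refine ⟨hs₀, by simp [s₀], fun j hj => ?_, fun _ => rfl⟩
      simp only [Function.iterate_zero, id_eq, s₀]
      exact Function.update_of_ne hj.ne _ _
    | succ t ih =>
      obtain ⟨h1, h2, h3, h4⟩ := ih
      rw [Function.iterate_succ_apply']
      set s₁ := (Prog.run w (.seq p (.right i)))^[t] s₀
      obtain ⟨e1, e2⟩ := hp w s₁ h1
      refine ⟨Prog.run_head_le w _ _ h1, ?_, fun j hj => ?_, fun ht => ?_⟩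
      · simp only [Prog.run, Function.update_self]
        rw [e2 i (by omega), h2]
        omega
      · simp only [Prog.run]
        rw [Function.update_of_ne hj.ne, e2 j (by omega), h3 j hj]
      · simp only [Prog.run]
        rw [e1, h4 (by omega), List.range_succ, List.foldl_append]
        simp only [List.foldl_cons, List.foldl_nil]
        congr 1
        refine Prod.ext (Ctx.get_congr h3) ?_
        change s₁.head i = t
        rw [h2]
        omega
  obtain ⟨-, -, h3, h4⟩ := main (w.length + 1)
  exact ⟨h4 le_rfl, h3⟩

/-- Types of tuples whose bounded members can be enumerated by nested loops. -/
class Enum (T : Type) [Ctx T] where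
  enum : ℕ → List T
  computes_for : ∀ {A C : Type} [Ctx C] {F : List A → C × T → Stacks → Stacks},
    Computes (C × T) F →
      Computes C fun w c S => (enum w.length).foldl (fun S x => F w (c, x) S) S

instance : Enum ℕ where
  enum n := List.range (n + 1)
  computes_for := Computes.forNat

/-- Both ways of bracketing use the same pointers in the same order, so the program does not change.
This turns enumeration of pairs into two nested loops. -/
theorem Computes.assoc {F : List A → C × (T × U) → Stacks → Stacks}
    (hF : Computes (C × (T × U)) F) :
    Computes ((C × T) × U) fun w x => F w (x.1.1, (x.1.2, x.2)) := by
  obtain ⟨p, hp⟩ := hF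
  refine ⟨p, fun w s hs => ?_⟩
  obtain ⟨h1, h2⟩ := hp w s hs
  have e : Ctx.lvl (C × (T × U)) = Ctx.lvl C + (Ctx.lvl T + Ctx.lvl U) := rfl
  have e' : Ctx.lvl ((C × T) × U) = Ctx.lvl C + Ctx.lvl T + Ctx.lvl U := rfl
  refine ⟨?_, fun i hi => h2 i (by omega)⟩
  rw [h1]
  simp only [Ctx.get, add_assoc, Ctx.lvl]

instance [Enum T] [Enum U] : Enum (T × U) where
  enum n := (Enum.enum n).flatMap fun t => (Enum.enum n).map fun u => (t, u)
  computes_for hF := by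
    refine (Enum.computes_for (T := T) (Enum.computes_for (T := U) hF.assoc)).congr ?_
    intro w c S
    rw [List.foldl_flatMap]
    simp only [List.foldl_map]

theorem mem_enum_nat {n x : ℕ} : x ∈ Enum.enum (T := ℕ) n ↔ x ≤ n := by
  simp [Enum.enum]

theorem mem_enum_prod [Enum T] [Enum U] {n : ℕ} {x : T × U} :
    x ∈ Enum.enum n ↔ x.1 ∈ Enum.enum n ∧ x.2 ∈ Enum.enum n := by
  obtain ⟨t, u⟩ := x
  simp [Enum.enum]

/-! ### Definable relations -/

/-- Put a bit on the first stack. -/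
abbrev pushBit (S : Stacks) (b : Bool) : Stacks := Function.update S 0 (b :: S 0)

open Classical in
/-- Relations between a word and a tuple of positions that are decided by programs. -/
def Def (C : Type) [Ctx C] (R : List A → C → Prop) : Prop :=
  Computes C fun w c S => pushBit S (decide (R w c))

variable {R Q : List A → C → Prop}

theorem Def.congr (hR : Def C R) (h : ∀ w c, Q w c ↔ R w c) : Def C Q := by
  have : Q = R := by
    funext w c
    exact propext (h w c)
  exact this ▸ hR

theorem Def.const (b : Prop) : Def (A := A) C fun _ _ => b :=
  Computes.push 0 _

theorem Def.test {t : C → ℕ} (ht : Proj t) (f : Option A → Bool) :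
    Def C fun w c => f w[t c]? = true := by
  refine (Computes.test ht f (Computes.push 0 true) (Computes.push 0 false)).congr ?_
  intro w c S
  split_ifs with h <;> simp [h]

theorem Def.not (hR : Def C R) : Def C fun w c => ¬ R w c := by
  refine (hR.seq (Computes.pop 0 (Computes.push 0 false) (Computes.push 0 true))).congr ?_
  intro w c S
  by_cases h : R w c <;> simp [h]

theorem Def.and (hR : Def C R) (hQ : Def C Q) : Def C fun w c => R w c ∧ Q w c := by
  refine (hR.seq (Computes.pop 0 hQ (Computes.push 0 false))).congr ?_
  intro w c S
  by_cases h : R w c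
  · simp only [h, decide_true, Function.update_self, List.head?_cons, if_true, List.tail_cons,
      Function.update_idem, Function.update_eq_self]
    refine congrArg (pushBit S) (Bool.eq_iff_iff.2 ?_)
    simp [h]
  · simp [h]

theorem Def.or (hR : Def C R) (hQ : Def C Q) : Def C fun w c => R w c ∨ Q w c :=
  (hR.not.and hQ.not).not.congr fun w c => by tauto

theorem Def.imp (hR : Def C R) (hQ : Def C Q) : Def C fun w c => R w c → Q w c :=
  (hR.and hQ.not).not.congr fun w c => by tauto

theorem Def.iff (hR : Def C R) (hQ : Def C Q) : Def C fun w c => (R w c ↔ Q w c) :=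
  ((hR.imp hQ).and (hQ.imp hR)).congr fun w c => by tauto

/-- Whenever a bit is on top of the first stack, replace the two topmost bits by their
disjunction. -/
theorem computes_or : Computes (A := A) C fun _ _ S =>
    if (S 0).head? = some true then pushBit (Function.update S 0 (S 0).tail.tail) true
    else Function.update S 0 (S 0).tail := by
  refine (Computes.pop 0 ((Computes.pop 0 Computes.skip Computes.skip).seq (Computes.push 0 true))
    Computes.skip).congr ?_
  intro w c S
  split_ifs <;> simp

/-- A running disjunction, initially false, lies on the first stack; each pass pushes the truth
value for the current tuple and merges the two topmost bits. -/
theorem Def.exists_enum [Enum T] {R : List A → C → T → Prop}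
    (hR : Def (C × T) fun w x => R w x.1 x.2) :
    Def C fun w c => ∃ x ∈ Enum.enum w.length, R w c x := by
  classical
  refine ((Computes.push 0 false).seq (Enum.computes_for (hR.seq computes_or))).congr ?_
  intro w c S
  have : ∀ (E : List T) (b : Bool), E.foldl (fun S x => if ((pushBit S (decide (R w c x))) 0).head?
      = some true then pushBit (Function.update (pushBit S (decide (R w c x))) 0
        ((pushBit S (decide (R w c x))) 0).tail.tail) true
      else Function.update (pushBit S (decide (R w c x))) 0
        ((pushBit S (decide (R w c x))) 0).tail) (pushBit S b) =
      pushBit S (b || decide (∃ x ∈ E, R w c x)) := by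
    intro E
    induction E with
    | nil => intro b; simp
    | cons x E ih =>
      intro b
      rw [List.foldl_cons]
      by_cases h : R w c x
      · simpa [h] using ih true
      · simpa [h] using ih b
  refine (this _ false).trans ?_
  rw [Bool.false_or]
  congr

theorem Def.ex {R : List A → C → ℕ → Prop} (hR : Def (C × ℕ) fun w x => R w x.1 x.2) :
    Def C fun w c => ∃ x ≤ w.length, R w c x :=
  (Def.exists_enum hR).congr fun w c => by simp only [mem_enum_nat]

theorem Def.all {R : List A → C → ℕ → Prop} (hR : Def (C × ℕ) fun w x => R w x.1 x.2) :
    Def C fun w c => ∀ x ≤ w.length, R w c x :=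
  (Def.ex (R := fun w c x => ¬ R w c x) hR.not).not.congr fun w c => by push Not; rfl

end Computes

/-! ### Comparison of positions -/

section Comparison

variable {A : Type} {w : List A} {i j : ℕ}

/-- Move two pointers to the left together if possible, recording success. -/
def bothLeft (A : Type) (i j : ℕ) : Prog A :=
  .atStart i (.push 1 false) (.atStart j (.push 1 false)
    (.seq (.left i) (.seq (.left j) (.push 1 true))))

/-- Undo a recorded move of two pointers. -/
def bothRight (A : Type) (i j : ℕ) : Prog A :=
  .pop 1 (.seq (.right i) (.right j)) .skip

/-- The moves succeed until one pointer is at 0, and from then on every round records `false`. Thus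
`t` rounds leave exactly `t` record bits, and the number of `true` among them is the common
displacement. -/
theorem iterate_bothLeft (hij : i ≠ j) (s : PState) (t : ℕ) :
    ((bothLeft A i j).run w)^[t] s =
      ⟨Function.update (Function.update s.head i (s.head i - min t (min (s.head i) (s.head j)))) j
        (s.head j - min t (min (s.head i) (s.head j))),
      Function.update s.stk 1 (List.replicate (t - min t (min (s.head i) (s.head j))) false ++
        (List.replicate (min t (min (s.head i) (s.head j))) true ++ s.stk 1))⟩ := by
  induction t with
  | zero => simp
  | succ t ih =>
    rw [Function.iterate_succ_apply', ih]
    set m := min (s.head i) (s.head j) with hm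
    rcases Nat.lt_or_ge t m with h | h
    · have h1 : s.head i - t ≠ 0 := by omega
      have h2 : s.head j - t ≠ 0 := by omega
      rw [min_eq_left h.le, min_eq_left (show t + 1 ≤ m from h)]
      simp only [bothLeft, Prog.run, Function.update_self, Function.update_of_ne hij,
        Function.update_of_ne hij.symm, h1, h2, if_false, Nat.sub_self, List.replicate_zero,
        List.nil_append, Function.update_idem, List.replicate_succ, List.cons_append]
      rw [Function.update_comm hij, Function.update_idem, Function.update_comm hij.symm,
        Function.update_idem, Nat.sub_sub, Nat.sub_sub]
    · have h0 : s.head i - m = 0 ∨ s.head j - m = 0 := by omega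
      rw [min_eq_right h, min_eq_right (h.trans (Nat.le_succ t)), Nat.succ_sub h]
      rcases h0 with h0 | h0 <;>
      simp [bothLeft, Prog.run, Function.update_of_ne hij, h0, List.replicate_succ]

theorem iterate_bothRight (hij : i ≠ j) (r : List Bool) (l : List Bool) : ∀ s : PState,
    s.stk 1 = l ++ r → s.head i + l.count true ≤ w.length → s.head j + l.count true ≤ w.length →
    ((bothRight A i j).run w)^[l.length] s =
      ⟨Function.update (Function.update s.head i (s.head i + l.count true)) j
        (s.head j + l.count true), Function.update s.stk 1 r⟩ := by
  induction l with
  | nil =>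
    intro s h _ _
    have : r = s.stk 1 := by simpa using h.symm
    simp [this]
  | cons b l ih =>
    intro s h h1 h2
    rw [List.length_cons, Function.iterate_succ_apply]
    cases b with
    | false =>
      have e : (bothRight A i j).run w s = ⟨s.head, Function.update s.stk 1 (l ++ r)⟩ := by
        simp [bothRight, Prog.run, h]
      rw [List.count_cons_of_ne (by simp)] at h1 h2 ⊢
      rw [e, ih ⟨s.head, Function.update s.stk 1 (l ++ r)⟩ (by simp) h1 h2]
      simp only [Function.update_idem]
    | true =>
      rw [List.count_cons_self] at h1 h2 ⊢
      have e : (bothRight A i j).run w s =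
          ⟨Function.update (Function.update s.head i (s.head i + 1)) j (s.head j + 1),
            Function.update s.stk 1 (l ++ r)⟩ := by
        simp only [bothRight, Prog.run, h, List.cons_append, List.head?_cons, if_true,
          List.tail_cons, Function.update_of_ne hij.symm]
        rw [min_eq_left (by omega), min_eq_left (by omega)]
      rw [e, ih _ (by simp)]
      · simp only [Function.update_self, Function.update_of_ne hij, Function.update_idem]
        rw [Function.update_comm hij, Function.update_idem, Function.update_comm hij.symm,
          Function.update_idem, add_right_comm, add_assoc, add_right_comm, add_assoc]
      · simp only [Function.update_self, Function.update_of_ne hij]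
        omega
      · simp only [Function.update_self]
        omega

/-- After n + 1 joint moves to the left the smaller pointer is at 0, so pointer `i` is at 0 exactly
if it was not beyond pointer `j`. The n + 1 record bits on the second stack are then consumed to
restore both pointers. -/
theorem Def.le {C : Type} [Ctx C] {t u : C → ℕ} (ht : Proj t) (hu : Proj u) :
    Def (A := A) C fun _ c => t c ≤ u c := by
  classical
  obtain ⟨i, hi, h1⟩ := ht.nat
  obtain ⟨j, hj, h2⟩ := hu.nat
  -- Joint moves would move a shared pointer twice per round, so this case is separate; the
  -- comparison is then trivially true.
  by_cases hij : i = j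
  · subst hij
    refine ⟨.push 0 true, fun w s _ => ⟨?_, fun _ _ => rfl⟩⟩
    simp [Prog.run, h1, h2]
  refine ⟨.seq (.loop (bothLeft A i j)) (.seq (.atStart i (.push 0 true) (.push 0 false))
    (.loop (bothRight A i j))), fun w s hs => ?_⟩
  have hi' := hs i
  have hj' := hs j
  have e1 : (Prog.loop (bothLeft A i j)).run w s = _ := iterate_bothLeft hij s (w.length + 1)
  rw [Prog.run, e1]
  set m := min (s.head i) (s.head j) with hm
  have hmin : min (w.length + 1) m = m := by omega
  rw [hmin]
  set s₁ : PState := ⟨Function.update (Function.update s.head i (s.head i - m)) j (s.head j - m),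
    Function.update s.stk 1 (List.replicate (w.length + 1 - m) false ++
      (List.replicate m true ++ s.stk 1))⟩ with hs₁
  have e2 : (Prog.atStart i (.push 0 true) (.push 0 false)).run w s₁ =
      ⟨s₁.head, pushBit s₁.stk (decide (s.head i ≤ s.head j))⟩ := by
    have : s₁.head i = 0 ↔ s.head i ≤ s.head j := by
      simp only [hs₁, Function.update_of_ne hij, Function.update_self]
      omega
    simp only [Prog.run, this]
    split_ifs with h <;> simp [h]
  set l := List.replicate (w.length + 1 - m) false ++ List.replicate m true with hl
  have hlen : l.length = w.length + 1 := by
    simp only [hl, List.length_append, List.length_replicate]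
    omega
  have hcount : l.count true = m := by simp [hl, List.count_replicate]
  rw [Prog.run, e2, Prog.run, ← hlen, iterate_bothRight hij (s.stk 1) l]
  · refine ⟨?_, fun k _ => ?_⟩
    · simp only [h1, h2]
      funext k
      fin_cases k <;> simp [hs₁]
    · simp only [hcount, hs₁, Function.update_self, Function.update_of_ne hij]
      by_cases hkj : k = j
      · subst hkj
        simp only [Function.update_self]
        omega
      · by_cases hki : k = i
        · subst hki
          simp only [Function.update_of_ne hkj, Function.update_self]
          omega
        · simp [hkj, hki]
  · simp [hs₁, hl]
  · simp only [hcount, hs₁, Function.update_self, Function.update_of_ne hij]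
    omega
  · simp only [hcount, hs₁, Function.update_self]
    omega

theorem Def.lt {C : Type} [Ctx C] {t u : C → ℕ} (ht : Proj t) (hu : Proj u) :
    Def (A := A) C fun _ c => t c < u c :=
  (Def.le hu ht).not.congr fun _ _ => not_le.symm

theorem Def.eq {C : Type} [Ctx C] {t u : C → ℕ} (ht : Proj t) (hu : Proj u) :
    Def (A := A) C fun _ c => t c = u c :=
  ((Def.le ht hu).and (Def.le hu ht)).congr fun _ _ => le_antisymm_iff

end Comparison

/-! ### Least fixed points -/

/-- The least set of tuples such that `u` belongs to it whenever, for some bounded `v`, it contains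
all bounded `z` with `G u v z`. -/
inductive Derivable {T : Type} (E : List T) (G : T → T → T → Prop) : T → Prop
  | intro (u v : T) : v ∈ E → (∀ z ∈ E, G u v z → Derivable E G z) → Derivable E G u

/-- One round of the computation of the least fixed point. -/
def derivStep {T : Type} (E : List T) (G : T → T → T → Prop) (X : T → Prop) (u : T) : Prop :=
  ∃ v ∈ E, ∀ z ∈ E, G u v z → X z

/-- The stages increase. If each of the first |E| + 1 steps added a member of E, then stage |E| + 1
would contain more than |E| of them; so on E the stages are stable after at most |E| rounds. -/
theorem derivStep_iterate_iff {T : Type} (E : List T) (G : T → T → T → Prop) {u : T}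
    (hu : u ∈ E) : (derivStep E G)^[E.length] (fun _ => False) u ↔ Derivable E G u := by
  classical
  set X : ℕ → T → Prop := fun t => (derivStep E G)^[t] fun _ => False with hX
  have hsucc : ∀ t, X (t + 1) = derivStep E G (X t) := fun t => Function.iterate_succ_apply' ..
  have mono1 : ∀ t u, X t u → X (t + 1) u := by
    intro t
    induction t with
    | zero => exact fun u h => h.elim
    | succ t ih =>
      intro u h
      rw [hsucc] at h ⊢
      obtain ⟨v, hv, h⟩ := h
      exact ⟨v, hv, fun z hz hg => ih z (h z hz hg)⟩
  have mono : ∀ t t', t ≤ t' → ∀ u, X t u → X t' u := by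
    intro t t' h
    induction h with
    | refl => exact fun u h => h
    | step _ ih => exact fun u h => mono1 _ u (ih u h)
  constructor
  · suffices ∀ t u, X t u → Derivable E G u from this _ u
    intro t
    induction t with
    | zero => exact fun u h => h.elim
    | succ t ih =>
      intro u h
      rw [hsucc] at h
      obtain ⟨v, hv, h⟩ := h
      exact .intro u v hv fun z hz hg => ih z (h z hz hg)
  · obtain ⟨t, ht, hfix⟩ : ∃ t ≤ E.length, ∀ z ∈ E, X (t + 1) z → X t z := by
      by_contra! hcon
      have hcard : ∀ t ≤ E.length + 1, t ≤ (E.toFinset.filter (X t)).card := by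
        intro t
        induction t with
        | zero => exact fun _ => Nat.zero_le _
        | succ t ih =>
          intro ht
          obtain ⟨z, hz, h1, h2⟩ := hcon t (by omega)
          refine (ih (by omega)).trans_lt (Finset.card_lt_card ?_)
          rw [Finset.ssubset_iff_of_subset fun u hu => by
            rw [Finset.mem_filter] at hu ⊢
            exact ⟨hu.1, mono1 t u hu.2⟩]
          exact ⟨z, by simp [hz, h1], by simp [h2]⟩
      have h1 := hcard _ le_rfl
      have h2 := (Finset.card_filter_le E.toFinset (X (E.length + 1))).trans
        (List.toFinset_card_le E)
      omega
    intro h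
    refine mono t _ ht u ?_
    induction h with
    | intro u v hv _ ih =>
      apply hfix u hu
      rw [hsucc]
      exact ⟨v, hv, fun z hz hg => ih z hz hg hz⟩

section LeastFixedPoint

/-- The truth value of a proposition. -/
noncomputable def truth (p : Prop) : Bool := @decide p (Classical.propDecidable p)

@[simp] theorem truth_eq_true_iff {p : Prop} : truth p = true ↔ p := by simp [truth]

@[simp] theorem truth_true : truth True = true := by simp [truth]

@[simp] theorem truth_false : truth False = false := by simp [truth]

variable {A C T : Type} [Ctx C] [Ctx T]

theorem stacks_eta (S : Stacks) : ![S 0, S 1, S 2, S 3] = S := by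
  funext k
  fin_cases k <;> rfl

section Update

variable (a b c d x : List Bool)

theorem update_vec_zero : Function.update (![a, b, c, d] : Stacks) 0 x = ![x, b, c, d] := by
  funext k
  fin_cases k <;> rfl

theorem update_vec_one : Function.update (![a, b, c, d] : Stacks) 1 x = ![a, x, c, d] := by
  funext k
  fin_cases k <;> rfl

theorem update_vec_two : Function.update (![a, b, c, d] : Stacks) 2 x = ![a, b, x, d] := by
  funext k
  fin_cases k <;> rfl

theorem update_vec_three : Function.update (![a, b, c, d] : Stacks) 3 x = ![a, b, c, x] := by
  funext k
  fin_cases k <;> rfl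

theorem vec_zero : (![a, b, c, d] : Stacks) 0 = a := rfl
theorem vec_one : (![a, b, c, d] : Stacks) 1 = b := rfl

end Update

theorem exists_computes_move_two_one : ∃ F, Computes (A := A) C F ∧ ∀ w c (b : Bool)
    (s₀ s₁ s₂ s₃ : List Bool), F w c ![s₀, s₁, b :: s₂, s₃] = ![s₀, b :: s₁, s₂, s₃] := by
  refine ⟨_, Computes.pop 2 (Computes.push 1 true) (Computes.push 1 false), ?_⟩
  intro w c b s₀ s₁ s₂ s₃
  cases b <;> simp [update_vec_one, update_vec_two]

theorem exists_computes_move_three_one : ∃ F, Computes (A := A) C F ∧ ∀ w c (b : Bool)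
    (s₀ s₁ s₂ s₃ : List Bool), F w c ![s₀, s₁, s₂, b :: s₃] = ![s₀, b :: s₁, s₂, s₃] := by
  refine ⟨_, Computes.pop 3 (Computes.push 1 true) (Computes.push 1 false), ?_⟩
  intro w c b s₀ s₁ s₂ s₃
  cases b <;> simp [update_vec_one, update_vec_three]

theorem exists_computes_move_zero_three : ∃ F, Computes (A := A) C F ∧ ∀ w c (b : Bool)
    (s₀ s₁ s₂ s₃ : List Bool), F w c ![b :: s₀, s₁, s₂, s₃] = ![s₀, s₁, s₂, b :: s₃] := by
  refine ⟨_, Computes.pop 0 (Computes.push 3 true) (Computes.push 3 false), ?_⟩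
  intro w c b s₀ s₁ s₂ s₃
  cases b <;> simp [update_vec_zero, update_vec_three]

theorem exists_computes_drop_one : ∃ F, Computes (A := A) C F ∧ ∀ w c (b : Bool)
    (s₀ s₁ s₂ s₃ : List Bool), F w c ![s₀, b :: s₁, s₂, s₃] = ![s₀, s₁, s₂, s₃] := by
  refine ⟨_, Computes.pop 1 Computes.skip Computes.skip, ?_⟩
  intro w c b s₀ s₁ s₂ s₃
  cases b <;> simp [update_vec_one]

theorem exists_computes_or_zero : ∃ F, Computes (A := A) C F ∧ ∀ w c (a b : Bool)
    (s₀ s₁ s₂ s₃ : List Bool), F w c ![b :: a :: s₀, s₁, s₂, s₃] = ![(a || b) :: s₀, s₁, s₂, s₃] :=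
    by
  refine ⟨_, computes_or, ?_⟩
  intro w c a b s₀ s₁ s₂ s₃
  cases b <;> simp [update_vec_zero, pushBit]

variable {R : List A → C → T → Prop}

/-- The treatment of one table entry `b`: it moves from the second to the third stack, and the
implication from `R` to `b` is conjoined to the accumulator on the first stack. -/
theorem exists_computes_guard (hR : Def (C × T) fun w x => R w x.1 x.2) :
    ∃ F, Computes (A := A) (C × T) F ∧ ∀ w x (a b : Bool) (s₀ s₁ s₂ s₃ : List Bool),
      F w x ![a :: s₀, b :: s₁, s₂, s₃] =
        ![(a && (!truth (R w x.1 x.2) || b)) :: s₀, s₁, b :: s₂, s₃] := by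
  refine ⟨_, hR.seq (Computes.pop 0
    (Computes.pop 1 (Computes.push 2 true) ((Computes.push 2 false).seq
      ((Computes.pop 0 Computes.skip Computes.skip).seq (Computes.push 0 false))))
    (Computes.pop 1 (Computes.push 2 true) (Computes.push 2 false))), ?_⟩
  intro w x a b s₀ s₁ s₂ s₃
  by_cases h : R w x.1 x.2 <;> cases b <;>
    simp [h, update_vec_zero, update_vec_one, update_vec_two]

variable [Enum T]

/-- With the table `χ` on the second stack, check that `χ` holds for all `z` with `R z`. -/
theorem exists_computes_forall (hR : Def (C × T) fun w x => R w x.1 x.2) :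
    ∃ F, Computes (A := A) C F ∧ ∀ w c (χ : T → Bool) (s₀ s₁ s₂ s₃ : List Bool),
      F w c ![s₀, (Enum.enum w.length).map χ ++ s₁, s₂, s₃] =
        ![truth (∀ z ∈ Enum.enum w.length, R w c z → χ z = true) :: s₀,
          (Enum.enum w.length).map χ ++ s₁, s₂, s₃] := by
  obtain ⟨F, hF, eF⟩ := exists_computes_guard hR
  obtain ⟨M, hM, eM⟩ := exists_computes_move_two_one (A := A) (C := C × T)
  refine ⟨_, ((Computes.push 0 true).seq (Enum.computes_for (T := T) hF)).seq
    (Enum.computes_for (T := T) hM), ?_⟩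
  intro w c χ s₀ s₁ s₂ s₃
  -- Scanning consumes the table and leaves it reversed on the third stack; `move` reverses it once
  -- more and thereby restores it.
  have scan : ∀ (E : List T) (a : Bool) (s₂ : List Bool),
      E.foldl (fun S x => F w (c, x) S) ![a :: s₀, E.map χ ++ s₁, s₂, s₃] =
        ![(a && truth (∀ z ∈ E, R w c z → χ z = true)) :: s₀, s₁, (E.map χ).reverse ++ s₂, s₃] := by
    intro E
    induction E with
    | nil => intro a s₂; simp
    | cons z E ih =>
      intro a s₂
      rw [List.foldl_cons, List.map_cons, List.cons_append, eF, ih]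
      by_cases h : R w c z <;> cases hz : χ z <;> simp [h, hz]
  have move : ∀ (E : List T) (l s₀ s₁ s₂ s₃ : List Bool), l.length = E.length →
      E.foldl (fun S x => M w (c, x) S) ![s₀, s₁, l ++ s₂, s₃] =
        ![s₀, l.reverse ++ s₁, s₂, s₃] := by
    intro E
    induction E with
    | nil =>
      intro l s₀ s₁ s₂ s₃ hl
      simp [List.eq_nil_of_length_eq_zero hl]
    | cons z E ih =>
      intro l s₀ s₁ s₂ s₃ hl
      obtain _ | ⟨b, l⟩ := l
      · simp at hl
      · rw [List.foldl_cons, List.cons_append, eM, ih l _ _ _ _ (by simpa using hl)]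
        simp
  rw [update_vec_zero, vec_zero, scan, move _ _ _ _ _ _ (by simp)]
  simp

/-- One round of the fixed point computation on the table on the second stack. -/
theorem exists_computes_round {G : List A → C → T → T → T → Prop}
    (hG : Def (((C × T) × T) × T) fun w x => G w x.1.1.1 x.1.1.2 x.1.2 x.2) :
    ∃ F, Computes (A := A) C F ∧ ∀ w c (χ : T → Prop) (s₀ s₁ s₂ s₃ : List Bool),
      F w c ![s₀, (Enum.enum w.length).map (fun z => truth (χ z)) ++ s₁, s₂, s₃] =
        ![s₀, (Enum.enum w.length).map
          (fun z => truth (derivStep (Enum.enum w.length) (G w c) χ z)) ++ s₁, s₂, s₃] := by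
  obtain ⟨F, hF, eF⟩ := exists_computes_forall (C := (C × T) × T)
    (R := fun w x z => G w x.1.1 x.1.2 x.2 z) hG
  obtain ⟨O, hO, eO⟩ := exists_computes_or_zero (A := A) (C := (C × T) × T)
  obtain ⟨M, hM, eM⟩ := exists_computes_move_zero_three (A := A) (C := C × T)
  obtain ⟨D, hD, eD⟩ := exists_computes_drop_one (A := A) (C := C × T)
  obtain ⟨N, hN, eN⟩ := exists_computes_move_three_one (A := A) (C := C × T)
  refine ⟨_, ((Enum.computes_for (T := T) (((Computes.push 0 false).seq
    (Enum.computes_for (T := T) (hF.seq hO))).seq hM)).seq (Enum.computes_for (T := T) hD)).seq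
    (Enum.computes_for (T := T) hN), ?_⟩
  intro w c χ s₀ s₁ s₂ s₃
  set E : List T := Enum.enum w.length with hE
  set τ := E.map fun z => truth (χ z) with hτ
  have any : ∀ (u : T) (V : List T) (a : Bool) (s₃ : List Bool),
      V.foldl (fun S v => O w ((c, u), v) (F w ((c, u), v) S)) ![a :: s₀, τ ++ s₁, s₂, s₃] =
        ![(a || truth (∃ v ∈ V, ∀ z ∈ E, G w c u v z → χ z)) :: s₀, τ ++ s₁, s₂, s₃] := by
    intro u V
    induction V with
    | nil => intro a s₃; simp
    | cons v V ih =>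
      intro a s₃
      rw [List.foldl_cons, eF, eO, ih, Bool.or_assoc]
      congr 3
      rw [Bool.eq_iff_iff]
      simp [hE]
  -- The new table is collected on the fourth stack, so that all entries of a round are computed
  -- from the old table, which is dropped only afterwards.
  have next : ∀ (U : List T) (s₃ : List Bool),
      U.foldl (fun S u => M w (c, u) (E.foldl (fun S v => O w ((c, u), v) (F w ((c, u), v) S))
        (Function.update S 0 (false :: S 0)))) ![s₀, τ ++ s₁, s₂, s₃] =
        ![s₀, τ ++ s₁, s₂, (U.map fun u => truth (derivStep E (G w c) χ u)).reverse ++ s₃] := by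
    intro U
    induction U with
    | nil => intro s₃; simp
    | cons u U ih =>
      intro s₃
      rw [List.foldl_cons, update_vec_zero, vec_zero, any, eM, ih, Bool.false_or, List.map_cons,
        List.reverse_cons, List.append_assoc, List.singleton_append]
      rfl
  have drop : ∀ (U : List T) (l s₃ : List Bool), l.length = U.length →
      U.foldl (fun S u => D w (c, u) S) ![s₀, l ++ s₁, s₂, s₃] = ![s₀, s₁, s₂, s₃] := by
    intro U
    induction U with
    | nil =>
      intro l s₃ hl
      simp [List.eq_nil_of_length_eq_zero hl]
    | cons z U ih =>
      intro l s₃ hl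
      obtain _ | ⟨b, l⟩ := l
      · simp at hl
      · rw [List.foldl_cons, List.cons_append, eD, ih l _ (by simpa using hl)]
  have move : ∀ (U : List T) (l s₁ : List Bool), l.length = U.length →
      U.foldl (fun S x => N w (c, x) S) ![s₀, s₁, s₂, l ++ s₃] =
        ![s₀, l.reverse ++ s₁, s₂, s₃] := by
    intro U
    induction U with
    | nil =>
      intro l s₁ hl
      simp [List.eq_nil_of_length_eq_zero hl]
    | cons z U ih =>
      intro l s₁ hl
      obtain _ | ⟨b, l⟩ := l
      · simp at hl
      · rw [List.foldl_cons, List.cons_append, eN, ih l _ (by simpa using hl)]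
        simp
  rw [next, drop _ _ _ (by simp [hτ]), move _ _ _ (by simp), List.reverse_reverse]

/-- Definable relations are closed under least fixed points. The additional component of the tuple
in `hG` is a loop counter. -/
theorem Def.exists_derivable {G : List A → C → T → T → T → Prop} {Q : List A → C → T → Prop}
    (hG : Def ((((C × T) × T) × T) × T) fun w x => G w x.1.1.1.1 x.1.1.2 x.1.2 x.2)
    (hQ : Def (C × T) fun w x => Q w x.1 x.2) :
    Def C fun w c => ∃ u ∈ Enum.enum w.length, Q w c u ∧
      Derivable (Enum.enum w.length) (G w c) u := by
  obtain ⟨F, hF, eF⟩ := exists_computes_round (C := C × T) (G := fun w x => G w x.1) hG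
  obtain ⟨P, hP, eP⟩ : ∃ F, Computes (A := A) (C × T) F ∧ ∀ w x (a b : Bool)
      (s₀ s₁ s₂ s₃ : List Bool), F w x ![a :: s₀, b :: s₁, s₂, s₃] =
        ![(a || (truth (Q w x.1 x.2) && b)) :: s₀, s₁, s₂, s₃] := by
    refine ⟨_, hQ.seq (Computes.pop 0
      (Computes.pop 1 ((Computes.pop 0 Computes.skip Computes.skip).seq (Computes.push 0 true))
        Computes.skip) (Computes.pop 1 Computes.skip Computes.skip)), ?_⟩
    intro w x a b s₀ s₁ s₂ s₃
    by_cases h : Q w x.1 x.2 <;> cases b <;> simp [h, update_vec_zero, update_vec_one]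
  refine (((Enum.computes_for (T := T) (Computes.push (C := C × T) 1 false)).seq
    (Enum.computes_for (T := T) hF)).seq ((Computes.push 0 false).seq
      (Enum.computes_for (T := T) hP))).congr ?_
  intro w c S
  rw [← stacks_eta S]
  generalize S 0 = s₀, S 1 = s₁, S 2 = s₂, S 3 = s₃
  set E : List T := Enum.enum w.length with hE
  have init : ∀ (U : List T) (s₁ : List Bool),
      U.foldl (fun (S : Stacks) _ => Function.update S 1 (false :: S 1)) ![s₀, s₁, s₂, s₃] =
        ![s₀, List.replicate U.length false ++ s₁, s₂, s₃] := by
    intro U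
    induction U with
    | nil => intro s₁; simp
    | cons z U ih =>
      intro s₁
      rw [List.foldl_cons, update_vec_one, vec_one, ih, List.length_cons, List.replicate_succ']
      simp
  -- The loop over rounds is itself an enumeration of `T` whose variable is ignored. It has |E|
  -- passes, which is enough by `derivStep_iterate_iff`.
  have rounds : ∀ (U : List T) (χ : T → Prop),
      U.foldl (fun S x => F w (c, x) S) ![s₀, E.map (fun z => truth (χ z)) ++ s₁, s₂, s₃] =
        ![s₀, E.map (fun z => truth ((derivStep E (G w c))^[U.length] χ z)) ++ s₁, s₂, s₃] := by
    intro U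
    induction U with
    | nil => intro χ; simp
    | cons z U ih =>
      intro χ
      rw [List.foldl_cons, eF, ih]
      simp only [List.length_cons, Function.iterate_succ_apply]
      rfl
  have query : ∀ (U : List T) (χ : T → Prop) (a : Bool),
      U.foldl (fun S x => P w (c, x) S) ![a :: s₀, U.map (fun z => truth (χ z)) ++ s₁, s₂, s₃] =
        ![(a || truth (∃ u ∈ U, Q w c u ∧ χ u)) :: s₀, s₁, s₂, s₃] := by
    intro U χ
    induction U with
    | nil => intro a; simp
    | cons z U ih =>
      intro a
      rw [List.foldl_cons, List.map_cons, List.cons_append, eP, ih, Bool.or_assoc]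
      congr 3
      rw [Bool.eq_iff_iff]
      simp
  have hrep : List.replicate E.length false = E.map fun _ => truth False := by
    simp
  rw [init, hrep, rounds, update_vec_zero, vec_zero, query, pushBit, update_vec_zero, vec_zero,
    Bool.false_or]
  congr 2
  rw [Bool.eq_iff_iff, truth_eq_true_iff]
  refine Iff.trans ?_ (@decide_eq_true_iff _ (Classical.propDecidable _)).symm
  refine exists_congr fun u => and_congr_right fun hu => and_congr_right fun _ => ?_
  exact derivStep_iterate_iff E (G w c) hu

end LeastFixedPoint

/-- Definable properties of words are decidable in polynomial time. -/
theorem inP_of_def {Γ Δ : Type} [Fintype Γ] [Fintype Δ] [Inhabited Γ]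
    {R : List (Γ ⊕ Δ) → Unit → Prop} (hR : Def Unit R) :
    InP {p : List Γ × List Δ | R (encPair p) ()} := by
  classical
  obtain ⟨p, hp⟩ := hR
  refine Prog.inP_of_run p fun x => ⟨decide (R (encPair x) ()), by simp, ?_⟩
  refine (hp (encPair x) _ fun _ => le_rfl).1.trans ?_
  rfl

/-! ### Reachability -/

/-- Tuples from which a target is reachable through bounded tuples. -/
inductive Reaches {T : Type} (E : List T) (S : T → T → Prop) (P : T → Prop) : T → Prop
  | target (u : T) : P u → Reaches E S P u
  | step (u v : T) : v ∈ E → S u v → Reaches E S P v → Reaches E S P u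

/-- Reachability in the form of `Derivable`: with `v` as the proposed successor of `u`, nothing is
required if `u` is a target, only `v` is required if `v` is a successor, and everything is required
otherwise. The last case demands `u` itself and so contributes nothing to the least fixed point. The
relation `E` is a definable copy of equality of tuples. -/
theorem Def.exists_reaches {A C T : Type} [Ctx C] [Ctx T] [Enum T]
    {S : List A → C → T → T → Prop} {P Q : List A → C → T → Prop}
    {E : List A → T → T → Prop} (hE : ∀ w x y, E w x y ↔ x = y)
    (hE' : Def ((((C × T) × T) × T) × T) fun w x => E w x.2 x.1.2)
    (hS : Def ((((C × T) × T) × T) × T) fun w x => S w x.1.1.1.1 x.1.1.2 x.1.2)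
    (hP : Def ((((C × T) × T) × T) × T) fun w x => P w x.1.1.1.1 x.1.1.2)
    (hQ : Def (C × T) fun w x => Q w x.1 x.2) :
    Def C fun w c => ∃ u ∈ Enum.enum w.length, Q w c u ∧
      Reaches (Enum.enum w.length) (S w c) (P w c) u := by
  refine (Def.exists_derivable (T := T) (Q := Q)
    (G := fun w c u v z => ¬ P w c u ∧ (S w c u v → E w z v))
    (hP.not.and (hS.imp hE')) hQ).congr ?_
  intro w c
  refine exists_congr fun u => and_congr_right fun hu => and_congr Iff.rfl ⟨fun h => ?_,
    fun h => ?_⟩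
  · induction h with
    | target u h => exact .intro u u hu fun z _ hz => (hz.1 h).elim
    | step u v hv huv _ ih =>
      exact .intro u v hv fun z hz hg => ((hE w z v).1 (hg.2 huv)).symm ▸ ih hv
  · induction h with
    | intro u v hv _ ih =>
      by_cases h1 : P w c u
      · exact .target u h1
      by_cases h2 : S w c u v
      · exact .step u v hv h2 (ih v hv ⟨h1, fun _ => (hE w v v).2 rfl⟩ hv)
      -- A useless choice of `v` requires every tuple, in particular `u`, so the induction
      -- hypothesis already speaks of `u`.
      · exact ih u hu ⟨h1, fun h => (h2 h).elim⟩ hu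

/-! ### Unit propagation -/

/-- The complementary literal. -/
def Literal.compl (l : Literal) : Literal := ⟨l.var, !l.positive⟩

@[simp] theorem Literal.compl_var (l : Literal) : l.compl.var = l.var := rfl

@[simp] theorem Literal.compl_positive (l : Literal) : l.compl.positive = !l.positive := rfl

@[simp] theorem Literal.compl_compl (l : Literal) : l.compl.compl = l := by
  ext <;> simp [Literal.compl]

/-- The literal is true under the valuation. -/
def Literal.Holds (v : Var → Bool) (l : Literal) : Prop := v l.var = l.positive

theorem Literal.holds_compl {v : Var → Bool} {l : Literal} : l.compl.Holds v ↔ ¬ l.Holds v := by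
  unfold Literal.Holds Literal.compl
  cases v l.var <;> cases l.positive <;> simp

/-- Literals that unit propagation derives from a set of clauses and basic literals. -/
inductive UnitDerivable (Cs : Set Clause) (base : Literal → Prop) : Literal → Prop
  | base (l : Literal) : base l → UnitDerivable Cs base l
  | unit (C : Clause) (l : Literal) : C ∈ Cs → l ∈ C →
      (∀ l' ∈ C, l' ≠ l → UnitDerivable Cs base l'.compl) → UnitDerivable Cs base l

/-- Unit propagation derives a contradiction. -/
def Conflict (Cs : Set Clause) (base : Literal → Prop) : Prop :=
  (∃ l, UnitDerivable Cs base l ∧ UnitDerivable Cs base l.compl) ∨ ∅ ∈ Cs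

section UnitPropagation

variable {Cs : Set Clause} {base base' : Literal → Prop}

theorem UnitDerivable.mono (h : ∀ l, base l → base' l) {l : Literal}
    (hl : UnitDerivable Cs base l) : UnitDerivable Cs base' l := by
  induction hl with
  | base l hl => exact .base l (h l hl)
  | unit C l hC hl _ ih => exact .unit C l hC hl ih

theorem Conflict.mono (h : ∀ l, base l → base' l) (hc : Conflict Cs base) : Conflict Cs base' :=
  hc.imp (fun ⟨l, h1, h2⟩ => ⟨l, h1.mono h, h2.mono h⟩) id

theorem UnitDerivable.holds {v : Var → Bool} (hv : ∀ C ∈ Cs, ∃ l ∈ C, l.Holds v)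
    (hb : ∀ l, base l → l.Holds v) {l : Literal} (hl : UnitDerivable Cs base l) : l.Holds v := by
  induction hl with
  | base l hl => exact hb l hl
  | unit C l hC _ _ ih =>
    obtain ⟨l', hl', h⟩ := hv C hC
    by_cases e : l' = l
    · exact e ▸ h
    · exact (Literal.holds_compl.1 (ih l' hl' e) h).elim

theorem not_conflict_of_holds {v : Var → Bool} (hv : ∀ C ∈ Cs, ∃ l ∈ C, l.Holds v)
    (hb : ∀ l, base l → l.Holds v) : ¬ Conflict Cs base := by
  rintro (⟨l, h1, h2⟩ | h)
  · exact Literal.holds_compl.1 (h2.holds hv hb) (h1.holds hv hb)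
  · obtain ⟨l, hl, -⟩ := hv _ h
    simp at hl

/-- If unit propagation refutes all literals of a clause, then there is a conflict. -/
theorem conflict_of_clause {C : Clause} (hC : C ∈ Cs)
    (h : ∀ l ∈ C, UnitDerivable Cs base l.compl) : Conflict Cs base := by
  rcases C.eq_empty_or_nonempty with rfl | ⟨l, hl⟩
  · exact Or.inr hC
  · exact Or.inl ⟨l, .unit C l hC hl fun l' hl' _ => h l' hl', h l hl⟩

/-- A literal of `τ` occurs in `C`, or at most one positive literal of `C` is not false. -/
def HornClause (τ : Literal → Prop) (C : Clause) : Prop :=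
  (∃ l ∈ C, τ l) ∨ ∀ l ∈ C, ∀ l' ∈ C, ¬ τ l.compl → ¬ τ l'.compl → l.positive = true →
    l'.positive = true → l = l'

/-- A literal of `τ` occurs in `C`, or at most two literals of `C` are not false. -/
def KromClause (τ : Literal → Prop) (C : Clause) : Prop :=
  (∃ l ∈ C, τ l) ∨ ∀ l ∈ C, ∀ l' ∈ C, ∀ l'' ∈ C, ¬ τ l.compl → ¬ τ l'.compl → ¬ τ l''.compl →
    l = l' ∨ l = l'' ∨ l' = l''

/-- A literal of `τ` occurs in `C`, or at most one literal of `C` is not false, and it is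
positive. -/
def IDClause (τ : Literal → Prop) (C : Clause) : Prop :=
  (∃ l ∈ C, τ l) ∨ ∀ l ∈ C, ∀ l' ∈ C, ¬ τ l.compl → ¬ τ l'.compl → l = l' ∧ l.positive = true

theorem IDClause.hornClause {τ : Literal → Prop} {C : Clause} (h : IDClause τ C) :
    HornClause τ C :=
  h.imp id fun h l hl l' hl' h1 h2 _ _ => (h l hl l' hl' h1 h2).1

/-- With more literals set, a clause can only become satisfied or lose further literals. This allows
the complements of the literals of the clause to be refuted to join the assignment. -/
theorem HornClause.mono {τ τ' : Literal → Prop} (h : ∀ l, τ l → τ' l) {C : Clause}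
    (hC : HornClause τ C) : HornClause τ' C :=
  hC.imp (fun ⟨l, hl, hτ⟩ => ⟨l, hl, h l hτ⟩) fun hC l hl l' hl' h1 h2 =>
    hC l hl l' hl' (fun e => h1 (h _ e)) (fun e => h2 (h _ e))

theorem KromClause.mono {τ τ' : Literal → Prop} (h : ∀ l, τ l → τ' l) {C : Clause}
    (hC : KromClause τ C) : KromClause τ' C :=
  hC.imp (fun ⟨l, hl, hτ⟩ => ⟨l, hl, h l hτ⟩) fun hC l hl l' hl' l'' hl'' h1 h2 h3 =>
    hC l hl l' hl' l'' hl'' (fun e => h1 (h _ e)) (fun e => h2 (h _ e)) (fun e => h3 (h _ e))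

/-- Unit propagation is complete for Horn clauses. -/
theorem exists_holds_of_horn (hH : ∀ C ∈ Cs, HornClause base C) (hc : ¬ Conflict Cs base) :
    ∃ v : Var → Bool, (∀ C ∈ Cs, ∃ l ∈ C, l.Holds v) ∧ ∀ l, base l → l.Holds v := by
  classical
  -- The least model: a variable is true only if propagation derives it.
  set v : Var → Bool := fun x => decide (UnitDerivable Cs base ⟨x, true⟩) with hv
  have hneg : ∀ l : Literal, UnitDerivable Cs base l → l.Holds v := by
    rintro ⟨x, s⟩ hl
    cases s with
    | true => simpa [Literal.Holds, hv] using hl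
    | false =>
      have : ¬ UnitDerivable Cs base ⟨x, true⟩ := fun h => hc (Or.inl ⟨_, h, hl⟩)
      simpa [Literal.Holds, hv] using this
  refine ⟨v, fun C hC => ?_, fun l hl => hneg l (.base l hl)⟩
  by_contra! hno
  have hfalse : ∀ l ∈ C, l.positive = false → UnitDerivable Cs base l.compl := by
    rintro ⟨x, s⟩ hl rfl
    have := hno _ hl
    simpa [Literal.Holds, hv, Literal.compl] using this
  rcases hH C hC with ⟨l, hl, hb⟩ | hone
  · exact hno l hl (hneg l (.base l hb))
  -- In a falsified clause all negative literals are refuted by propagation. If a positive literal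
  -- is left over by the base, it is the only one, so it is derived and true; otherwise the whole
  -- clause is refuted.
  by_cases hfree : ∃ l ∈ C, l.positive = true ∧ ¬ base l.compl
  · obtain ⟨l, hl, hp, hlb⟩ := hfree
    refine hno l hl (hneg l (.unit C l hC hl fun l' hl' hne => ?_))
    cases hp' : l'.positive with
    | false => exact hfalse l' hl' hp'
    | true =>
      by_cases hb' : base l'.compl
      · exact .base _ hb'
      · exact (hne (hone l' hl' l hl hb' hlb hp' hp)).elim
  · push Not at hfree
    refine hc (conflict_of_clause hC fun l hl => ?_)
    cases hp : l.positive with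
    | false => exact hfalse l hl hp
    | true => exact .base _ (hfree l hl hp)

/-- A set of clauses with at most two literals is satisfiable if unit propagation from one of the
two literals of each variable runs into no conflict. -/
theorem exists_holds_of_krom (hK : ∀ C ∈ Cs, KromClause base C) (hc : ¬ Conflict Cs base)
    (hx : ∀ C ∈ Cs, ∀ l ∈ C, ∃ s, ¬ Conflict Cs fun l' => base l' ∨ l' = ⟨l.var, s⟩) :
    ∃ v : Var → Bool, (∀ C ∈ Cs, ∃ l ∈ C, l.Holds v) ∧ ∀ l, base l → l.Holds v := by
  classical
  -- For every variable of the clauses the base is extended by one of its literals without conflict.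
  -- For other variables the base alone is used, so that the choice is total.
  have hsel : ∀ x : Var, ∃ b : Literal → Prop, (∀ l, base l → b l) ∧ ¬ Conflict Cs b ∧
      ((∃ C ∈ Cs, ∃ l ∈ C, l.var = x) → ∃ s, b ⟨x, s⟩) := by
    intro x
    by_cases h : ∃ C ∈ Cs, ∃ l ∈ C, l.var = x
    · obtain ⟨C, hC, l, hl, rfl⟩ := h
      obtain ⟨s, hs⟩ := hx C hC l hl
      exact ⟨_, fun l h => Or.inl h, hs, fun _ => ⟨s, Or.inr rfl⟩⟩
    · exact ⟨base, fun _ h => h, hc, fun h' => (h h').elim⟩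
  choose b hb hbc hbx using hsel
  -- `M x` is a consistent set of literals that is closed under unit propagation.
  set M : Var → Literal → Prop := fun x => UnitDerivable Cs (b x) with hM
  have hcons : ∀ x l, M x l → ¬ M x l.compl := fun x l h h' => hbc x (Or.inl ⟨l, h, h'⟩)
  set assigns : Var → Var → Prop := fun x y => M x ⟨y, true⟩ ∨ M x ⟨y, false⟩ with hassigns
  have hassign : ∀ x (l : Literal), assigns x l.var ↔ M x l ∨ M x l.compl := by
    rintro x ⟨y, s⟩
    cases s
    · exact or_comm
    · exact Iff.rfl
  have wf : WellFounded (WellOrderingRel : Var → Var → Prop) := WellOrderingRel.isWellOrder.wf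
  -- Gluing of the partial models: the variables are well-ordered, and each variable takes its value
  -- from the first partial model that assigns it. The value of `least` where no model does so is
  -- irrelevant.
  set least : Var → Var := fun y =>
    if h : ∃ x, assigns x y then wf.min {x | assigns x y} h else y with hleast
  set v : Var → Bool := fun y => decide (M (least y) ⟨y, true⟩) with hv
  have hholds : ∀ x (l : Literal), M x l → (∀ x', assigns x' l.var → ¬ WellOrderingRel x' x) →
      l.Holds v := by
    intro x l hl hmin
    have hex : ∃ x, assigns x l.var := ⟨x, (hassign x l).2 (Or.inl hl)⟩
    have e : least l.var = x := by
      have h0 : least l.var = wf.min {x | assigns x l.var} hex := dif_pos hex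
      have h1 : assigns (least l.var) l.var := h0 ▸ wf.min_mem {x | assigns x l.var} hex
      have h2 : ¬ WellOrderingRel x (least l.var) :=
        h0 ▸ wf.not_lt_min {x | assigns x l.var} ((hassign x l).2 (Or.inl hl))
      rcases trichotomous_of WellOrderingRel x (least l.var) with h | h | h
      · exact (h2 h).elim
      · exact h.symm
      · exact (hmin _ h1 h).elim
    obtain ⟨y, s⟩ := l
    cases s with
    | true => simpa [Literal.Holds, hv, e] using hl
    | false =>
      have := hcons x _ hl
      simpa [Literal.Holds, hv, e, Literal.compl] using this
  have hbase : ∀ l, base l → l.Holds v := by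
    intro l hl
    -- All partial models contain the base; the empty name is an arbitrary index.
    have hex : ∃ x, assigns x l.var := ⟨[], (hassign _ l).2 (Or.inl (.base l (hb _ l hl)))⟩
    obtain ⟨x, -, hmin⟩ := wf.has_min {x | assigns x l.var} hex
    exact hholds x l (.base l (hb x l hl)) fun x' => hmin x'
  refine ⟨v, fun C hC => ?_, hbase⟩
  rcases hK C hC with ⟨l, hl, hbl⟩ | htwo
  · exact ⟨l, hl, hbase l hbl⟩
  by_cases hfree : ∃ l ∈ C, ¬ base l.compl
  · have hex : ∃ x, ∃ l ∈ C, ¬ base l.compl ∧ assigns x l.var := by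
      obtain ⟨l, hl, hlb⟩ := hfree
      obtain ⟨s, hs⟩ := hbx l.var ⟨C, hC, l, hl, rfl⟩
      refine ⟨l.var, l, hl, hlb, ?_⟩
      cases s
      · exact Or.inr (.base _ hs)
      · exact Or.inl (.base _ hs)
    -- Let `x` index the first partial model that assigns some literal of the clause not refuted by
    -- the base. By minimality every such literal that is true in this model is also true in the
    -- glued valuation.
    obtain ⟨x, ⟨l, hl, hlb, hxl⟩, hmin⟩ :=
      wf.has_min {x | ∃ l ∈ C, ¬ base l.compl ∧ assigns x l.var} hex
    have hpick : ∀ l ∈ C, ¬ base l.compl → M x l → ∃ l ∈ C, l.Holds v := fun l hl hlb hM =>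
      ⟨l, hl, hholds x l hM fun x' h => hmin x' ⟨l, hl, hlb, h⟩⟩
    rcases (hassign x l).1 hxl with h | h
    · exact hpick l hl hlb h
    -- The model refutes `l`. A second remaining literal is then derived by propagation, because the
    -- clause has at most two; without one, the whole clause is refuted, which is a conflict.
    by_cases hsecond : ∃ l' ∈ C, ¬ base l'.compl ∧ l' ≠ l
    · obtain ⟨l', hl', hlb', hne⟩ := hsecond
      refine hpick l' hl' hlb' (.unit C l' hC hl' fun l'' hl'' hne'' => ?_)
      by_cases hlb'' : base l''.compl
      · exact .base _ (hb _ _ hlb'')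
      · rcases htwo l hl l' hl' l'' hl'' hlb hlb' hlb'' with e | e | e
        · exact (hne e.symm).elim
        · exact e ▸ h
        · exact (hne'' e.symm).elim
    · push Not at hsecond
      refine (hbc x (conflict_of_clause hC fun l' hl' => ?_)).elim
      by_cases hlb' : base l'.compl
      · exact .base _ (hb _ _ hlb')
      · exact hsecond l' hl' hlb' ▸ h
  · push Not at hfree
    exact (hc (conflict_of_clause hC fun l hl => .base _ (hfree l hl))).elim

end UnitPropagation

/-! ### Reducts -/

section Reduct

variable {X : Finset Var} (θ : Assignment X)

/-- The literals that are true under a partial assignment. -/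
def Assignment.Sets (l : Literal) : Prop := θ.literalValue l = some true

theorem Assignment.sets_compl_iff (l : Literal) :
    θ.Sets l.compl ↔ θ.literalValue l = some false := by
  unfold Assignment.Sets Assignment.literalValue
  simp only [Literal.compl_var, Literal.compl_positive]
  split_ifs with h <;> simp_all

theorem mem_reduct_iff {φ : CNF} {D : Clause} : D ∈ φ.reduct θ ↔ ∃ C ∈ φ, (¬ ∃ l ∈ C, θ.Sets l) ∧
    D = C.filter fun l => θ.literalValue l ≠ some false := by
  unfold CNF.reduct Assignment.Sets
  simp only [Finset.mem_image, Finset.mem_filter, not_exists, not_and, ne_eq, and_assoc]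
  exact exists_congr fun C => and_congr_right fun _ => and_congr_right fun _ => eq_comm

/-- The literals that survive in the reduct of a clause are those whose complement is not set. So
the class can be tested on the original clause, without construction of the reduct. -/
theorem reduct_mem_horn_iff {φ : CNF} :
    φ.reduct θ ∈ Horn ↔ ∀ C ∈ φ, HornClause θ.Sets C := by
  unfold Horn HornClause
  simp only [Set.mem_ofPred_eq, mem_reduct_iff, forall_exists_index, and_imp, or_iff_not_imp_left,
    Finset.card_le_one]
  constructor
  · exact fun h C hC hn l hl l' hl' h1 h2 h3 h4 =>
      h _ C hC hn rfl l (by simp [hl, h1, h3, ← θ.sets_compl_iff]) l'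
        (by simp [hl', h2, h4, ← θ.sets_compl_iff])
  · rintro h _ C hC hn rfl l hl l' hl'
    simp only [Finset.mem_filter, ne_eq, ← θ.sets_compl_iff] at hl hl'
    exact h C hC hn l hl.1.1 l' hl'.1.1 hl.1.2 hl'.1.2 hl.2 hl'.2

theorem reduct_mem_krom_iff {φ : CNF} :
    φ.reduct θ ∈ Krom ↔ ∀ C ∈ φ, KromClause θ.Sets C := by
  unfold Krom KromClause
  simp only [Set.mem_ofPred_eq, mem_reduct_iff, forall_exists_index, and_imp, or_iff_not_imp_left]
  constructor
  · intro h C hC hn l hl l' hl' l'' hl'' h1 h2 h3 h4 h5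
    by_contra h6
    refine absurd (h _ C hC hn rfl) (not_le.2 (Finset.two_lt_card.2 ⟨l, ?_, l', ?_, l'', ?_, h4,
      h5, h6⟩))
    · simp [hl, h1, ← θ.sets_compl_iff]
    · simp [hl', h2, ← θ.sets_compl_iff]
    · simp [hl'', h3, ← θ.sets_compl_iff]
  · rintro h _ C hC hn rfl
    by_contra hcard
    obtain ⟨l, hl, l', hl', l'', hl'', h1, h2, h3⟩ := Finset.two_lt_card.1 (not_le.1 hcard)
    simp only [Finset.mem_filter, ne_eq, ← θ.sets_compl_iff] at hl hl' hl''
    exact h3 (h C hC hn l hl.1 l' hl'.1 l'' hl''.1 hl.2 hl'.2 hl''.2 h1 h2)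

theorem reduct_mem_id_iff {φ : CNF} :
    φ.reduct θ ∈ ID ↔ ∀ C ∈ φ, IDClause θ.Sets C := by
  unfold ID IDClause
  simp only [Set.mem_ofPred_eq, mem_reduct_iff, forall_exists_index, and_imp, or_iff_not_imp_left,
    Finset.card_le_one]
  constructor
  · exact fun h C hC hn l hl l' hl' h1 h2 =>
      ⟨(h _ C hC hn rfl).1 l (by simp [hl, h1, ← θ.sets_compl_iff]) l'
        (by simp [hl', h2, ← θ.sets_compl_iff]),
        (h _ C hC hn rfl).2 l (by simp [hl, h1, ← θ.sets_compl_iff])⟩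
  · rintro h _ C hC hn rfl
    simp only [Finset.mem_filter, ne_eq, ← θ.sets_compl_iff]
    exact ⟨fun l hl l' hl' => (h C hC hn l hl.1 l' hl'.1 hl.2 hl'.2).1,
      fun l hl => (h C hC hn l hl.1 l hl.1 hl.2 hl.2).2⟩

end Reduct

/-- Basic literals when a clause is to be derived under a partial assignment, with an additional
assumption. -/
def refutationBase (τ : Literal → Prop) (D : Clause) (a l : Literal) : Prop :=
  τ l ∨ l.compl ∈ D ∨ l = a

/-- Under a strong backdoor into one of the target classes, entailment of a formula is the same as
the success of unit propagation with case distinction on one variable, for all assignments to the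
backdoor. -/
theorem entails_iff_conflict {Cs : Set Clause} {ψ : CNF} {B : Finset Var} {V : Set Var}
    (hne : V.Nonempty) (hV : ∀ C ∈ Cs, ∀ l ∈ C, l.var ∈ V)
    (hB : ∀ θ : Assignment B, (∀ C ∈ Cs, HornClause θ.Sets C) ∨ ∀ C ∈ Cs, KromClause θ.Sets C) :
    (∀ v : Var → Bool, (∀ C ∈ Cs, ∃ l ∈ C, l.Holds v) → ∀ D ∈ ψ, ∃ l ∈ D, l.Holds v) ↔
      ∀ θ : Assignment B, ∀ D ∈ ψ, ∃ x ∈ V, ∀ s, Conflict Cs (refutationBase θ.Sets D ⟨x, s⟩) := by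
  constructor
  · intro h θ D hD
    by_contra! hno
    set base : Literal → Prop := fun l => θ.Sets l ∨ l.compl ∈ D with hbase
    have heq : ∀ x s, refutationBase θ.Sets D ⟨x, s⟩ = fun l => base l ∨ l = ⟨x, s⟩ := by
      intro x s
      funext l
      simp only [refutationBase, hbase, or_assoc]
    simp only [heq] at hno
    -- Here `V` must be nonempty: a split without conflict on one side, for some variable, shows
    -- that the smaller base has no conflict either.
    have hc : ¬ Conflict Cs base := by
      obtain ⟨x, hx⟩ := hne
      obtain ⟨s, hs⟩ := hno x hx
      exact fun h => hs (h.mono fun l hl => Or.inl hl)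
    obtain ⟨v, hv, hvb⟩ : ∃ v : Var → Bool, (∀ C ∈ Cs, ∃ l ∈ C, l.Holds v) ∧
        ∀ l, base l → l.Holds v := by
      rcases hB θ with hH | hK
      · exact exists_holds_of_horn (fun C hC => (hH C hC).mono fun l hl => Or.inl hl) hc
      · exact exists_holds_of_krom (fun C hC => (hK C hC).mono fun l hl => Or.inl hl) hc
          fun C hC l hl => hno _ (hV C hC l hl)
    obtain ⟨l, hl, hlv⟩ := h v hv D hD
    exact Literal.holds_compl.1 (hvb l.compl (Or.inr (by simpa using hl))) hlv
  · intro h v hv D hD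
    by_contra! hno
    -- The assignment is the restriction of `v` to the backdoor, and the branch of the split is the
    -- one that agrees with `v`. A valuation that satisfies the premises and falsifies the clause
    -- satisfies all basic literals of this branch.
    obtain ⟨x, -, hx⟩ := h (fun y => v y) D hD
    refine not_conflict_of_holds hv (fun l hl => ?_) (hx (v x))
    rcases hl with hl | hl | rfl
    · unfold Assignment.Sets Assignment.literalValue at hl
      unfold Literal.Holds
      cases hp : l.positive <;> simp_all
    · have := hno _ hl
      rwa [Literal.holds_compl, not_not] at this
    · rfl

/-! ### Reading words -/

/-- The alphabet of pairs of an input word and an advice word. -/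
abbrev Letter : Type := Symbol ⊕ Fin 3

instance : Inhabited Symbol := ⟨.zero⟩

/-- The letter of a bit of a name. -/
def bitLetter (b : Bool) : Letter := Sum.inl (if b then .one else .zero)

/-- The letter of a bit of the advice. -/
def adviceLetter (b : Bool) : Letter := Sum.inr (if b then 1 else 0)

/-- The letter that starts a literal. -/
def signLetter (b : Bool) : Letter := Sum.inl (if b then .pos else .neg)

/-- The name at the beginning of a word. -/
def nameOf : List Letter → Var
  | .inl .zero :: t => false :: nameOf t
  | .inl .one :: t => true :: nameOf t
  | _ => []

/-- The literals at the beginning of a word, up to the first letter that does not belong to a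
literal. -/
def litsOf : List Letter → List Literal
  | .inl .zero :: t => litsOf t
  | .inl .one :: t => litsOf t
  | .inl .pos :: t => ⟨nameOf t, true⟩ :: litsOf t
  | .inl .neg :: t => ⟨nameOf t, false⟩ :: litsOf t
  | _ => []

/-- The name that starts at a position. -/
def nameAt (w : List Letter) (i : ℕ) : Var := nameOf (w.drop i)

/-- The clause whose marker is at a position. -/
def clauseAt (w : List Letter) (c : ℕ) : Clause := (litsOf (w.drop (c + 1))).toFinset

def IsBit (a : Option Letter) : Prop := ∃ b, a = some (bitLetter b)

def IsSign (a : Option Letter) : Prop := ∃ b, a = some (signLetter b)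

theorem nameOf_cons_bitLetter (b : Bool) (t : List Letter) :
    nameOf (bitLetter b :: t) = b :: nameOf t := by
  cases b <;> rfl

theorem nameOf_eq_nil {t : List Letter} (h : ¬ IsBit t.head?) : nameOf t = [] := by
  match t with
  | [] => rfl
  | .inr _ :: _ => rfl
  | .inl a :: t =>
    cases a with
    | zero => exact (h ⟨false, rfl⟩).elim
    | one => exact (h ⟨true, rfl⟩).elim
    | _ => rfl

theorem litsOf_cons_bitLetter (b : Bool) (t : List Letter) :
    litsOf (bitLetter b :: t) = litsOf t := by
  cases b <;> rfl

theorem litsOf_cons_signLetter (b : Bool) (t : List Letter) :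
    litsOf (signLetter b :: t) = ⟨nameOf t, b⟩ :: litsOf t := by
  cases b <;> rfl

theorem litsOf_eq_nil {t : List Letter} (h : ¬ IsBit t.head?) (h' : ¬ IsSign t.head?) :
    litsOf t = [] := by
  match t with
  | [] => rfl
  | .inr _ :: _ => rfl
  | .inl a :: t =>
    cases a with
    | zero => exact (h ⟨false, rfl⟩).elim
    | one => exact (h ⟨true, rfl⟩).elim
    | pos => exact (h' ⟨true, rfl⟩).elim
    | neg => exact (h' ⟨false, rfl⟩).elim
    | _ => rfl

theorem bitLetter_ne_signLetter (b b' : Bool) : bitLetter b ≠ signLetter b' := by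
  cases b <;> cases b' <;> simp [bitLetter, signLetter]

theorem signLetter_injective : Function.Injective signLetter := by
  intro b b'
  cases b <;> cases b' <;> simp [signLetter]

theorem adviceLetter_injective : Function.Injective adviceLetter := by
  intro b b'
  cases b <;> cases b' <;> simp [adviceLetter]

section Positions

variable {w : List Letter} {i j : ℕ}

theorem nameAt_of_bit {b : Bool} (h : w[i]? = some (bitLetter b)) :
    nameAt w i = b :: nameAt w (i + 1) := by
  obtain ⟨hi, e⟩ := List.getElem?_eq_some_iff.1 h
  rw [nameAt, List.drop_eq_getElem_cons hi, e, nameOf_cons_bitLetter, nameAt]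

theorem nameAt_of_not_bit (h : ¬ IsBit w[i]?) : nameAt w i = [] :=
  nameOf_eq_nil (by rwa [List.head?_drop])

/-- The literal whose sign is at position `i` belongs to the clause with marker at `c`. -/
def LitIn (w : List Letter) (c i : ℕ) : Prop :=
  c < i ∧ ∀ j ≤ w.length, c < j → j < i → IsBit w[j]? ∨ IsSign w[j]?

/-- Reading skips bits, emits a literal at each sign and stops at any other letter. Hence the
literals correspond to the signs before which only bits and signs occur, a condition on positions
that quantifiers can express. -/
theorem mem_litsOf_iff {t : List Letter} {l : Literal} : l ∈ litsOf t ↔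
    ∃ i, t[i]? = some (signLetter l.positive) ∧ (∀ j < i, IsBit t[j]? ∨ IsSign t[j]?) ∧
      nameOf (t.drop (i + 1)) = l.var := by
  induction t with
  | nil => simp [litsOf]
  | cons a t ih =>
    have shift : IsBit (some a) ∨ IsSign (some a) → ((∃ i, t[i]? = some (signLetter l.positive) ∧
        (∀ j < i, IsBit t[j]? ∨ IsSign t[j]?) ∧ nameOf (t.drop (i + 1)) = l.var) ↔
        ∃ i, (a :: t)[i + 1]? = some (signLetter l.positive) ∧
        (∀ j < i + 1, IsBit (a :: t)[j]? ∨ IsSign (a :: t)[j]?) ∧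
        nameOf ((a :: t).drop (i + 1 + 1)) = l.var) := by
      intro ha
      refine exists_congr fun i => and_congr (by simp) (and_congr ⟨fun h j hj => ?_,
        fun h j hj => ?_⟩ (by simp))
      · cases j with
        | zero => simpa using ha
        | succ j => simpa using h j (by omega)
      · simpa using h (j + 1) (by omega)
    have split : (∃ i, (a :: t)[i]? = some (signLetter l.positive) ∧
        (∀ j < i, IsBit (a :: t)[j]? ∨ IsSign (a :: t)[j]?) ∧
        nameOf ((a :: t).drop (i + 1)) = l.var) ↔
        (a = signLetter l.positive ∧ nameOf t = l.var) ∨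
        ∃ i, (a :: t)[i + 1]? = some (signLetter l.positive) ∧
        (∀ j < i + 1, IsBit (a :: t)[j]? ∨ IsSign (a :: t)[j]?) ∧
        nameOf ((a :: t).drop (i + 1 + 1)) = l.var := by
      constructor
      · rintro ⟨i, h⟩
        cases i with
        | zero => exact Or.inl (by simpa using h)
        | succ i => exact Or.inr ⟨i, h⟩
      · rintro (h | ⟨i, h⟩)
        · exact ⟨0, by simpa using h⟩
        · exact ⟨i + 1, h⟩
    rw [split]
    by_cases hb : IsBit (some a)
    · rw [← shift (Or.inl hb), ← ih]
      obtain ⟨b, hb⟩ := hb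
      rw [Option.some_inj] at hb
      subst hb
      rw [litsOf_cons_bitLetter]
      simp [bitLetter_ne_signLetter]
    by_cases hs : IsSign (some a)
    · rw [← shift (Or.inr hs), ← ih]
      obtain ⟨b, hs⟩ := hs
      rw [Option.some_inj] at hs
      subst hs
      rw [litsOf_cons_signLetter, List.mem_cons, signLetter_injective.eq_iff, Literal.ext_iff]
      simp only [and_comm, eq_comm]
    · rw [litsOf_eq_nil (by simpa using hb) (by simpa using hs)]
      simp only [List.not_mem_nil, false_iff, not_or]
      constructor
      · rintro ⟨h, -⟩
        exact hs ⟨_, by rw [h]⟩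
      · rintro ⟨i, -, h, -⟩
        have := h 0 (by omega)
        simp [hb, hs] at this

theorem mem_clauseAt_iff {c : ℕ} {l : Literal} : l ∈ clauseAt w c ↔
    ∃ i < w.length, LitIn w c i ∧ w[i]? = some (signLetter l.positive) ∧
      nameAt w (i + 1) = l.var := by
  rw [clauseAt, List.mem_toFinset, mem_litsOf_iff]
  simp only [List.getElem?_drop, List.drop_drop]
  constructor
  · rintro ⟨i, h1, h2, h3⟩
    refine ⟨c + 1 + i, (List.getElem?_eq_some_iff.1 h1).1, ⟨by omega, fun j _ hcj hji => ?_⟩, h1,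
      h3⟩
    have := h2 (j - (c + 1)) (by omega)
    rwa [show c + 1 + (j - (c + 1)) = j by omega] at this
  · rintro ⟨i, hi, ⟨hci, h2⟩, h1, h3⟩
    have e : c + 1 + (i - (c + 1)) = i := by omega
    refine ⟨i - (c + 1), by rwa [e], fun j hj => h2 _ (by omega) (by omega) (by omega), ?_⟩
    rwa [← add_assoc, e]

/-- Equality of names as reachability: both positions advance over equal bits. -/
def SameBit (w : List Letter) (u v : ℕ × ℕ) : Prop :=
  (∃ b, w[u.1]? = some (bitLetter b) ∧ w[u.2]? = some (bitLetter b)) ∧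
    v.1 = u.1 + 1 ∧ v.2 = u.2 + 1

/-- Two positions advance together as long as they hold the same bit. The names agree exactly if
both positions leave their names in the same step. -/
theorem reaches_sameBit_iff (hi : i ≤ w.length) (hj : j ≤ w.length) :
    Reaches (Enum.enum w.length) (SameBit w) (fun u => ¬ IsBit w[u.1]? ∧ ¬ IsBit w[u.2]?) (i, j) ↔
      nameAt w i = nameAt w j := by
  constructor
  · intro h
    suffices ∀ u : ℕ × ℕ, Reaches (Enum.enum w.length) (SameBit w)
        (fun u => ¬ IsBit w[u.1]? ∧ ¬ IsBit w[u.2]?) u → nameAt w u.1 = nameAt w u.2 from this _ h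
    intro u h
    induction h with
    | target u h => rw [nameAt_of_not_bit h.1, nameAt_of_not_bit h.2]
    | step u v hv huv _ ih =>
      obtain ⟨⟨b, h1, h2⟩, e1, e2⟩ := huv
      rw [nameAt_of_bit h1, nameAt_of_bit h2, ← e1, ← e2, ih]
  · intro h
    generalize hx : nameAt w i = x at h
    induction x generalizing i j with
    | nil =>
      refine .target _ ⟨?_, ?_⟩
      · rintro ⟨b, hb⟩
        rw [nameAt_of_bit hb] at hx
        cases hx
      · rintro ⟨b, hb⟩
        rw [nameAt_of_bit hb] at h
        cases h
    | cons b x ih =>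
      have key : ∀ {i : ℕ}, nameAt w i = b :: x → w[i]? = some (bitLetter b) ∧ i < w.length ∧
          nameAt w (i + 1) = x := by
        intro i hx
        by_cases hb : IsBit w[i]?
        · obtain ⟨b', hb'⟩ := hb
          rw [nameAt_of_bit hb'] at hx
          injection hx with e1 e2
          subst e1
          exact ⟨hb', (List.getElem?_eq_some_iff.1 hb').1, e2⟩
        · rw [nameAt_of_not_bit hb] at hx
          cases hx
      obtain ⟨h1, h2, h3⟩ := key hx
      obtain ⟨h4, h5, h6⟩ := key h.symm
      refine .step _ (i + 1, j + 1) ?_ ⟨⟨b, h1, h4⟩, rfl, rfl⟩ (ih h2 h5 h3 h6.symm)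
      rw [mem_enum_prod]
      exact ⟨mem_enum_nat.2 h2, mem_enum_nat.2 h5⟩

end Positions

/-! ### Definability of basic relations -/

section Definability

variable {A C D : Type} [Ctx C] [Ctx D]

theorem Proj.comp {E : Type} [Ctx E] {f : D → E} {g : C → D} (hf : Proj f) (hg : Proj g) :
    Proj fun c => f (g c) := by
  obtain ⟨k, hk, h⟩ := hf
  obtain ⟨m, hm, h'⟩ := hg
  refine ⟨m + k, by omega, fun x => ?_⟩
  refine (congrArg f (h' x)).trans ((h _).trans ?_)
  simp only [add_assoc]

/-- It suffices to define a relation on positions of the word. -/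
theorem Def.congr_of_le {R Q : List A → C → Prop} {t u : C → ℕ} (ht : Proj t) (hu : Proj u)
    (hR : Def C R) (h : ∀ w c, t c ≤ w.length → u c ≤ w.length → (Q w c ↔ R w c)) : Def C Q := by
  obtain ⟨i, -, hi⟩ := ht.nat
  obtain ⟨j, -, hj⟩ := hu.nat
  obtain ⟨p, hp⟩ := hR
  refine ⟨p, fun w s hs => ⟨?_, (hp w s hs).2⟩⟩
  have e : Q w (Ctx.get s.head) = R w (Ctx.get s.head) :=
    propext (h _ _ (by rw [hi]; exact hs i) (by rw [hj]; exact hs j))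
  rw [(hp w s hs).1]
  exact congrArg (pushBit s.stk) (by simp [e])

variable {t u : C → ℕ}

/-- The successor is defined from the order: no position lies strictly between. The quantifier
ranges over positions of the word, whence the use of `Def.congr_of_le`. -/
theorem Def.succ_eq (ht : Proj t) (hu : Proj u) : Def (A := A) C fun _ c => u c = t c + 1 := by
  refine Def.congr_of_le ht hu ((Def.lt ht hu).and (Def.all (R := fun _ c x => x ≤ t c ∨ u c ≤ x)
    ((Def.le Proj.id.snd (ht.comp Proj.id.fst)).or (Def.le (hu.comp Proj.id.fst) Proj.id.snd)))) ?_
  intro w c h1 h2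
  constructor
  · intro h
    exact ⟨by omega, fun x _ => by omega⟩
  · rintro ⟨h3, h4⟩
    have := h4 (t c + 1) (by omega)
    omega

theorem Def.eq_zero (ht : Proj t) : Def (A := A) C fun _ c => t c = 0 := by
  refine (Def.all (R := fun _ c x => t c ≤ x) (Def.le (ht.comp Proj.id.fst) Proj.id.snd)).congr ?_
  intro w c
  exact ⟨fun h x _ => by omega, fun h => by simpa using h 0 (Nat.zero_le _)⟩

theorem Def.letter_eq [DecidableEq A] (ht : Proj t) (a : Option A) :
    Def C fun w c => w[t c]? = a :=
  (Def.test ht fun b => decide (b = a)).congr fun w c => by simp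

/-- Truth values are not positions and cannot be enumerated by a pointer; a quantifier over them is
resolved into two programs. -/
theorem Def.exists_bool {R : List A → C → Bool → Prop} (h : ∀ b, Def C fun w c => R w c b) :
    Def C fun w c => ∃ b, R w c b :=
  ((h true).or (h false)).congr fun w c => by simp [or_comm]

theorem Def.forall_bool {R : List A → C → Bool → Prop} (h : ∀ b, Def C fun w c => R w c b) :
    Def C fun w c => ∀ b, R w c b :=
  ((h true).and (h false)).congr fun w c => by simp [and_comm]

theorem Def.isBit (ht : Proj t) : Def C fun w c => IsBit w[t c]? :=
  Def.exists_bool fun _ => Def.letter_eq ht _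

theorem Def.isSign (ht : Proj t) : Def C fun w c => IsSign w[t c]? :=
  Def.exists_bool fun _ => Def.letter_eq ht _

theorem Def.pair_eq {t u : C → ℕ × ℕ} (ht : Proj t) (hu : Proj u) :
    Def (A := A) C fun _ c => (t c).1 = (u c).1 ∧ (t c).2 = (u c).2 :=
  (Def.eq ht.fst hu.fst).and (Def.eq ht.snd hu.snd)

theorem Def.nameAt_eq (ht : Proj t) (hu : Proj u) :
    Def C fun w c => nameAt w (t c) = nameAt w (u c) := by
  refine Def.congr_of_le ht hu (Def.exists_reaches (T := ℕ × ℕ) (S := fun w _ => SameBit w)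
    (P := fun w _ u => ¬ IsBit w[u.1]? ∧ ¬ IsBit w[u.2]?)
    (Q := fun _ c x => x.1 = t c ∧ x.2 = u c)
    (E := fun _ x y => x.1 = y.1 ∧ x.2 = y.2) (fun _ x y => Prod.ext_iff.symm)
    (Def.pair_eq Proj.id.snd Proj.id.fst.snd)
    ((Def.exists_bool fun b => (Def.letter_eq Proj.id.fst.fst.snd.fst _).and
      (Def.letter_eq Proj.id.fst.fst.snd.snd _)).and
      ((Def.succ_eq Proj.id.fst.fst.snd.fst Proj.id.fst.snd.fst).and
        (Def.succ_eq Proj.id.fst.fst.snd.snd Proj.id.fst.snd.snd)))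
    ((Def.isBit Proj.id.fst.fst.snd.fst).not.and (Def.isBit Proj.id.fst.fst.snd.snd).not)
    ((Def.eq Proj.id.snd.fst (ht.comp Proj.id.fst)).and
      (Def.eq Proj.id.snd.snd (hu.comp Proj.id.fst)))) ?_
  intro w c h1 h2
  rw [← reaches_sameBit_iff h1 h2]
  constructor
  · intro h
    exact ⟨(t c, u c), mem_enum_prod.2 ⟨mem_enum_nat.2 h1, mem_enum_nat.2 h2⟩, ⟨rfl, rfl⟩, h⟩
  · rintro ⟨⟨x, y⟩, -, ⟨rfl, rfl⟩, h⟩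
    exact h

theorem Def.litIn (ht : Proj t) (hu : Proj u) : Def C fun w c => LitIn w (t c) (u c) :=
  (Def.lt ht hu).and (Def.all (R := fun w c j => t c < j → j < u c → IsBit w[j]? ∨ IsSign w[j]?)
    ((Def.lt (ht.comp Proj.id.fst) Proj.id.snd).imp
      ((Def.lt Proj.id.snd (hu.comp Proj.id.fst)).imp
        ((Def.isBit Proj.id.snd).or (Def.isSign Proj.id.snd)))))

/-- Quantification over the literals of a clause. -/
theorem Def.exists_mem_clauseAt {P : List Letter → C → Literal → Prop} (ht : Proj t)
    (h : ∀ s, Def (C × ℕ) fun w x => P w x.1 ⟨nameAt w x.2, s⟩) :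
    Def C fun w c => ∃ l ∈ clauseAt w (t c), P w c l := by
  -- Only components of the tuple can serve as terms. The start `j` of the name, just after the sign
  -- at `i`, is therefore a quantified position of its own.
  refine (Def.exists_bool fun s => Def.ex (R := fun w c j => (∃ i ≤ w.length, j = i + 1 ∧
    LitIn w (t c) i ∧ w[i]? = some (signLetter s)) ∧ P w c ⟨nameAt w j, s⟩)
    ((Def.ex (R := fun w (x : C × ℕ) i => x.2 = i + 1 ∧ LitIn w (t x.1) i ∧
      w[i]? = some (signLetter s)) ((Def.succ_eq Proj.id.snd Proj.id.fst.snd).and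
      ((Def.litIn (ht.comp Proj.id.fst.fst) Proj.id.snd).and
        (Def.letter_eq Proj.id.snd _)))).and (h s))).congr ?_
  intro w c
  simp only [mem_clauseAt_iff]
  constructor
  · rintro ⟨⟨x, s⟩, ⟨i, hi, h1, h2, h3⟩, h4⟩
    exact ⟨s, i + 1, hi, ⟨i, hi.le, rfl, h1, h2⟩, by rw [h3]; exact h4⟩
  · rintro ⟨s, j, hj, ⟨i, hi, rfl, h1, h2⟩, h3⟩
    exact ⟨_, ⟨i, hj, h1, h2, rfl⟩, h3⟩

theorem Def.forall_mem_clauseAt {P : List Letter → C → Literal → Prop} (ht : Proj t)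
    (h : ∀ s, Def (C × ℕ) fun w x => P w x.1 ⟨nameAt w x.2, s⟩) :
    Def C fun w c => ∀ l ∈ clauseAt w (t c), P w c l :=
  (Def.exists_mem_clauseAt (P := fun w c l => ¬ P w c l) ht fun s => (h s).not).not.congr
    fun w c => by push Not; rfl

theorem Def.literal_eq (ht : Proj t) (hu : Proj u) (s s' : Bool) :
    Def C fun w c => (⟨nameAt w (t c), s⟩ : Literal) = ⟨nameAt w (u c), s'⟩ :=
  ((Def.nameAt_eq ht hu).and (Def.const (s = s'))).congr fun w c => by
    rw [Literal.mk.injEq]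

end Definability

/-! ### Blocks of the advice -/

/-- The items of a listing: each occurrence of the marker `m` is followed by a code. -/
def listed {β : Type} (m : Letter) (f : List Letter → β) : List Letter → List β
  | [] => []
  | a :: t => if a = m then f t :: listed m f t else listed m f t

theorem mem_listed_iff {β : Type} {m : Letter} {f : List Letter → β} {t : List Letter} {x : β} :
    x ∈ listed m f t ↔ ∃ i : ℕ, t[i]? = some m ∧ f (t.drop (i + 1)) = x := by
  induction t with
  | nil => simp [listed]
  | cons a t ih =>
    have split : (∃ i : ℕ, (a :: t)[i]? = some m ∧ f ((a :: t).drop (i + 1)) = x) ↔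
        (a = m ∧ f t = x) ∨ ∃ i : ℕ, t[i]? = some m ∧ f (t.drop (i + 1)) = x := by
      constructor
      · rintro ⟨i, h⟩
        cases i with
        | zero => exact Or.inl (by simpa using h)
        | succ i => exact Or.inr ⟨i, by simpa using h⟩
      · rintro (h | ⟨i, h⟩)
        · exact ⟨0, by simpa using h⟩
        · exact ⟨i + 1, by simpa using h⟩
    rw [split, ← ih, listed]
    by_cases h : a = m
    · simp [h, eq_comm]
    · simp [h]

theorem listed_append_of_notMem {β : Type} {m : Letter} {f : List Letter → β} {s t : List Letter}
    (h : m ∉ s) : listed m f (s ++ t) = listed m f t := by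
  induction s with
  | nil => rfl
  | cons a s ih =>
    rw [List.mem_cons, not_or] at h
    rw [List.cons_append, listed, if_neg (Ne.symm h.1), ih h.2]

/-- The names listed in a word. -/
def namesOf (t : List Letter) : List Var := listed (.inl .name) nameOf t

theorem namesOf_cons (a : Letter) (t : List Letter) : namesOf (a :: t) =
    if a = .inl .name then nameOf t :: namesOf t else namesOf t := rfl

/-- The bits of the advice at the beginning of a word. -/
def adviceOf : List Letter → List Bool
  | .inr i :: t => if i = 2 then [] else decide (i = 1) :: adviceOf t
  | _ => []

theorem mem_namesOf_iff {t : List Letter} {x : Var} : x ∈ namesOf t ↔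
    ∃ i : ℕ, t[i]? = some (.inl .name) ∧ nameOf (t.drop (i + 1)) = x :=
  mem_listed_iff

/-- A name that is not listed again later. -/
def LastName (w : List Letter) (b : ℕ) : Prop :=
  w[b]? = some (.inl .name) ∧ nameAt w (b + 1) ∉ namesOf (w.drop (b + 1))

def IsAdvice (a : Option Letter) : Prop := ∃ b, a = some (adviceLetter b)

theorem adviceOf_cons_adviceLetter (b : Bool) (t : List Letter) :
    adviceOf (adviceLetter b :: t) = b :: adviceOf t := by
  cases b <;> rfl

theorem adviceOf_eq_nil {t : List Letter} (h : ¬ IsAdvice t.head?) : adviceOf t = [] := by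
  match t with
  | [] => rfl
  | .inl _ :: _ => rfl
  | .inr i :: t =>
    match i with
    | 0 => exact (h ⟨false, rfl⟩).elim
    | 1 => exact (h ⟨true, rfl⟩).elim
    | 2 => rfl

/-- One step of a parallel walk through the listed names and a block of the advice. -/
def WalkStep (w : List Letter) (u v : ℕ × ℕ) : Prop :=
  v.1 = u.1 + 1 ∧ ((LastName w u.1 ∧ IsAdvice w[u.2]? ∧ v.2 = u.2 + 1) ∨
    (¬ LastName w u.1 ∧ v.2 = u.2))

/-- The literal is true under the assignment given by the block of the advice with marker at
`p`. -/
def TrueAt (w : List Letter) (p : ℕ) (l : Literal) : Prop :=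
  (l.var, l.positive) ∈ (namesOf w).dedup.zip (adviceOf (w.drop (p + 1)))

theorem Reaches.cases_iff {T : Type} {E : List T} {S : T → T → Prop} {P : T → Prop} {u : T} :
    Reaches E S P u ↔ P u ∨ ∃ v ∈ E, S u v ∧ Reaches E S P v := by
  constructor
  · rintro (⟨_, h⟩ | ⟨_, v, h1, h2, h3⟩)
    · exact Or.inl h
    · exact Or.inr ⟨v, h1, h2, h3⟩
  · rintro (h | ⟨v, h1, h2, h3⟩)
    · exact .target _ h
    · exact .step _ v h1 h2 h3

/-! ### Pairing the backdoor variables with the bits of a block -/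

section Walk

variable {w : List Letter}

/-- Removal of duplicates keeps the last occurrence of each name. This is why the walk consumes an
advice bit exactly at the names that are not listed again later. -/
theorem namesOf_dedup_of_lastName {b : ℕ} (h : LastName w b) : (namesOf (w.drop b)).dedup =
    nameAt w (b + 1) :: (namesOf (w.drop (b + 1))).dedup := by
  obtain ⟨hb, e⟩ := List.getElem?_eq_some_iff.1 h.1
  rw [List.drop_eq_getElem_cons hb, namesOf_cons, if_pos e]
  exact List.dedup_cons_of_notMem h.2

theorem namesOf_dedup_of_not_lastName {b : ℕ} (h : ¬ LastName w b) : (namesOf (w.drop b)).dedup =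
    (namesOf (w.drop (b + 1))).dedup := by
  by_cases hb : b < w.length
  · rw [List.drop_eq_getElem_cons hb, namesOf_cons]
    split_ifs with e
    · refine List.dedup_cons_of_mem ?_
      by_contra h'
      exact h ⟨by rw [List.getElem?_eq_getElem hb, e], h'⟩
    · rfl
  · rw [List.drop_of_length_le (by omega), List.drop_of_length_le (by omega)]

theorem adviceOf_of_advice {q : ℕ} {b : Bool} (h : w[q]? = some (adviceLetter b)) :
    adviceOf (w.drop q) = b :: adviceOf (w.drop (q + 1)) := by
  obtain ⟨hq, e⟩ := List.getElem?_eq_some_iff.1 h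
  rw [List.drop_eq_getElem_cons hq, e, adviceOf_cons_adviceLetter]

theorem adviceOf_of_not_advice {q : ℕ} (h : ¬ IsAdvice w[q]?) : adviceOf (w.drop q) = [] :=
  adviceOf_eq_nil (by rwa [List.head?_drop])

/-- Induction along a walk. -/
theorem reaches_walk_iff {P : ℕ × ℕ → Prop} {Q : List Var → List Bool → Prop}
    (h0 : ∀ q, P (w.length, q) ↔ Q [] (adviceOf (w.drop q)))
    (h1 : ∀ b < w.length, ∀ q, ¬ LastName w b → ¬ P (b, q))
    (h2 : ∀ b q, LastName w b → ¬ IsAdvice w[q]? →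
      (P (b, q) ↔ Q (nameAt w (b + 1) :: (namesOf (w.drop (b + 1))).dedup) []))
    (h3 : ∀ b q a, LastName w b → w[q]? = some (adviceLetter a) →
      ((P (b, q) ∨ Q (namesOf (w.drop (b + 1))).dedup (adviceOf (w.drop (q + 1)))) ↔
        Q (nameAt w (b + 1) :: (namesOf (w.drop (b + 1))).dedup)
          (a :: adviceOf (w.drop (q + 1)))))
    {b q : ℕ} (hb : b ≤ w.length) (hq : q ≤ w.length) :
    Reaches (Enum.enum w.length) (WalkStep w) P (b, q) ↔
      Q (namesOf (w.drop b)).dedup (adviceOf (w.drop q)) := by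
  induction hm : w.length - b generalizing b q with
  | zero =>
    obtain rfl : b = w.length := by omega
    rw [Reaches.cases_iff, List.drop_length, show namesOf [] = [] from rfl, List.dedup_nil, ← h0,
      -- At the end of the word the walk has stopped, since the next position is outside the
      -- enumeration.
      or_iff_left_iff_imp]
    rintro ⟨⟨v1, v2⟩, hv, h, -⟩
    rw [mem_enum_prod, mem_enum_nat] at hv
    have := hv.1
    have := h.1
    simp only at *
    omega
  | succ m ih =>
    have step : ∀ q' ≤ w.length, Reaches (Enum.enum w.length) (WalkStep w) P (b + 1, q') ↔
        Q (namesOf (w.drop (b + 1))).dedup (adviceOf (w.drop q')) := fun q' hq' =>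
      ih (by omega) hq' (by omega)
    have mem : ∀ q' ≤ w.length, (b + 1, q') ∈ Enum.enum (T := ℕ × ℕ) w.length := fun q' hq' =>
      mem_enum_prod.2 ⟨mem_enum_nat.2 (by simp; omega), mem_enum_nat.2 hq'⟩
    rw [Reaches.cases_iff]
    by_cases hl : LastName w b
    · rw [namesOf_dedup_of_lastName hl]
      by_cases ha : IsAdvice w[q]?
      · obtain ⟨a, ha'⟩ := id ha
        have hq' : q + 1 ≤ w.length := (List.getElem?_eq_some_iff.1 ha').1
        rw [adviceOf_of_advice ha', ← h3 b q a hl ha', ← step _ hq']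
        refine or_congr Iff.rfl ⟨?_, fun h => ⟨_, mem _ hq', ⟨rfl, Or.inl ⟨hl, ha, rfl⟩⟩, h⟩⟩
        rintro ⟨⟨v1, v2⟩, -, ⟨rfl, ⟨-, -, rfl⟩ | ⟨h, -⟩⟩, h'⟩
        · exact h'
        · exact (h hl).elim
      · rw [adviceOf_of_not_advice ha, ← h2 b q hl ha, or_iff_left_iff_imp]
        rintro ⟨v, -, ⟨-, ⟨-, h, -⟩ | ⟨h, -⟩⟩, -⟩
        · exact (ha h).elim
        · exact (h hl).elim
    · rw [namesOf_dedup_of_not_lastName hl, ← step _ hq,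
        or_iff_right (h1 b (by omega) q hl)]
      refine ⟨?_, fun h => ⟨_, mem _ hq, ⟨rfl, Or.inr ⟨hl, rfl⟩⟩, h⟩⟩
      rintro ⟨⟨v1, v2⟩, -, ⟨rfl, ⟨h, -⟩ | ⟨-, h⟩⟩, h'⟩
      · exact (hl h).elim
      · obtain rfl : v2 = q := h
        exact h'

theorem not_lastName_length : ¬ LastName w w.length := fun h => by simpa using h.1

theorem reaches_walk_trueAt_iff {l : Literal} {b q : ℕ} (hb : b ≤ w.length) (hq : q ≤ w.length) :
    Reaches (Enum.enum w.length) (WalkStep w) (fun u => LastName w u.1 ∧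
      nameAt w (u.1 + 1) = l.var ∧ w[u.2]? = some (adviceLetter l.positive)) (b, q) ↔
      (l.var, l.positive) ∈ (namesOf (w.drop b)).dedup.zip (adviceOf (w.drop q)) := by
  refine reaches_walk_iff (Q := fun B β => (l.var, l.positive) ∈ B.zip β) ?_ ?_ ?_ ?_ hb hq
  · intro q
    simp [not_lastName_length]
  · intro b _ q h h'
    exact h h'.1
  · intro b q _ ha
    simp only [List.zip_nil_right, List.not_mem_nil, iff_false]
    exact fun h => ha ⟨_, h.2.2⟩
  · intro b q a hl ha
    rw [List.zip_cons_cons, List.mem_cons, Prod.mk.injEq, ha, Option.some_inj,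
      adviceLetter_injective.eq_iff]
    simp only [hl, true_and]
    tauto

/-- Names and bits are consumed one against one, so the lengths agree iff the bits are used up when
the walk comes to the end of the word. -/
theorem reaches_walk_length_iff {b q : ℕ} (hb : b ≤ w.length) (hq : q ≤ w.length) :
    Reaches (Enum.enum w.length) (WalkStep w) (fun u => w[u.1]? = none ∧ ¬ IsAdvice w[u.2]?)
      (b, q) ↔ (namesOf (w.drop b)).dedup.length = (adviceOf (w.drop q)).length := by
  refine reaches_walk_iff (Q := fun B β => B.length = β.length) ?_ ?_ ?_ ?_ hb hq
  · intro q
    simp only [List.getElem?_length, true_and, List.length_nil]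
    constructor
    · intro h
      rw [adviceOf_of_not_advice h, List.length_nil]
    · rintro h ⟨a, ha⟩
      rw [adviceOf_of_advice ha] at h
      simp at h
  · intro b hb q _ h
    simp at h
    omega
  · intro b q hl ha
    have := (List.getElem?_eq_some_iff.1 hl.1).1
    simp
    omega
  · intro b q a hl ha
    have := (List.getElem?_eq_some_iff.1 hl.1).1
    simp
    omega

end Walk

/-! ### Definability of the assignment given by a block -/

section Definability

variable {C : Type} [Ctx C] {t u : C → ℕ}

/-- Definability of relations that refer to the next position. -/
theorem Def.at_succ {A : Type} {R : List A → C → ℕ → Prop} (ht : Proj t)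
    (hR : Def (C × ℕ) fun w x => R w x.1 x.2) :
    Def C fun w c => t c < w.length ∧ R w c (t c + 1) :=
  (Def.ex (R := fun w c j => j = t c + 1 ∧ R w c j)
    ((Def.succ_eq (ht.comp Proj.id.fst) Proj.id.snd).and hR)).congr fun w c => by
    constructor
    · rintro ⟨h, h'⟩
      exact ⟨_, h, rfl, h'⟩
    · rintro ⟨_, h, rfl, h'⟩
      exact ⟨h, h'⟩

/-- A form in which the next position appears only under the guard that it still belongs to the
word, as `Def.at_succ` needs. -/
theorem lastName_iff {w : List Letter} {b : ℕ} : LastName w b ↔ b < w.length ∧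
    w[b]? = some (.inl .name) ∧ ¬ ∃ b' ≤ w.length, b < b' ∧ w[b']? = some (.inl .name) ∧
      b' < w.length ∧ nameAt w (b' + 1) = nameAt w (b + 1) := by
  have : nameAt w (b + 1) ∈ namesOf (w.drop (b + 1)) ↔ ∃ b' ≤ w.length, b < b' ∧
      w[b']? = some (.inl .name) ∧ b' < w.length ∧ nameAt w (b' + 1) = nameAt w (b + 1) := by
    rw [mem_namesOf_iff]
    simp only [List.getElem?_drop, List.drop_drop]
    constructor
    · rintro ⟨i, h1, h2⟩
      have := (List.getElem?_eq_some_iff.1 h1).1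
      exact ⟨b + 1 + i, this.le, by omega, h1, this, h2⟩
    · rintro ⟨b', -, h1, h2, -, h3⟩
      obtain ⟨i, rfl⟩ : ∃ i, b' = b + 1 + i := ⟨b' - (b + 1), by omega⟩
      exact ⟨i, h2, h3⟩
  rw [← this]
  exact ⟨fun h => ⟨(List.getElem?_eq_some_iff.1 h.1).1, h⟩, fun h => h.2⟩

theorem Def.lastName (ht : Proj t) : Def C fun w c => LastName w (t c) :=
  (Def.at_succ ht (R := fun w c j => w[t c]? = some (.inl .name) ∧ ¬ ∃ b' ≤ w.length, t c < b' ∧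
      w[b']? = some (.inl .name) ∧ b' < w.length ∧ nameAt w (b' + 1) = nameAt w j)
    ((Def.letter_eq (ht.comp Proj.id.fst) _).and
      (Def.ex (R := fun w (x : C × ℕ) b' => t x.1 < b' ∧ w[b']? = some (.inl .name) ∧
        b' < w.length ∧ nameAt w (b' + 1) = nameAt w x.2)
        ((Def.lt (ht.comp Proj.id.fst.fst) Proj.id.snd).and
          ((Def.letter_eq Proj.id.snd _).and
            (Def.at_succ (R := fun w (x : (C × ℕ) × ℕ) j' => nameAt w j' = nameAt w x.1.2)
              Proj.id.snd (Def.nameAt_eq Proj.id.snd Proj.id.fst.fst.snd))))).not)).congr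
    fun _ _ => lastName_iff

theorem Def.isAdvice (ht : Proj t) : Def C fun w c => IsAdvice w[t c]? :=
  Def.exists_bool fun _ => Def.letter_eq ht _

theorem Def.walkStep {t u : C → ℕ × ℕ} (ht : Proj t) (hu : Proj u) :
    Def C fun w c => WalkStep w (t c) (u c) :=
  (Def.succ_eq ht.fst hu.fst).and
    (((Def.lastName ht.fst).and ((Def.isAdvice ht.snd).and (Def.succ_eq ht.snd hu.snd))).or
      ((Def.lastName ht.fst).not.and (Def.eq hu.snd ht.snd)))

/-- Definability of the walk that starts after the marker of a block. -/
theorem Def.walk {P : List Letter → C → ℕ × ℕ → Prop} (ht : Proj t)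
    (hP : Def ((((C × (ℕ × ℕ)) × (ℕ × ℕ)) × (ℕ × ℕ)) × (ℕ × ℕ)) fun w x =>
      P w x.1.1.1.1 x.1.1.2) :
    Def C fun w c => t c < w.length ∧
      Reaches (Enum.enum w.length) (WalkStep w) (P w c) (0, t c + 1) := by
  refine (Def.exists_reaches (T := ℕ × ℕ) (S := fun w _ => WalkStep w) (P := P)
    (Q := fun _ c x => x.1 = 0 ∧ x.2 = t c + 1)
    (E := fun _ x y => x.1 = y.1 ∧ x.2 = y.2) (fun _ x y => Prod.ext_iff.symm)
    (Def.pair_eq Proj.id.snd Proj.id.fst.snd)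
    (Def.walkStep Proj.id.fst.fst.snd Proj.id.fst.snd) hP
    ((Def.eq_zero Proj.id.snd.fst).and
      (Def.succ_eq (ht.comp Proj.id.fst) Proj.id.snd.snd))).congr ?_
  intro w c
  constructor
  · rintro ⟨h, h'⟩
    exact ⟨(0, t c + 1), mem_enum_prod.2 ⟨mem_enum_nat.2 (Nat.zero_le _), mem_enum_nat.2 h⟩,
      ⟨rfl, rfl⟩, h'⟩
  · rintro ⟨⟨x, y⟩, h, ⟨rfl, rfl⟩, h'⟩
    exact ⟨mem_enum_nat.1 (mem_enum_prod.1 h).2, h'⟩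

theorem Def.trueAt (ht : Proj t) (hu : Proj u) (s : Bool) :
    Def C fun w c => TrueAt w (t c) ⟨nameAt w (u c), s⟩ := by
  refine (Def.walk (P := fun w c x => LastName w x.1 ∧ (x.1 < w.length ∧
    nameAt w (x.1 + 1) = nameAt w (u c)) ∧ w[x.2]? = some (adviceLetter s)) ht
    ((Def.lastName Proj.id.fst.fst.snd.fst).and ((Def.at_succ
      (R := fun w (x : (((C × (ℕ × ℕ)) × (ℕ × ℕ)) × (ℕ × ℕ)) × (ℕ × ℕ)) j =>
        nameAt w j = nameAt w (u x.1.1.1.1)) Proj.id.fst.fst.snd.fst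
      (Def.nameAt_eq Proj.id.snd (hu.comp Proj.id.fst.fst.fst.fst.fst))).and
        (Def.letter_eq Proj.id.fst.fst.snd.snd _)))).congr ?_
  intro w c
  by_cases h : t c < w.length
  · have e : (fun x : ℕ × ℕ => LastName w x.1 ∧ (x.1 < w.length ∧
        nameAt w (x.1 + 1) = nameAt w (u c)) ∧ w[x.2]? = some (adviceLetter s)) =
        fun x => LastName w x.1 ∧ nameAt w (x.1 + 1) = nameAt w (u c) ∧
          w[x.2]? = some (adviceLetter s) := by
      funext x
      refine propext (and_congr_right fun hx => ?_)
      simp [(List.getElem?_eq_some_iff.1 hx.1).1]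
    rw [e]
    have := reaches_walk_trueAt_iff (w := w) (l := ⟨nameAt w (u c), s⟩) (Nat.zero_le _) h
    simp only [Nat.succ_eq_add_one] at this
    rw [this, List.drop_zero, TrueAt]
    simp [h]
  · simp [TrueAt, h, List.drop_of_length_le (show w.length ≤ t c + 1 by omega), adviceOf]

theorem Def.blockLength (ht : Proj t) : Def C fun w c => t c < w.length ∧
    (namesOf w).dedup.length = (adviceOf (w.drop (t c + 1))).length := by
  refine (Def.walk (P := fun w _ x => w[x.1]? = none ∧ ¬ IsAdvice w[x.2]?) ht
    ((Def.letter_eq Proj.id.fst.fst.snd.fst _).and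
      (Def.isAdvice Proj.id.fst.fst.snd.snd).not)).congr ?_
  intro w c
  refine and_congr_right fun h => ?_
  rw [reaches_walk_length_iff (Nat.zero_le _) h, List.drop_zero]

end Definability

/-! ### Definability of unit propagation -/

/-- The position is before the marker of the conclusion. -/
def BeforeGoal (w : List Letter) (c : ℕ) : Prop := ∀ j < c, w[j]? ≠ some (.inl .goal)

def IsPremise (w : List Letter) (c : ℕ) : Prop :=
  w[c]? = some (.inl .clause) ∧ BeforeGoal w c

def IsConclusion (w : List Letter) (c : ℕ) : Prop :=
  w[c]? = some (.inl .clause) ∧ ¬ BeforeGoal w c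

/-- The clauses of the premises. -/
def premises (w : List Letter) : Set Clause := {C | ∃ c, IsPremise w c ∧ clauseAt w c = C}

/-- Literals as pairs of positions. -/
def litOf (w : List Letter) (u : ℕ × ℕ) : Literal := ⟨nameAt w u.1, decide (u.2 = 0)⟩

/-- Relations between words, tuples and literals whose names are given by positions. -/
def DefLit (C : Type) [Ctx C] (P : List Letter → C → Literal → Prop) : Prop :=
  ∀ {D : Type} [Ctx D] {t : D → C} {u : D → ℕ}, Proj t → Proj u → ∀ s,
    Def D fun w x => P w (t x) ⟨nameAt w (u x), s⟩

/-- `z` codes the complement of a literal that has to be refuted before `u` follows from the clause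
at `v`. -/
def Needs (w : List Letter) (base : Literal → Prop) (u v z : ℕ × ℕ) : Prop :=
  ¬ base (litOf w u) ∧ (IsPremise w v.1 ∧ litOf w u ∈ clauseAt w v.1 →
    ∃ l ∈ clauseAt w v.1, l ≠ litOf w u ∧ litOf w z = l.compl)

/-! ### Unit propagation as a least fixed point on positions -/

section Semantics

variable {w : List Letter} {base : Literal → Prop}

/-- The second position codes the sign: 0 is positive, anything else negative. A nonempty word is
needed so that 1 is an available position. -/
theorem exists_litOf_eq (hn : 0 < w.length) {l : Literal} {i : ℕ} (hi : i ≤ w.length)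
    (h : nameAt w i = l.var) : ∃ u ∈ Enum.enum (T := ℕ × ℕ) w.length, litOf w u = l := by
  refine ⟨(i, if l.positive then 0 else 1), mem_enum_prod.2 ⟨mem_enum_nat.2 hi, mem_enum_nat.2 ?_⟩,
    Literal.ext h ?_⟩
  · simp only
    split <;> omega
  · cases l.positive <;> simp [litOf]

theorem exists_nameAt_of_mem_clauseAt {c : ℕ} {l : Literal} (h : l ∈ clauseAt w c) :
    ∃ i ≤ w.length, nameAt w i = l.var := by
  obtain ⟨i, hi, -, -, h⟩ := mem_clauseAt_iff.1 h
  exact ⟨i + 1, hi, h⟩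

/-- The existential component `v` guesses the marker of the clause used for propagation, and the
universal component `z` runs through the complements of its other literals. As in
`Def.exists_reaches`, basic literals require nothing, and a wrong guess requires everything. -/
theorem derivable_iff_unitDerivable (hn : 0 < w.length) {u : ℕ × ℕ}
    (hu : u ∈ Enum.enum w.length) : Derivable (Enum.enum w.length) (Needs w base) u ↔
      UnitDerivable (premises w) base (litOf w u) := by
  constructor
  · intro h
    induction h with
    | intro u v hv _ ih =>
      by_cases hb : base (litOf w u)
      · exact .base _ hb
      by_cases hC : IsPremise w v.1 ∧ litOf w u ∈ clauseAt w v.1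
      · refine .unit _ _ ⟨_, hC.1, rfl⟩ hC.2 fun l hl hne => ?_
        obtain ⟨i, hi, e⟩ := exists_nameAt_of_mem_clauseAt hl
        obtain ⟨z, hz, e⟩ := exists_litOf_eq (l := l.compl) hn hi e
        rw [← e]
        exact ih z hz ⟨hb, fun _ => ⟨l, hl, hne, e⟩⟩ hz
      -- For a wrong guess `Needs` holds for every `z`, in particular for `u` itself, whose
      -- derivation is then a premise.
      · exact ih u hu ⟨hb, fun h => (hC h).elim⟩ hu
  · intro h
    generalize hl : litOf w u = l at h
    induction h generalizing u with
    | base l h => exact .intro u u hu fun z _ hz => (hz.1 (hl ▸ h)).elim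
    | unit C l hC hlC _ ih =>
      obtain ⟨c, hc, rfl⟩ := hC
      have hcn : c < w.length := (List.getElem?_eq_some_iff.1 hc.1).1
      refine .intro u (c, 0) (mem_enum_prod.2 ⟨mem_enum_nat.2 hcn.le,
        mem_enum_nat.2 (Nat.zero_le _)⟩) fun z hz hG => ?_
      obtain ⟨l', hl', hne, e⟩ := hG.2 ⟨hc, hl ▸ hlC⟩
      exact ih l' hl' (hl ▸ hne) hz e

/-- A derived literal is basic or occurs in a clause, so its variable is named in the word and a
contradictory pair can be sought by position. -/
theorem conflict_iff (hb : ∀ l, base l → ∃ i ≤ w.length, nameAt w i = l.var) :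
    Conflict (premises w) base ↔ (∃ i ≤ w.length, UnitDerivable (premises w) base
      ⟨nameAt w i, true⟩ ∧ UnitDerivable (premises w) base ⟨nameAt w i, false⟩) ∨
      ∃ c ≤ w.length, IsPremise w c ∧ ¬ ∃ l ∈ clauseAt w c, True := by
  refine or_congr ⟨?_, ?_⟩ ?_
  · rintro ⟨⟨x, s⟩, h1, h2⟩
    obtain ⟨i, hi, rfl⟩ : ∃ i ≤ w.length, nameAt w i = x := by
      rcases id h1 with ⟨_, h⟩ | ⟨C, _, ⟨c, -, rfl⟩, h, -⟩
      · exact hb _ h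
      · exact exists_nameAt_of_mem_clauseAt h
    refine ⟨i, hi, ?_⟩
    cases s
    · exact ⟨h2, h1⟩
    · exact ⟨h1, h2⟩
  · rintro ⟨i, -, h1, h2⟩
    exact ⟨_, h1, h2⟩
  · constructor
    · rintro ⟨c, hc, h⟩
      exact ⟨c, (List.getElem?_eq_some_iff.1 hc.1).1.le, hc, by simp [h]⟩
    · rintro ⟨c, -, hc, h⟩
      refine ⟨c, hc, Finset.eq_empty_of_forall_notMem fun l hl => h ⟨l, hl, trivial⟩⟩

theorem exists_nameAt_of_trueAt {p : ℕ} {l : Literal} (h : TrueAt w p l) :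
    ∃ i ≤ w.length, nameAt w i = l.var := by
  obtain ⟨i, h1, h2⟩ := mem_namesOf_iff.1 (List.mem_dedup.1 (List.of_mem_zip h).1)
  exact ⟨i + 1, (List.getElem?_eq_some_iff.1 h1).1, h2⟩

theorem exists_nameAt_of_refutationBase {p d a : ℕ} {s : Bool} {l : Literal}
    (h : refutationBase (TrueAt w p) (clauseAt w d) ⟨nameAt w a, s⟩ l) :
    ∃ i ≤ w.length, nameAt w i = l.var := by
  rcases h with h | h | rfl
  · exact exists_nameAt_of_trueAt h
  · exact exists_nameAt_of_mem_clauseAt (l := l.compl) h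
  · by_cases ha : a ≤ w.length
    · exact ⟨a, ha, rfl⟩
    · refine ⟨w.length, le_rfl, ?_⟩
      simp [nameAt, List.drop_of_length_le (show w.length ≤ a by omega)]

end Semantics

section Definability

variable {C : Type} [Ctx C] {t u : C → ℕ}

theorem Def.length_pos {A : Type} [DecidableEq A] : Def (A := A) C fun w _ => 0 < w.length :=
  (Def.ex (R := fun w _ i => ¬ w[i]? = none) (Def.letter_eq Proj.id.snd _).not).congr
    fun w _ => by
      simp only [List.getElem?_eq_none_iff, not_le]
      exact ⟨fun h => ⟨0, Nat.zero_le _, h⟩, fun ⟨i, _, h⟩ => by omega⟩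

theorem Def.beforeGoal (ht : Proj t) : Def C fun w c => BeforeGoal w (t c) :=
  (Def.all (R := fun w c j => j < t c → ¬ w[j]? = some (.inl .goal))
    ((Def.lt Proj.id.snd (ht.comp Proj.id.fst)).imp (Def.letter_eq Proj.id.snd _).not)).congr
    fun _ _ => ⟨fun h j _ hj => h j hj, fun h j hj e =>
      h j (List.getElem?_eq_some_iff.1 e).1.le hj e⟩

theorem Def.isPremise (ht : Proj t) : Def C fun w c => IsPremise w (t c) :=
  (Def.letter_eq ht _).and (Def.beforeGoal ht)

theorem Def.isConclusion (ht : Proj t) : Def C fun w c => IsConclusion w (t c) :=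
  (Def.letter_eq ht _).and (Def.beforeGoal ht).not

theorem Def.litOf {R : List Letter → C → Literal → Prop} {u : C → ℕ × ℕ} (hu : Proj u)
    (h : ∀ s, Def C fun w c => R w c ⟨nameAt w (u c).1, s⟩) :
    Def C fun w c => R w c (litOf w (u c)) :=
  (((Def.eq_zero hu.snd).and (h true)).or ((Def.eq_zero hu.snd).not.and (h false))).congr
    fun w c => by
      by_cases e : (u c).2 = 0 <;> simp [BackdoorImp.litOf, e]

theorem Def.mem_clauseAt (ht : Proj t) (hu : Proj u) (s : Bool) :
    Def C fun w c => (⟨nameAt w (u c), s⟩ : Literal) ∈ clauseAt w (t c) :=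
  (Def.exists_mem_clauseAt (P := fun w c l => l = ⟨nameAt w (u c), s⟩) ht fun s' =>
    Def.literal_eq Proj.id.snd (hu.comp Proj.id.fst) s' s).congr fun w c => by simp

theorem Def.needs {base : List Letter → C → Literal → Prop} (hb : DefLit C base) {D : Type}
    [Ctx D] {f : D → C} {u v z : D → ℕ × ℕ} (hf : Proj f) (hu : Proj u) (hv : Proj v)
    (hz : Proj z) : Def D fun w x => Needs w (base w (f x)) (u x) (v x) (z x) := by
  refine (Def.litOf (R := fun w x l => base w (f x) l) hu fun s => hb hf hu.fst s).not.and
    (((Def.isPremise hv.fst).and (Def.litOf (R := fun w x l => l ∈ clauseAt w (v x).1) hu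
      fun s => Def.mem_clauseAt hv.fst hu.fst s)).imp
    (Def.exists_mem_clauseAt (P := fun w x l => l ≠ BackdoorImp.litOf w (u x) ∧
      BackdoorImp.litOf w (z x) = l.compl) hv.fst fun s => ?_))
  refine (Def.litOf (R := fun w (x : D × ℕ) l => (⟨nameAt w x.2, s⟩ : Literal) = l)
    (hu.comp Proj.id.fst) fun s' => ?_).not.and
    (Def.litOf (R := fun w (x : D × ℕ) l => l = ⟨nameAt w x.2, !s⟩) (hz.comp Proj.id.fst)
      fun s' => ?_)
  · exact Def.literal_eq Proj.id.snd (hu.comp Proj.id.fst).fst s s'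
  · exact Def.literal_eq (hz.comp Proj.id.fst).fst Proj.id.snd s' (!s)

theorem Def.unitDerivable {base : List Letter → C → Literal → Prop} (hb : DefLit C base) {D : Type}
    [Ctx D] {f : D → C} (hf : Proj f) {t : D → ℕ} (ht : Proj t) (s : Bool) :
    Def D fun w x => 0 < w.length ∧
      UnitDerivable (premises w) (base w (f x)) ⟨nameAt w (t x), s⟩ := by
  refine Def.congr_of_le ht ht (Def.length_pos.and (Def.exists_derivable (T := ℕ × ℕ)
    (G := fun w x => Needs w (base w (f x))) (Q := fun _ x u => u.1 = t x ∧ (u.2 = 0 ↔ s = true))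
    (Def.needs hb (hf.comp Proj.id.fst.fst.fst.fst) Proj.id.fst.fst.snd Proj.id.fst.snd Proj.id.snd)
    ((Def.eq Proj.id.snd.fst (ht.comp Proj.id.fst)).and
      ((Def.eq_zero Proj.id.snd.snd).iff (Def.const _))))) ?_
  intro w x hx _
  refine and_congr_right fun hn => ?_
  constructor
  · intro h
    refine ⟨(t x, if s then 0 else 1), ?_, ?_, ?_⟩
    · refine mem_enum_prod.2 ⟨mem_enum_nat.2 hx, mem_enum_nat.2 ?_⟩
      simp only
      split <;> omega
    · cases s <;> simp
    · rw [derivable_iff_unitDerivable hn]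
      · cases s <;> exact h
      · refine mem_enum_prod.2 ⟨mem_enum_nat.2 hx, mem_enum_nat.2 ?_⟩
        simp only
        split <;> omega
  · rintro ⟨⟨i, j⟩, hu, ⟨rfl, hj⟩, h⟩
    rw [derivable_iff_unitDerivable hn hu] at h
    convert h using 1
    simp only at hj
    simp [BackdoorImp.litOf, hj]

theorem Def.conflict {base : List Letter → C → Literal → Prop} (hb : DefLit C base)
    (hname : ∀ w c l, base w c l → ∃ i ≤ w.length, nameAt w i = l.var) :
    Def C fun w c => 0 < w.length ∧ Conflict (premises w) (base w c) := by
  refine ((Def.ex (R := fun w c i => (0 < w.length ∧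
      UnitDerivable (premises w) (base w c) ⟨nameAt w i, true⟩) ∧ (0 < w.length ∧
      UnitDerivable (premises w) (base w c) ⟨nameAt w i, false⟩))
    ((Def.unitDerivable hb Proj.id.fst Proj.id.snd true).and
      (Def.unitDerivable hb Proj.id.fst Proj.id.snd false))).or (Def.length_pos.and
    (Def.ex (R := fun w _ c => IsPremise w c ∧ ¬ ∃ l ∈ clauseAt w c, True)
      ((Def.isPremise Proj.id.snd).and (Def.exists_mem_clauseAt (P := fun _ _ _ => True)
        Proj.id.snd fun _ => Def.const _).not)))).congr ?_
  intro w c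
  rw [conflict_iff (hname w c)]
  by_cases hn : 0 < w.length
  · simp only [hn, true_and]
  · simp [hn]

/-! ### The acceptance condition -/

/-- All clauses of the word satisfy `K` under all assignments that are listed in the advice, and
unit propagation derives all clauses of the conclusion. -/
def Accepts (K : (Literal → Prop) → Clause → Prop) (w : List Letter) : Prop :=
  ∀ p, w[p]? = some (.inr 2) →
    (namesOf w).dedup.length = (adviceOf (w.drop (p + 1))).length ∧
    (∀ c, w[c]? = some (.inl .clause) → K (TrueAt w p) (clauseAt w c)) ∧
    ∀ d, IsConclusion w d → ∃ a ≤ w.length, ∀ s, Conflict (premises w)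
      (refutationBase (TrueAt w p) (clauseAt w d) ⟨nameAt w a, s⟩)

/-- Conditions on clauses of the word under an assignment in the advice. -/
def DefClause (K : (Literal → Prop) → Clause → Prop) : Prop :=
  ∀ {D : Type} [Ctx D] {p c : D → ℕ}, Proj p → Proj c →
    Def D fun w x => K (TrueAt w (p x)) (clauseAt w (c x))

theorem Def.accepts {K : (Literal → Prop) → Clause → Prop} (hK : DefClause K) :
    Def C fun w _ => Accepts K w := by
  refine (Def.all (R := fun w _ p => w[p]? = some (.inr 2) → (p < w.length ∧
    (namesOf w).dedup.length = (adviceOf (w.drop (p + 1))).length) ∧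
    (∀ c ≤ w.length, w[c]? = some (.inl .clause) → K (TrueAt w p) (clauseAt w c)) ∧
    ∀ d ≤ w.length, IsConclusion w d → ∃ a ≤ w.length, ∀ s, 0 < w.length ∧ Conflict (premises w)
      (refutationBase (TrueAt w p) (clauseAt w d) ⟨nameAt w a, s⟩)) ?_).congr ?_
  · refine (Def.letter_eq Proj.id.snd _).imp ((Def.blockLength Proj.id.snd).and (Def.and
      (Def.all (R := fun w (x : C × ℕ) c => w[c]? = some (.inl .clause) →
        K (TrueAt w x.2) (clauseAt w c))
        ((Def.letter_eq Proj.id.snd _).imp (hK Proj.id.fst.snd Proj.id.snd)))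
      (Def.all (R := fun w (x : C × ℕ) d => IsConclusion w d → ∃ a ≤ w.length, ∀ s,
        0 < w.length ∧ Conflict (premises w)
          (refutationBase (TrueAt w x.2) (clauseAt w d) ⟨nameAt w a, s⟩))
        ((Def.isConclusion Proj.id.snd).imp (Def.ex (R := fun w (x : (C × ℕ) × ℕ) a => ∀ s,
          0 < w.length ∧ Conflict (premises w)
            (refutationBase (TrueAt w x.1.2) (clauseAt w x.2) ⟨nameAt w a, s⟩)) ?_)))))
    refine Def.forall_bool fun s => Def.conflict (C := ((C × ℕ) × ℕ) × ℕ)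
      (base := fun w x => refutationBase (TrueAt w x.1.1.2) (clauseAt w x.1.2) ⟨nameAt w x.2, s⟩)
      ?_ fun _ _ l h => exists_nameAt_of_refutationBase h
    exact fun ht hu s' => (Def.trueAt ht.fst.fst.snd hu s').or
      ((Def.mem_clauseAt ht.fst.snd hu (!s')).or (Def.literal_eq hu ht.snd s' s))
  · intro w _
    constructor
    · intro h p _ hp
      have hpl : p < w.length := (List.getElem?_eq_some_iff.1 hp).1
      obtain ⟨h1, h2, h3⟩ := h p hp
      refine ⟨⟨hpl, h1⟩, fun c _ => h2 c, fun d _ hd => ?_⟩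
      obtain ⟨a, ha, h⟩ := h3 d hd
      exact ⟨a, ha, fun s => ⟨by omega, h s⟩⟩
    · intro h p hp
      have hpl : p < w.length := (List.getElem?_eq_some_iff.1 hp).1
      obtain ⟨⟨-, h1⟩, h2, h3⟩ := h p hpl.le hp
      refine ⟨h1, fun c hc => h2 c (List.getElem?_eq_some_iff.1 hc).1.le hc, fun d hd => ?_⟩
      obtain ⟨a, ha, h⟩ := h3 d (List.getElem?_eq_some_iff.1 hd.1).1.le hd
      exact ⟨a, ha, fun s => (h s).2⟩

theorem defClause_exists_trueAt {D : Type} [Ctx D] {p c : D → ℕ} (hp : Proj p) (hc : Proj c) :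
    Def D fun w x => ∃ l ∈ clauseAt w (c x), TrueAt w (p x) l :=
  Def.exists_mem_clauseAt (P := fun w x l => TrueAt w (p x) l) hc fun s =>
    Def.trueAt (hp.comp Proj.id.fst) Proj.id.snd s

theorem defClause_horn : DefClause HornClause := fun {D} _ {p c} hp hc =>
  (defClause_exists_trueAt hp hc).or (Def.forall_mem_clauseAt (P := fun w x l =>
    ∀ l' ∈ clauseAt w (c x), ¬ TrueAt w (p x) l.compl → ¬ TrueAt w (p x) l'.compl →
      l.positive = true → l'.positive = true → l = l') hc fun s =>
    Def.forall_mem_clauseAt (P := fun w (x : D × ℕ) l' => ¬ TrueAt w (p x.1) ⟨nameAt w x.2, !s⟩ →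
      ¬ TrueAt w (p x.1) l'.compl → s = true → l'.positive = true → ⟨nameAt w x.2, s⟩ = l')
      (hc.comp Proj.id.fst) fun s' =>
      (Def.trueAt (hp.comp Proj.id.fst.fst) Proj.id.fst.snd (!s)).not.imp
        ((Def.trueAt (hp.comp Proj.id.fst.fst) Proj.id.snd (!s')).not.imp
          ((Def.const (s = true)).imp ((Def.const (s' = true)).imp
            (Def.literal_eq Proj.id.fst.snd Proj.id.snd s s')))))

theorem defClause_id : DefClause IDClause := fun {D} _ {p c} hp hc =>
  (defClause_exists_trueAt hp hc).or (Def.forall_mem_clauseAt (P := fun w x l =>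
    ∀ l' ∈ clauseAt w (c x), ¬ TrueAt w (p x) l.compl → ¬ TrueAt w (p x) l'.compl →
      l = l' ∧ l.positive = true) hc fun s =>
    Def.forall_mem_clauseAt (P := fun w (x : D × ℕ) l' => ¬ TrueAt w (p x.1) ⟨nameAt w x.2, !s⟩ →
      ¬ TrueAt w (p x.1) l'.compl → ⟨nameAt w x.2, s⟩ = l' ∧ s = true)
      (hc.comp Proj.id.fst) fun s' =>
      (Def.trueAt (hp.comp Proj.id.fst.fst) Proj.id.fst.snd (!s)).not.imp
        ((Def.trueAt (hp.comp Proj.id.fst.fst) Proj.id.snd (!s')).not.imp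
          ((Def.literal_eq Proj.id.fst.snd Proj.id.snd s s').and (Def.const (s = true)))))

theorem defClause_krom : DefClause KromClause := fun {D} _ {p c} hp hc =>
  (defClause_exists_trueAt hp hc).or (Def.forall_mem_clauseAt (P := fun w x l =>
    ∀ l' ∈ clauseAt w (c x), ∀ l'' ∈ clauseAt w (c x), ¬ TrueAt w (p x) l.compl →
      ¬ TrueAt w (p x) l'.compl → ¬ TrueAt w (p x) l''.compl → l = l' ∨ l = l'' ∨ l' = l'')
      hc fun s =>
    Def.forall_mem_clauseAt (P := fun w (x : D × ℕ) l' => ∀ l'' ∈ clauseAt w (c x.1),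
      ¬ TrueAt w (p x.1) ⟨nameAt w x.2, !s⟩ → ¬ TrueAt w (p x.1) l'.compl →
      ¬ TrueAt w (p x.1) l''.compl → ⟨nameAt w x.2, s⟩ = l' ∨ ⟨nameAt w x.2, s⟩ = l'' ∨ l' = l'')
      (hc.comp Proj.id.fst) fun s' =>
    Def.forall_mem_clauseAt (P := fun w (x : (D × ℕ) × ℕ) l'' =>
      ¬ TrueAt w (p x.1.1) ⟨nameAt w x.1.2, !s⟩ → ¬ TrueAt w (p x.1.1) ⟨nameAt w x.2, !s'⟩ →
      ¬ TrueAt w (p x.1.1) l''.compl → (⟨nameAt w x.1.2, s⟩ : Literal) = ⟨nameAt w x.2, s'⟩ ∨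
        ⟨nameAt w x.1.2, s⟩ = l'' ∨ ⟨nameAt w x.2, s'⟩ = l'')
      (hc.comp Proj.id.fst.fst) fun s'' =>
      (Def.trueAt (hp.comp Proj.id.fst.fst.fst) Proj.id.fst.fst.snd (!s)).not.imp
        ((Def.trueAt (hp.comp Proj.id.fst.fst.fst) Proj.id.fst.snd (!s')).not.imp
          ((Def.trueAt (hp.comp Proj.id.fst.fst.fst) Proj.id.snd (!s'')).not.imp
            ((Def.literal_eq Proj.id.fst.fst.snd Proj.id.fst.snd s s').or
              ((Def.literal_eq Proj.id.fst.fst.snd Proj.id.snd s s'').or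
                (Def.literal_eq Proj.id.fst.snd Proj.id.snd s' s''))))))

end Definability

/-! ### Words that encode instances -/

/-- The listing of the backdoor. -/
def encNames (B : List Var) : List Symbol := B.flatMap fun x => Symbol.name :: encVar x

/-- The local condition on a position of a code: which letter it holds, which one is next, and
which ones occur later. -/
def Rule (here next later : Symbol → Prop) : Prop :=
  (here .name → ¬ later .backdoor) ∧
  (here .backdoor → ¬ later .backdoor ∧ ¬ next .zero ∧ ¬ next .one) ∧
  (here .pos ∨ here .neg ∨ here .clause ∨ here .formula ∨ here .goal → later .backdoor) ∧
  (here .clause ∨ here .formula → ¬ next .zero ∧ ¬ next .one) ∧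
  (here .formula → ¬ next .pos ∧ ¬ next .neg) ∧
  (here .goal → next .formula ∧ ¬ later .goal) ∧
  (next .formula → ¬ later .goal → here .goal)

/-- Words all of whose positions satisfy the local condition. -/
def Good : List Symbol → Prop
  | [] => True
  | a :: t => Rule (fun s => s = a) (fun s => t.head? = some s) (fun s => s ∈ t) ∧ Good t

/-- The recursion is replaced by a condition on all positions, which is first-order and hence
definable. -/
theorem good_iff {x : List Symbol} : Good x ↔ ∀ i, Rule (fun s => x[i]? = some s)
    (fun s => x[i + 1]? = some s) (fun s => ∃ j, i < j ∧ x[j]? = some s) := by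
  induction x with
  | nil => simp [Good, Rule]
  | cons a t ih =>
    rw [Good, ih]
    have e0 : (fun s => s = a) = fun s => (a :: t)[0]? = some s := by
      funext s
      simp [eq_comm]
    have e1 : (fun s => t.head? = some s) = fun s => (a :: t)[0 + 1]? = some s := by
      funext s
      simp [List.head?_eq_getElem?]
    have e2 : (fun s => s ∈ t) = fun s => ∃ j, 0 < j ∧ (a :: t)[j]? = some s := by
      funext s
      rw [List.mem_iff_getElem?]
      refine propext ⟨fun ⟨i, h⟩ => ⟨i + 1, Nat.succ_pos i, by simpa using h⟩, ?_⟩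
      rintro ⟨_ | j, h, h'⟩
      · omega
      · exact ⟨j, by simpa using h'⟩
    have e3 : ∀ i, (fun s => ∃ j, i < j ∧ t[j]? = some s) =
        fun s => ∃ j, i + 1 < j ∧ (a :: t)[j]? = some s := by
      intro i
      funext s
      refine propext ⟨fun ⟨j, h, h'⟩ => ⟨j + 1, by omega, by simpa using h'⟩, ?_⟩
      rintro ⟨_ | j, h, h'⟩
      · omega
      · exact ⟨j, by omega, by simpa using h'⟩
    rw [e0, e1, e2]
    constructor
    · rintro ⟨h0, h⟩ i
      cases i with
      | zero => exact h0
      | succ i =>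
        have := h i
        rw [e3] at this
        simpa only [List.getElem?_cons_succ] using this
    · intro h
      refine ⟨h 0, fun i => ?_⟩
      rw [e3]
      simpa only [List.getElem?_cons_succ] using h (i + 1)

theorem eq_nil_of_head_encVar {b : Var} {t : List Symbol}
    (h : ¬ (encVar b ++ t).head? = some .zero ∧ ¬ (encVar b ++ t).head? = some .one) : b = [] := by
  match b with
  | [] => rfl
  | true :: _ => exact (h.2 rfl).elim
  | false :: _ => exact (h.1 rfl).elim

theorem eq_nil_of_head_literals {ls : List Literal} {t : List Symbol}
    (h : ¬ (ls.flatMap encLiteral ++ t).head? = some .pos ∧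
      ¬ (ls.flatMap encLiteral ++ t).head? = some .neg) : ls = [] := by
  match ls with
  | [] => rfl
  | ⟨_, true⟩ :: _ => exact (h.1 rfl).elim
  | ⟨_, false⟩ :: _ => exact (h.2 rfl).elim

/-- The shape of the end of a code. -/
theorem Good.parse {t : List Symbol} (h : Good t) :
    (.backdoor ∉ t → ∃ b B, t = encVar b ++ encNames B) ∧
    (.backdoor ∈ t → .goal ∉ t → (∃ b ls cs B, t = encVar b ++ (List.flatMap encLiteral ls ++
      (List.flatMap encClause cs ++ .backdoor :: encNames B))) ∨
      ∃ cs B, t = .formula :: (List.flatMap encClause cs ++ .backdoor :: encNames B)) ∧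
    (.goal ∈ t → ∃ b ls cs Φ ψ B, t = encVar b ++ (List.flatMap encLiteral ls ++
      (List.flatMap encClause cs ++ encInst Φ ψ B))) := by
  induction t with
  | nil => exact ⟨fun _ => ⟨[], [], rfl⟩, by simp, by simp⟩
  | cons a t ih =>
    obtain ⟨⟨r1, r2, r3, r4, r5, r6, r7⟩, ht⟩ := h
    obtain ⟨ih1, ih2, ih3⟩ := ih ht
    have hgoal : .goal ∉ t → ¬ t.head? = some .formula ∨ a = .goal := by
      intro hg
      by_cases hf : t.head? = some .formula
      · exact Or.inr (r7 hf hg).symm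
      · exact Or.inl hf
    -- Behind the last goal marker a formula marker can only follow that marker directly. Before any
    -- other letter, the alternative that starts with a formula marker is excluded.
    have ih2' : a ≠ .goal → .backdoor ∈ t → .goal ∉ t → ∃ b ls cs B, t = encVar b ++
        (List.flatMap encLiteral ls ++
        (List.flatMap encClause cs ++ .backdoor :: encNames B)) := by
      intro ha hb hg
      rcases ih2 hb hg with h | ⟨cs, B, rfl⟩
      · exact h
      · rcases hgoal hg with h | h
        · exact (h rfl).elim
        · exact (ha h).elim
    have bit : ∀ β : Bool, a = (if β then .one else .zero) →
        (.backdoor ∉ a :: t → ∃ b B, a :: t = encVar b ++ encNames B) ∧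
        (.backdoor ∈ a :: t → .goal ∉ a :: t → (∃ b ls cs B, a :: t = encVar b ++
          (List.flatMap encLiteral ls ++
          (List.flatMap encClause cs ++ .backdoor :: encNames B))) ∨
          ∃ cs B, a :: t = .formula :: (List.flatMap encClause cs ++ .backdoor :: encNames B)) ∧
        (.goal ∈ a :: t → ∃ b ls cs Φ ψ B, a :: t = encVar b ++ (List.flatMap encLiteral ls ++
          (List.flatMap encClause cs ++ encInst Φ ψ B))) := by
      intro β ha
      have hb : a ≠ .backdoor := by
        rw [ha]
        cases β <;> simp
      have hg : a ≠ .goal := by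
        rw [ha]
        cases β <;> simp
      simp only [List.mem_cons, hb.symm, hg.symm, false_or]
      refine ⟨fun h => ?_, fun h h' => Or.inl ?_, fun h => ?_⟩
      · obtain ⟨b, B, rfl⟩ := ih1 h
        exact ⟨β :: b, B, by rw [ha]; rfl⟩
      · obtain ⟨b, ls, cs, B, rfl⟩ := ih2' hg h h'
        exact ⟨β :: b, ls, cs, B, by rw [ha]; rfl⟩
      · obtain ⟨b, ls, cs, Φ, ψ, B, rfl⟩ := ih3 h
        exact ⟨β :: b, ls, cs, Φ, ψ, B, by rw [ha]; rfl⟩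
    have sign : ∀ β : Bool, a = (if β then .pos else .neg) →
        (.backdoor ∉ a :: t → ∃ b B, a :: t = encVar b ++ encNames B) ∧
        (.backdoor ∈ a :: t → .goal ∉ a :: t → (∃ b ls cs B, a :: t = encVar b ++
          (List.flatMap encLiteral ls ++
          (List.flatMap encClause cs ++ .backdoor :: encNames B))) ∨
          ∃ cs B, a :: t = .formula :: (List.flatMap encClause cs ++ .backdoor :: encNames B)) ∧
        (.goal ∈ a :: t → ∃ b ls cs Φ ψ B, a :: t = encVar b ++ (List.flatMap encLiteral ls ++
          (List.flatMap encClause cs ++ encInst Φ ψ B))) := by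
      intro β ha
      have hb : a ≠ .backdoor := by
        rw [ha]
        cases β <;> simp
      have hg : a ≠ .goal := by
        rw [ha]
        cases β <;> simp
      have hback : .backdoor ∈ t := r3 (by rw [ha]; cases β <;> simp)
      simp only [List.mem_cons, hb.symm, hg.symm, false_or]
      refine ⟨fun h => (h hback).elim, fun h h' => Or.inl ?_, fun h => ?_⟩
      · obtain ⟨b, ls, cs, B, rfl⟩ := ih2' hg h h'
        exact ⟨[], ⟨b, β⟩ :: ls, cs, B, by rw [ha]; simp [encLiteral, encVar]⟩
      · obtain ⟨b, ls, cs, Φ, ψ, B, rfl⟩ := ih3 h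
        exact ⟨[], ⟨b, β⟩ :: ls, cs, Φ, ψ, B, by rw [ha]; simp [encLiteral, encVar]⟩
    cases a with
    | zero => exact bit false rfl
    | one => exact bit true rfl
    | pos => exact sign true rfl
    | neg => exact sign false rfl
    | clause =>
      have hback : .backdoor ∈ t := r3 (by simp)
      have hbit := r4 (by simp)
      simp only [List.mem_cons, reduceCtorEq, false_or]
      refine ⟨fun h => (h hback).elim, fun h h' => Or.inl ?_, fun h => ?_⟩
      · obtain ⟨b, ls, cs, B, rfl⟩ := ih2' (by simp) h h'
        obtain rfl := eq_nil_of_head_encVar hbit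
        exact ⟨[], [], ls :: cs, B, by simp [encClause, encVar]⟩
      · obtain ⟨b, ls, cs, Φ, ψ, B, rfl⟩ := ih3 h
        obtain rfl := eq_nil_of_head_encVar hbit
        exact ⟨[], [], ls :: cs, Φ, ψ, B, by simp [encClause, encVar]⟩
    | formula =>
      have hback : .backdoor ∈ t := r3 (by simp)
      have hbit := r4 (by simp)
      have hsign := r5 rfl
      simp only [List.mem_cons, reduceCtorEq, false_or]
      refine ⟨fun h => (h hback).elim, fun h h' => Or.inr ?_, fun h => ?_⟩
      · obtain ⟨b, ls, cs, B, rfl⟩ := ih2' (by simp) h h'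
        obtain rfl := eq_nil_of_head_encVar hbit
        obtain rfl := eq_nil_of_head_literals hsign
        exact ⟨cs, B, by simp [encVar]⟩
      · obtain ⟨b, ls, cs, Φ, ψ, B, rfl⟩ := ih3 h
        obtain rfl := eq_nil_of_head_encVar hbit
        obtain rfl := eq_nil_of_head_literals hsign
        exact ⟨[], [], [], cs :: Φ, ψ, B, by simp [encVar, encInst, encCNF]⟩
    | goal =>
      have hback : .backdoor ∈ t := r3 (by simp)
      obtain ⟨hf, hg⟩ := r6 rfl
      refine ⟨fun h => (h (List.mem_cons_of_mem _ hback)).elim, fun h h' => (h' (by simp)).elim,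
        fun h => ?_⟩
      -- The letter after the goal marker is a formula marker. The first alternative contains none
      -- in front: after empty name and literals it starts with a clause or backdoor marker.
      rcases ih2 hback hg with ⟨b, ls, cs, B, rfl⟩ | ⟨cs, B, rfl⟩
      · obtain rfl := eq_nil_of_head_encVar (by rw [hf]; simp)
        obtain rfl := eq_nil_of_head_literals (show ¬ _ ∧ ¬ _ by
          rw [show ∀ s : List Symbol, encVar [] ++ s = s from fun _ => rfl] at hf
          rw [hf]; simp)
        cases cs <;> simp [encVar, encClause] at hf
      · exact ⟨[], [], [], [], cs, B, by simp [encVar, encInst, encCNF, encNames]⟩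
    | backdoor =>
      obtain ⟨hb, hbit⟩ := r2 rfl
      refine ⟨fun h => (h (by simp)).elim, fun _ _ => Or.inl ?_, fun h => ?_⟩
      · obtain ⟨b, B, rfl⟩ := ih1 hb
        obtain rfl := eq_nil_of_head_encVar hbit
        exact ⟨[], [], [], B, by simp [encVar]⟩
      · obtain ⟨b, B, rfl⟩ := ih1 hb
        have : ∀ y : Var, .goal ∉ encVar y := by
          intro y
          simp only [encVar, List.mem_map, not_exists, not_and]
          intro β _
          cases β <;> simp
        simp [encNames, this] at h
    | name =>
      have hb := r1 rfl
      simp only [List.mem_cons, reduceCtorEq, false_or]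
      have h1 := ih1 hb
      refine ⟨fun h => ?_, fun h => (hb h).elim, fun h => ?_⟩
      · obtain ⟨b, B, rfl⟩ := h1
        exact ⟨[], b :: B, by simp [encNames, encVar]⟩
      · obtain ⟨b, B, rfl⟩ := h1
        have : ∀ y : Var, .goal ∉ encVar y := by
          intro y
          simp only [encVar, List.mem_map, not_exists, not_and]
          intro β _
          cases β <;> simp
        simp [encNames, this] at h

theorem notMem_encVar {s : Symbol} (h0 : s ≠ .zero) (h1 : s ≠ .one) (x : Var) : s ∉ encVar x := by
  simp only [encVar, List.mem_map, not_exists, not_and]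
  intro β _
  cases β
  · simpa using h0.symm
  · simpa using h1.symm

/-- Ends of codes that may follow a clause. -/
structure ClauseEnd (t : List Symbol) : Prop where
  good : Good t
  backdoor_mem : .backdoor ∈ t
  goal_mem : t.head? = some .formula → .goal ∈ t
  head_zero : ¬ t.head? = some .zero
  head_one : ¬ t.head? = some .one

/-- The second component is carried along to make the last condition of `Rule` vacuous: a formula
marker at the front always has a goal marker behind it. -/
theorem good_encVar_append {t : List Symbol} (h : Good t)
    (h' : t.head? = some .formula → .goal ∈ t) (x : Var) : Good (encVar x ++ t) ∧
      ((encVar x ++ t).head? = some .formula → .goal ∈ encVar x ++ t) := by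
  induction x with
  | nil => exact ⟨h, h'⟩
  | cons b x ih =>
    cases b <;>
    · refine ⟨⟨⟨?_, ?_, ?_, ?_, ?_, ?_, fun h1 h2 => (h2 (ih.2 h1)).elim⟩, ih.1⟩, ?_⟩ <;>
      simp [encVar]

theorem ClauseEnd.literals {t : List Symbol} (h : ClauseEnd t) (ls : List Literal) :
    ClauseEnd (ls.flatMap encLiteral ++ t) := by
  induction ls with
  | nil => exact h
  | cons l ls ih =>
    obtain ⟨h1, h2⟩ := good_encVar_append ih.good ih.goal_mem l.var
    rw [List.flatMap_cons, List.append_assoc]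
    have hb := List.mem_append_right (encVar l.var) ih.backdoor_mem
    rcases l with ⟨x, s⟩
    cases s <;>
    · refine ⟨⟨⟨?_, ?_, fun _ => hb, ?_, ?_, ?_, fun h3 h4 => (h4 (h2 h3)).elim⟩, h1⟩,
        List.mem_cons_of_mem _ hb, ?_, ?_, ?_⟩ <;> simp [encLiteral]

theorem ClauseEnd.clauses {t : List Symbol} (h : ClauseEnd t) (cs : List (List Literal)) :
    ClauseEnd (cs.flatMap encClause ++ t) := by
  induction cs with
  | nil => exact h
  | cons c cs ih =>
    obtain ⟨h1, h2, h3, h4, h5⟩ := ih.literals c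
    rw [List.flatMap_cons, List.append_assoc]
    refine ⟨⟨⟨?_, ?_, fun _ => h2, fun _ => ⟨h4, h5⟩, ?_, ?_, fun h6 h7 => (h7 (h3 h6)).elim⟩, h1⟩,
      List.mem_cons_of_mem _ h2, ?_, ?_, ?_⟩ <;> simp [encClause]

theorem good_formula {t : List Symbol} (h : ClauseEnd t) (hp : ¬ t.head? = some .pos)
    (hn : ¬ t.head? = some .neg) (cs : List (List Literal)) :
    Good (.formula :: (cs.flatMap encClause ++ t)) := by
  obtain ⟨h1, h2, h3, h4, h5⟩ := h.clauses cs
  refine ⟨⟨?_, ?_, fun _ => h2, fun _ => ⟨h4, h5⟩, fun _ => ?_, ?_,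
    fun h6 h7 => (h7 (h3 h6)).elim⟩, h1⟩
  any_goals simp; done
  cases cs with
  | nil => exact ⟨hp, hn⟩
  | cons c cs => exact ⟨fun h => Symbol.noConfusion (Option.some.inj h),
      fun h => Symbol.noConfusion (Option.some.inj h)⟩

theorem clauseEnd_backdoor (B : List Var) : ClauseEnd (.backdoor :: encNames B) := by
  have key : Good (encNames B) ∧ .backdoor ∉ encNames B ∧ ¬ (encNames B).head? = some .formula ∧
      ¬ (encNames B).head? = some .zero ∧ ¬ (encNames B).head? = some .one := by
    induction B with
    | nil => simp [encNames, Good]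
    | cons x B ih =>
      obtain ⟨h1, h2, h3, h4⟩ := ih
      obtain ⟨g1, -⟩ := good_encVar_append h1 (fun h => (h3 h).elim) x
      have g3 : .backdoor ∉ encVar x ++ encNames B := by
        simp [h2, notMem_encVar]
      have g4 : ¬ (encVar x ++ encNames B).head? = some .formula := by
        cases x with
        | nil => exact h3
        | cons b x => cases b <;> simp [encVar]
      rw [show encNames (x :: B) = .name :: (encVar x ++ encNames B) by simp [encNames]]
      refine ⟨⟨⟨fun _ => g3, ?_, ?_, ?_, ?_, ?_, fun h => (g4 h).elim⟩, g1⟩, by simpa using g3,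
        ?_, ?_, ?_⟩ <;> simp
  obtain ⟨h1, h2, h3, h4, h5⟩ := key
  refine ⟨⟨⟨?_, fun _ => ⟨h2, h4, h5⟩, ?_, ?_, ?_, ?_, fun h => (h3 h).elim⟩, h1⟩,
    ?_, ?_, ?_, ?_⟩ <;>
    simp

theorem good_encInst (Φ : List (List (List Literal))) (ψ : List (List Literal)) (B : List Var) :
    Good (encInst Φ ψ B) := by
  have hno : .goal ∉ encCNF ψ ++ .backdoor :: encNames B := by
    simp only [encCNF, encNames]
    simp [notMem_encVar, encClause, encLiteral]
    intro c _ l _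
    split <;> simp
  suffices ClauseEnd (encInst Φ ψ B) ∧ .goal ∈ encInst Φ ψ B ∧
      ¬ (encInst Φ ψ B).head? = some .pos ∧ ¬ (encInst Φ ψ B).head? = some .neg from this.1.good
  induction Φ with
  | nil =>
    have hg := good_formula (clauseEnd_backdoor B) (by simp) (by simp) ψ
    have hb : Symbol.backdoor ∈ encCNF ψ ++ .backdoor :: encNames B := by simp
    rw [show encInst [] ψ B = .goal :: (encCNF ψ ++ .backdoor :: encNames B) by
      simp [encInst, encNames]]
    refine ⟨⟨⟨⟨?_, ?_, fun _ => hb, ?_, ?_, fun _ => ⟨rfl, hno⟩, fun _ _ => rfl⟩, hg⟩,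
      List.mem_cons_of_mem _ hb, ?_, ?_, ?_⟩, ?_, ?_, ?_⟩ <;> simp
  | cons φ Φ ih =>
    obtain ⟨h1, h2, h3, h4⟩ := ih
    have e : encInst (φ :: Φ) ψ B = .formula :: (φ.flatMap encClause ++ encInst Φ ψ B) := by
      simp [encInst, encCNF]
    rw [e]
    exact ⟨⟨good_formula h1 h3 h4 φ, by simp [h1.backdoor_mem], fun _ => by simp [h2], by simp,
      by simp⟩, by simp [h2], by simp, by simp⟩

/-- `Good.parse` describes suffixes, which may start within a name, a literal list or a clause list.
A first letter that marks a formula or the goal rules out such leftovers. -/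
theorem exists_eq_encInst_iff {x : List Symbol} : (∃ Φ ψ B, x = encInst Φ ψ B) ↔
    Good x ∧ .goal ∈ x ∧ (x.head? = some .formula ∨ x.head? = some .goal) := by
  constructor
  · rintro ⟨Φ, ψ, B, rfl⟩
    refine ⟨good_encInst Φ ψ B, by simp [encInst], ?_⟩
    cases Φ <;> simp [encInst, encCNF]
  · rintro ⟨h, hg, hh⟩
    obtain ⟨b, ls, cs, Φ, ψ, B, rfl⟩ := h.parse.2.2 hg
    obtain rfl := eq_nil_of_head_encVar (by rcases hh with h | h <;> rw [h] <;> simp)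
    rw [show ∀ s : List Symbol, encVar [] ++ s = s from fun _ => rfl] at hh ⊢
    obtain rfl := eq_nil_of_head_literals (by rcases hh with h | h <;> rw [h] <;> simp)
    rw [show ∀ s : List Symbol, List.flatMap encLiteral [] ++ s = s from fun _ => rfl] at hh ⊢
    cases cs with
    | nil => exact ⟨Φ, ψ, B, rfl⟩
    | cons c cs => simp [encClause] at hh

/-- The first component of the pair is the code of an instance. -/
def Valid (w : List Letter) : Prop :=
  (∀ i, Rule (fun s => w[i]? = some (.inl s)) (fun s => w[i + 1]? = some (.inl s))
    fun s => ∃ j : ℕ, i < j ∧ w[j]? = some (.inl s)) ∧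
  (∃ i : ℕ, w[i]? = some (.inl .goal)) ∧ (w[0]? = some (.inl .formula) ∨ w[0]? = some (.inl .goal))

theorem encPair_getElem?_eq_inl_iff {x : List Symbol} {y : List (Fin 3)} {i : ℕ} {s : Symbol} :
    (encPair (x, y))[i]? = some (.inl s) ↔ x[i]? = some s := by
  rw [encPair, List.getElem?_append]
  split_ifs with h
  · simp
  · simp only [List.getElem?_map, List.length_map]
    simp only [List.length_map] at h
    rw [List.getElem?_eq_none (l := x) (by omega)]
    simp

theorem valid_encPair_iff {x : List Symbol} {y : List (Fin 3)} :
    Valid (encPair (x, y)) ↔ ∃ Φ ψ B, x = encInst Φ ψ B := by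
  rw [exists_eq_encInst_iff, good_iff, Valid]
  simp only [encPair_getElem?_eq_inl_iff, List.head?_eq_getElem?, List.mem_iff_getElem?]

section Definability

variable {C : Type} [Ctx C]

theorem Def.rule {here next later : List Letter → C → Symbol → Prop}
    (h1 : ∀ s, Def C fun w c => here w c s) (h2 : ∀ s, Def C fun w c => next w c s)
    (h3 : ∀ s, Def C fun w c => later w c s) :
    Def C fun w c => Rule (here w c) (next w c) (later w c) :=
  ((h1 _).imp (h3 _).not).and <|
  ((h1 _).imp ((h3 _).not.and ((h2 _).not.and (h2 _).not))).and <|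
  (((h1 _).or ((h1 _).or ((h1 _).or ((h1 _).or (h1 _))))).imp (h3 _)).and <|
  (((h1 _).or (h1 _)).imp ((h2 _).not.and (h2 _).not)).and <|
  ((h1 _).imp ((h2 _).not.and (h2 _).not)).and <|
  ((h1 _).imp ((h2 _).and (h3 _).not)).and <|
  (h2 _).imp ((h3 _).not.imp (h1 _))

theorem Def.valid : Def C fun w _ => Valid w := by
  refine (((Def.all (R := fun (w : List Letter) _ i => Rule (fun s => w[i]? = some (.inl s))
    (fun s => i < w.length ∧ w[i + 1]? = some (.inl s))
    fun s => ∃ j ≤ w.length, i < j ∧ w[j]? = some (.inl s : Letter)) (Def.rule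
      (fun s => Def.letter_eq Proj.id.snd _) (fun s => Def.at_succ
        (R := fun (w : List Letter) (_ : C × ℕ) j => w[j]? = some (.inl s)) Proj.id.snd
        (Def.letter_eq Proj.id.snd _))
      fun s => Def.ex (R := fun (w : List Letter) (x : C × ℕ) j => x.2 < j ∧ w[j]? = some (.inl s))
        ((Def.lt Proj.id.fst.snd Proj.id.snd).and (Def.letter_eq Proj.id.snd _))))).and
    ((Def.ex (R := fun (w : List Letter) _ i => w[i]? = some (.inl .goal))
      (Def.letter_eq Proj.id.snd _)).and
      (Def.ex (R := fun (w : List Letter) _ i => i = 0 ∧ (w[i]? = some (.inl .formula) ∨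
        w[i]? = some (.inl .goal))) ((Def.eq_zero Proj.id.snd).and
        ((Def.letter_eq Proj.id.snd _).or (Def.letter_eq Proj.id.snd _)))))).congr ?_
  intro w _
  have le : ∀ {i : ℕ} {a : Letter}, w[i]? = some a → i < w.length := fun h =>
    (List.getElem?_eq_some_iff.1 h).1
  refine and_congr ?_ (and_congr ?_ ?_)
  · have e1 : ∀ i, (fun s => i < w.length ∧ w[i + 1]? = some (Sum.inl s)) =
        fun s => w[i + 1]? = some (.inl s) := by
      intro i
      funext s
      refine propext (and_iff_right_of_imp fun h => ?_)
      have := le h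
      omega
    have e2 : ∀ i, (fun s => ∃ j ≤ w.length, i < j ∧ w[j]? = some (Sum.inl s)) =
        fun s => ∃ j : ℕ, i < j ∧ w[j]? = some (.inl s) := by
      intro i
      funext s
      exact propext ⟨fun ⟨j, _, h⟩ => ⟨j, h⟩, fun ⟨j, h, h'⟩ => ⟨j, (le h').le, h, h'⟩⟩
    simp only [e1, e2]
    refine ⟨fun h i _ => h i, fun h i => ?_⟩
    by_cases hi : i ≤ w.length
    · exact h i hi
    -- Outside the word there are no letters, and the local condition is vacuous.
    · have h1 : ∀ j, i ≤ j → w[j]? = none := fun j hj => List.getElem?_eq_none (by omega)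
      simp only [h1 i le_rfl, h1 (i + 1) (Nat.le_succ i)]
      simp [Rule]
  · exact ⟨fun ⟨i, h⟩ => ⟨i, (le h).le, h⟩, fun ⟨i, _, h⟩ => ⟨i, h⟩⟩
  · exact ⟨fun h => ⟨0, Nat.zero_le _, rfl, h⟩, fun ⟨_, _, h0, h⟩ => h0 ▸ h⟩

end Definability

/-! ### The listings in the code of an instance -/

/-- The clauses listed in a word. -/
def clausesOf (t : List Letter) : List Clause :=
  listed (.inl .clause) (fun s => (litsOf s).toFinset) t

theorem clausesOf_clause (t : List Letter) :
    clausesOf (.inl .clause :: t) = (litsOf t).toFinset :: clausesOf t := rfl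

theorem mem_clausesOf_iff {w : List Letter} {C : Clause} :
    C ∈ clausesOf w ↔ ∃ c : ℕ, w[c]? = some (.inl .clause) ∧ clauseAt w c = C :=
  mem_listed_iff

theorem nameOf_append {u t : List Letter} (hb : ¬ IsBit t.head?) :
    nameOf (u ++ t) = nameOf u := by
  induction u with
  | nil => exact nameOf_eq_nil hb
  | cons a u ih =>
    rw [List.cons_append]
    by_cases h : IsBit (some a)
    · obtain ⟨b, h⟩ := h
      obtain rfl := Option.some.inj h
      rw [nameOf_cons_bitLetter, nameOf_cons_bitLetter, ih]
    · rw [nameOf_eq_nil (by simpa using h), nameOf_eq_nil (by simpa using h)]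

theorem litsOf_append {u t : List Letter} (hb : ¬ IsBit t.head?) (hs : ¬ IsSign t.head?) :
    litsOf (u ++ t) = litsOf u := by
  induction u with
  | nil => exact litsOf_eq_nil hb hs
  | cons a u ih =>
    rw [List.cons_append]
    by_cases h : IsBit (some a)
    · obtain ⟨b, h⟩ := h
      obtain rfl := Option.some.inj h
      rw [litsOf_cons_bitLetter, litsOf_cons_bitLetter, ih]
    by_cases h' : IsSign (some a)
    · obtain ⟨b, h'⟩ := h'
      obtain rfl := Option.some.inj h'
      rw [litsOf_cons_signLetter, litsOf_cons_signLetter, ih, nameOf_append hb]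
    · rw [litsOf_eq_nil (by simpa using h) (by simpa using h'),
        litsOf_eq_nil (by simpa using h) (by simpa using h')]

theorem isBit_inl_iff {s : Symbol} : IsBit (some (.inl s)) ↔ s = .zero ∨ s = .one := by
  unfold IsBit
  constructor
  · rintro ⟨_ | _, h⟩ <;> simp_all [bitLetter]
  · rintro (rfl | rfl)
    · exact ⟨false, rfl⟩
    · exact ⟨true, rfl⟩

theorem isSign_inl_iff {s : Symbol} : IsSign (some (.inl s)) ↔ s = .pos ∨ s = .neg := by
  unfold IsSign
  constructor
  · rintro ⟨_ | _, h⟩ <;> simp_all [signLetter]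
  · rintro (rfl | rfl)
    · exact ⟨true, rfl⟩
    · exact ⟨false, rfl⟩

theorem map_encVar (x : Var) : (encVar x).map (Sum.inl : Symbol → Letter) = x.map bitLetter := by
  simp [encVar, bitLetter, Function.comp_def]

theorem map_encLiteral (l : Literal) : (encLiteral l).map (Sum.inl : Symbol → Letter) =
    signLetter l.positive :: l.var.map bitLetter := by
  simp [encLiteral, signLetter, map_encVar]

theorem nameOf_map_bitLetter {x : Var} {t : List Letter} (h : ¬ IsBit t.head?) :
    nameOf (x.map bitLetter ++ t) = x := by
  induction x with
  | nil => exact nameOf_eq_nil h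
  | cons b x ih => rw [List.map_cons, List.cons_append, nameOf_cons_bitLetter, ih]

theorem litsOf_map_bitLetter {x : Var} {t : List Letter} :
    litsOf (x.map bitLetter ++ t) = litsOf t := by
  induction x with
  | nil => rfl
  | cons b x ih => rw [List.map_cons, List.cons_append, litsOf_cons_bitLetter, ih]

theorem litsOf_literals {t : List Letter} (h : ¬ IsBit t.head?) (ls : List Literal) :
    litsOf ((ls.flatMap encLiteral).map Sum.inl ++ t) = ls ++ litsOf t ∧
      ¬ IsBit ((ls.flatMap encLiteral).map Sum.inl ++ t).head? := by
  induction ls with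
  | nil => exact ⟨rfl, h⟩
  | cons l ls ih =>
    rw [List.flatMap_cons, List.map_append, map_encLiteral, List.append_assoc, List.cons_append,
      litsOf_cons_signLetter, nameOf_map_bitLetter ih.2, litsOf_map_bitLetter, ih.1]
    refine ⟨rfl, ?_⟩
    rintro ⟨b, hb⟩
    exact bitLetter_ne_signLetter b l.positive (Option.some.inj hb).symm

theorem notMem_map_literals {s : Symbol} (h0 : s ≠ .zero) (h1 : s ≠ .one) (h2 : s ≠ .pos)
    (h3 : s ≠ .neg) (ls : List Literal) :
    (Sum.inl s : Letter) ∉ (ls.flatMap encLiteral).map Sum.inl := by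
  rw [List.mem_map_of_injective Sum.inl_injective]
  simp only [List.mem_flatMap, encLiteral, List.mem_cons, not_exists, not_and, not_or]
  intro l _
  refine ⟨?_, notMem_encVar h0 h1 _⟩
  split <;> assumption

theorem clausesOf_clauses {t : List Letter} (hb : ¬ IsBit t.head?) (hs : ¬ IsSign t.head?)
    (cs : List (List Literal)) :
    clausesOf ((cs.flatMap encClause).map Sum.inl ++ t) = cs.map List.toFinset ++ clausesOf t ∧
      ¬ IsBit ((cs.flatMap encClause).map Sum.inl ++ t).head? ∧
      ¬ IsSign ((cs.flatMap encClause).map Sum.inl ++ t).head? := by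
  induction cs with
  | nil => exact ⟨rfl, hb, hs⟩
  | cons c cs ih =>
    obtain ⟨ih1, ih2, ih3⟩ := ih
    have e : ((c :: cs).flatMap encClause).map Sum.inl ++ t = .inl .clause ::
        ((c.flatMap encLiteral).map Sum.inl ++ ((cs.flatMap encClause).map Sum.inl ++ t)) := by
      simp [encClause]
    rw [e, clausesOf_clause, (litsOf_literals ih2 c).1, litsOf_eq_nil ih2 ih3]
    refine ⟨?_, ?_, ?_⟩
    · rw [clausesOf, listed_append_of_notMem (notMem_map_literals (by simp) (by simp) (by simp)
        (by simp) c), ← clausesOf, ih1]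
      simp
    · exact fun h => by simpa using isBit_inl_iff.1 h
    · exact fun h => by simpa using isSign_inl_iff.1 h

theorem clausesOf_formulas {t : List Letter} (hb : ¬ IsBit t.head?) (hs : ¬ IsSign t.head?)
    (Φ : List (List (List Literal))) :
    clausesOf ((Φ.flatMap encCNF).map Sum.inl ++ t) = Φ.flatten.map List.toFinset ++ clausesOf t ∧
      ¬ IsBit ((Φ.flatMap encCNF).map Sum.inl ++ t).head? ∧
      ¬ IsSign ((Φ.flatMap encCNF).map Sum.inl ++ t).head? := by
  induction Φ with
  | nil => exact ⟨rfl, hb, hs⟩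
  | cons φ Φ ih =>
    obtain ⟨ih1, ih2, ih3⟩ := ih
    have e : ((φ :: Φ).flatMap encCNF).map Sum.inl ++ t = .inl .formula ::
        ((φ.flatMap encClause).map Sum.inl ++ ((Φ.flatMap encCNF).map Sum.inl ++ t)) := by
      simp [encCNF]
    rw [e]
    refine ⟨?_, ?_, ?_⟩
    · refine (clausesOf_clauses ih2 ih3 φ).1.trans ?_
      simp [ih1]
    · exact fun h => by simpa using isBit_inl_iff.1 h
    · exact fun h => by simpa using isSign_inl_iff.1 h

theorem namesOf_names {t : List Letter} (h : ¬ IsBit t.head?) (B : List Var) :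
    namesOf ((encNames B).map Sum.inl ++ t) = B ++ namesOf t ∧
      ¬ IsBit ((encNames B).map Sum.inl ++ t).head? := by
  induction B with
  | nil => exact ⟨rfl, h⟩
  | cons x B ih =>
    have e : (encNames (x :: B)).map Sum.inl ++ t = .inl .name ::
        (x.map bitLetter ++ ((encNames B).map Sum.inl ++ t)) := by
      simp [encNames, map_encVar]
    rw [e, namesOf_cons, if_pos rfl, nameOf_map_bitLetter ih.2]
    refine ⟨?_, fun h => by simpa using isBit_inl_iff.1 h⟩
    rw [namesOf, ← map_encVar, listed_append_of_notMem, ← namesOf, ih.1]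
    · rfl
    · rw [List.mem_map_of_injective Sum.inl_injective]
      exact notMem_encVar (by simp) (by simp) x

/-! ### Premises before the goal marker, conclusion after it -/

section Split

variable {u v : List Letter}

theorem clauseAt_append_left (hv : v.head? = some (.inl .goal)) {c : ℕ} (hc : c < u.length) :
    clauseAt (u ++ v) c = clauseAt u c := by
  rw [clauseAt, List.drop_append_of_le_length hc, litsOf_append, clauseAt]
  · rw [hv]
    exact fun h => by simpa using isBit_inl_iff.1 h
  · rw [hv]
    exact fun h => by simpa using isSign_inl_iff.1 h

theorem clauseAt_append_right (i : ℕ) : clauseAt (u ++ v) (u.length + i) = clauseAt v i := by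
  rw [clauseAt, add_assoc, List.drop_append, clauseAt, List.drop_of_length_le (by omega),
    Nat.add_sub_cancel_left, List.nil_append]

theorem getElem?_append_length (hv : v.head? = some (.inl .goal)) :
    (u ++ v)[u.length]? = some (.inl .goal) := by
  rw [List.getElem?_append_right le_rfl, Nat.sub_self, ← List.head?_eq_getElem?, hv]

theorem mem_premises_append_iff (hu : .inl .goal ∉ u) (hv : v.head? = some (.inl .goal))
    {C : Clause} : C ∈ premises (u ++ v) ↔ C ∈ clausesOf u := by
  rw [mem_clausesOf_iff]
  constructor
  · rintro ⟨c, ⟨hc, hg⟩, rfl⟩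
    have hlt : c < u.length := by
      by_contra! hle
      rcases hle.eq_or_lt with rfl | hlt
      · rw [getElem?_append_length hv] at hc
        simp at hc
      · exact hg _ hlt (getElem?_append_length hv)
    rw [List.getElem?_append_left hlt] at hc
    exact ⟨c, hc, (clauseAt_append_left hv hlt).symm⟩
  · rintro ⟨c, hc, rfl⟩
    have hlt := (List.getElem?_eq_some_iff.1 hc).1
    refine ⟨c, ⟨by rwa [List.getElem?_append_left hlt], fun j hj h => ?_⟩,
      clauseAt_append_left hv hlt⟩
    rw [List.getElem?_append_left (by omega)] at h
    exact hu (List.mem_of_getElem? h)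

theorem exists_isConclusion_append_iff (hu : .inl .goal ∉ u) (hv : v.head? = some (.inl .goal))
    {C : Clause} : (∃ d, IsConclusion (u ++ v) d ∧ clauseAt (u ++ v) d = C) ↔
      C ∈ clausesOf v := by
  rw [mem_clausesOf_iff]
  constructor
  · rintro ⟨d, ⟨hd, hg⟩, rfl⟩
    have hle : u.length ≤ d := by
      by_contra! hlt
      refine hg fun j hj h => ?_
      rw [List.getElem?_append_left (by omega)] at h
      exact hu (List.mem_of_getElem? h)
    obtain ⟨i, rfl⟩ := Nat.exists_eq_add_of_le hle
    rw [List.getElem?_append_right hle, Nat.add_sub_cancel_left] at hd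
    exact ⟨i, hd, (clauseAt_append_right i).symm⟩
  · rintro ⟨i, hi, rfl⟩
    refine ⟨u.length + i, ⟨?_, fun h => ?_⟩, clauseAt_append_right i⟩
    · rwa [List.getElem?_append_right (Nat.le_add_right _ _), Nat.add_sub_cancel_left]
    · cases i with
      | zero =>
        rw [← List.head?_eq_getElem?, hv] at hi
        simp at hi
      | succ i => exact h u.length (by omega) (getElem?_append_length hv)

end Split

/-! ### The advice -/

/-- All words of length `k` over the bits. -/
def allBits : ℕ → List (List Bool)
  | 0 => [[]]
  | k + 1 => (allBits k).flatMap fun β => [false :: β, true :: β]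

theorem mem_allBits {k : ℕ} {β : List Bool} : β ∈ allBits k ↔ β.length = k := by
  induction k generalizing β with
  | zero => simp [allBits]
  | succ k ih =>
    simp only [allBits, List.mem_flatMap, ih]
    cases β with
    | nil => simp
    | cons b β => cases b <;> simp

/-- The list of all assignments to `k` variables. -/
def advice (k : ℕ) : List (Fin 3) :=
  (allBits k).flatMap fun β => 2 :: β.map fun b => bif b then 1 else 0

/-- The letter 2 is not a bit, so the next marker ends each block and the list can be recovered. -/
theorem listed_advice (L : List (List Bool)) : listed (.inr 2) adviceOf
    ((L.flatMap fun β => (2 : Fin 3) :: β.map fun b => bif b then 1 else 0).map .inr) = L := by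
  induction L with
  | nil => rfl
  | cons β L ih =>
    have e : ((β :: L).flatMap fun β => (2 : Fin 3) :: β.map fun b => bif b then 1 else 0).map
        .inr =
        .inr 2 :: (β.map adviceLetter ++
          (L.flatMap fun β => (2 : Fin 3) :: β.map fun b => bif b then 1 else 0).map .inr) := by
      simp only [List.flatMap_cons, List.map_append, List.map_cons, List.map_map, List.cons_append]
      congr 3
      funext b
      cases b <;> rfl
    have hn : ¬ IsAdvice ((L.flatMap fun β => (2 : Fin 3) :: β.map fun b =>
        bif b then 1 else 0).map (Sum.inr : Fin 3 → Letter)).head? := by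
      cases L with
      | nil => rintro ⟨b, h⟩; cases h
      | cons β L =>
        rintro ⟨b, h⟩
        have := Option.some.inj h
        cases b <;> simp [adviceLetter] at this
    have ha : ∀ {t : List Letter}, ¬ IsAdvice t.head? →
        adviceOf (β.map adviceLetter ++ t) = β := by
      intro t ht
      clear e
      induction β with
      | nil => exact adviceOf_eq_nil ht
      | cons b β ih => rw [List.map_cons, List.cons_append, adviceOf_cons_adviceLetter, ih]
    rw [e, listed, if_pos rfl, ha hn, listed_append_of_notMem, ih]
    simp only [List.mem_map, not_exists, not_and]
    intro b _
    cases b <;> simp [adviceLetter]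

theorem primrec_allBits : Primrec allBits := by
  have step : Primrec₂ fun (_ : ℕ) (L : List (List Bool)) =>
      L.flatMap fun β => [false :: β, true :: β] := by
    refine Primrec.list_flatMap Primrec.snd ?_
    exact Primrec.list_cons.comp (Primrec.list_cons.comp (Primrec.const false) Primrec.snd)
      (Primrec.list_cons.comp (Primrec.list_cons.comp (Primrec.const true) Primrec.snd)
        (Primrec.const []))
  refine (Primrec.nat_rec₁ [[]] step).of_eq fun k => ?_
  induction k with
  | zero => rfl
  | succ k ih => simp only [allBits, ← ih]

theorem computable_advice : Computable advice := by
  refine (Primrec.list_flatMap primrec_allBits ?_).to_comp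
  refine Primrec.list_cons.comp (Primrec.const 2) (Primrec.list_map Primrec.snd ?_)
  exact (Primrec.cond Primrec.id (Primrec.const 1) (Primrec.const 0)).comp Primrec.snd

/-! ### Correctness -/

theorem mem_zip_map_iff {α β : Type} {D : List α} {f : α → β} {x : α} {b : β} :
    (x, b) ∈ D.zip (D.map f) ↔ x ∈ D ∧ f x = b := by
  induction D with
  | nil => simp
  | cons a D ih =>
    simp only [List.map_cons, List.zip_cons_cons, List.mem_cons, Prod.mk.injEq, ih]
    constructor
    · rintro (⟨rfl, rfl⟩ | ⟨h, h'⟩)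
      · exact ⟨Or.inl rfl, rfl⟩
      · exact ⟨Or.inr h, h'⟩
    · rintro ⟨rfl | h, h'⟩
      · exact Or.inl ⟨rfl, h'.symm⟩
      · exact Or.inr ⟨h, h'⟩

/-- Without repetitions in `D`, values can be prescribed independently; a block of bits thus becomes
an assignment. -/
theorem exists_map_eq {α β : Type} [DecidableEq α] [Inhabited β] {D : List α} (hD : D.Nodup) :
    ∀ {L : List β}, D.length = L.length → ∃ f : α → β, D.map f = L := by
  induction D with
  | nil =>
    intro L h
    exact ⟨fun _ => default, (List.length_eq_zero_iff.1 h.symm).symm⟩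
  | cons a D ih =>
    intro L h
    cases L with
    | nil => simp at h
    | cons b L =>
      rw [List.nodup_cons] at hD
      obtain ⟨f, hf⟩ := ih hD.2 (by simpa using h)
      refine ⟨Function.update f a b, ?_⟩
      rw [List.map_cons, Function.update_self, ← hf]
      refine congrArg _ (List.map_congr_left fun x hx => Function.update_of_ne ?_ _ _)
      rintro rfl
      exact hD.1 hx

theorem Assignment.sets_iff {X : Finset Var} {θ : Assignment X} {l : Literal} :
    θ.Sets l ↔ ∃ h : l.var ∈ X, θ ⟨l.var, h⟩ = l.positive := by
  unfold Assignment.Sets Assignment.literalValue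
  split_ifs with h1 h2 <;> simp_all

/-- The assignments to a finite set, as lists of values. -/
theorem exists_assignment_iff {B : List Var} {τ : Literal → Prop} :
    (∃ β : List Bool, B.dedup.length = β.length ∧
      τ = fun l => (l.var, l.positive) ∈ B.dedup.zip β) ↔
      ∃ θ : Assignment B.toFinset, τ = θ.Sets := by
  have key : ∀ (f : Var → Bool) (θ : Assignment B.toFinset), (∀ x, θ x = f x) →
      (fun l : Literal => (l.var, l.positive) ∈ B.dedup.zip (B.dedup.map f)) = θ.Sets := by
    intro f θ h
    funext l
    rw [mem_zip_map_iff, Assignment.sets_iff, List.mem_dedup]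
    simp only [h, exists_prop, List.mem_toFinset]
  constructor
  · rintro ⟨β, hβ, rfl⟩
    obtain ⟨f, rfl⟩ := exists_map_eq (List.nodup_dedup B) hβ
    exact ⟨fun x => f x, key f _ fun _ => rfl⟩
  · rintro ⟨θ, rfl⟩
    set f : Var → Bool := fun x => if h : x ∈ B.toFinset then θ ⟨x, h⟩ else false with hf
    refine ⟨B.dedup.map f, by simp, (key f θ fun x => ?_).symm⟩
    rw [hf]
    simp only [x.2, dite_true]

/-- The acceptance condition in terms of the instance. -/
theorem accepts_iff (K : (Literal → Prop) → Clause → Prop) (Φ : List (List (List Literal)))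
    (ψ : List (List Literal)) (B : List Var) (k : ℕ) :
    ∃ V : Set Var, V.Nonempty ∧ (∀ C ∈ Φ.flatten.map List.toFinset, ∀ l ∈ C, l.var ∈ V) ∧
      (Accepts K (encPair (encInst Φ ψ B, advice k)) ↔ B.toFinset.card = k ∧
        ∀ θ : Assignment B.toFinset,
          (∀ C ∈ Φ.flatten.map List.toFinset ++ ψ.map List.toFinset, K θ.Sets C) ∧
          ∀ D ∈ ψ.map List.toFinset, ∃ x ∈ V, ∀ s, Conflict
            {C | C ∈ Φ.flatten.map List.toFinset} (refutationBase θ.Sets D ⟨x, s⟩)) := by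
  set y := (advice k).map (Sum.inr : Fin 3 → Letter) with hy
  set u := (Φ.flatMap encCNF).map (Sum.inl : Symbol → Letter) with hu
  set z := Sum.inl Symbol.backdoor :: ((encNames B).map (Sum.inl : Symbol → Letter) ++ y) with hz
  set v := Sum.inl Symbol.goal :: (Sum.inl Symbol.formula ::
    ((ψ.flatMap encClause).map (Sum.inl : Symbol → Letter) ++ z)) with hv
  have hw : encPair (encInst Φ ψ B, advice k) = u ++ v := by
    simp [encPair, encInst, encCNF, encNames, hu, hv, hz, hy]
  have hy_mem : ∀ s : Symbol, Sum.inl s ∉ y := by simp [hy]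
  have hy_bit : ¬ IsBit y.head? := by
    rintro ⟨b, h⟩
    exact hy_mem _ (List.mem_of_head? h)
  have hz_mem : Sum.inl Symbol.clause ∉ z := by
    simp [hz, hy_mem, encNames, notMem_encVar]
  have hz_clauses : clausesOf z = [] := by
    have := listed_append_of_notMem (f := fun s => (litsOf s).toFinset) (t := []) hz_mem
    rwa [List.append_nil] at this
  have ends : ∀ {s : Symbol} {t : List Letter}, s ≠ .zero → s ≠ .one → s ≠ .pos → s ≠ .neg →
      ¬ IsBit (Sum.inl s :: t).head? ∧ ¬ IsSign (Sum.inl s :: t).head? := by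
    intro s t h0 h1 h2 h3
    exact ⟨fun h => (isBit_inl_iff.1 h).elim h0 h1, fun h => (isSign_inl_iff.1 h).elim h2 h3⟩
  have hz_end : ¬ IsBit z.head? ∧ ¬ IsSign z.head? := ends (by simp) (by simp) (by simp) (by simp)
  have hv_end : ¬ IsBit v.head? ∧ ¬ IsSign v.head? := ends (by simp) (by simp) (by simp) (by simp)
  have hv_clauses : clausesOf v = ψ.map List.toFinset := by
    refine (clausesOf_clauses hz_end.1 hz_end.2 ψ).1.trans ?_
    rw [hz_clauses, List.append_nil]
  have hu_clauses : clausesOf u = Φ.flatten.map List.toFinset := by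
    have := (clausesOf_formulas (t := []) (by rintro ⟨_, h⟩; cases h) (by rintro ⟨_, h⟩; cases h)
      Φ).1
    simpa [hu, show clausesOf [] = [] from rfl] using this
  have hw_clauses : clausesOf (u ++ v) = Φ.flatten.map List.toFinset ++ ψ.map List.toFinset :=
    (clausesOf_formulas hv_end.1 hv_end.2 Φ).1.trans (by rw [hv_clauses])
  have hu_mem : ∀ s : Symbol, s = .goal ∨ s = .name → Sum.inl s ∉ u := by
    intro s hs
    rw [hu, List.mem_map_of_injective Sum.inl_injective]
    rcases hs with rfl | rfl <;>
    · simp [encCNF, encClause, encLiteral, notMem_encVar]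
      intro _ _ _ _ _ _
      split <;> simp
  have hw_names : namesOf (u ++ v) = B := by
    rw [namesOf, listed_append_of_notMem (hu_mem _ (Or.inr rfl))]
    have e : v = Sum.inl Symbol.goal :: Sum.inl Symbol.formula ::
      ((ψ.flatMap encClause).map (Sum.inl : Symbol → Letter)) ++ z := rfl
    rw [e, listed_append_of_notMem]
    · refine (namesOf_names hy_bit B).1.trans ?_
      have := listed_append_of_notMem (f := nameOf) (t := []) (hy_mem .name)
      rw [List.append_nil] at this
      rw [namesOf, this]
      exact List.append_nil B
    · simp [encClause, encLiteral, notMem_encVar]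
      intro _ _ _ _
      split <;> simp
  have hw_blocks : listed (.inr 2) adviceOf (u ++ v) = allBits k := by
    have e : u ++ v = (encInst Φ ψ B).map Sum.inl ++ y := by rw [← hw, encPair, hy]
    rw [e, listed_append_of_notMem (by simp), hy, advice, listed_advice]
  have hprem : premises (u ++ v) = {C | C ∈ Φ.flatten.map List.toFinset} := by
    ext C
    rw [mem_premises_append_iff (hu_mem _ (Or.inl rfl)) rfl, hu_clauses]
    rfl
  have hconc : ∀ C, (∃ d, IsConclusion (u ++ v) d ∧ clauseAt (u ++ v) d = C) ↔
      C ∈ ψ.map List.toFinset := by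
    intro C
    rw [exists_isConclusion_append_iff (hu_mem _ (Or.inl rfl)) rfl, hv_clauses]
  -- The split variable may be any name readable at a position of the word. This set contains all
  -- variables of the clauses, is nonempty because of position 0, and is searched by a quantifier
  -- over positions.
  refine ⟨{x | ∃ a ≤ (u ++ v).length, nameAt (u ++ v) a = x}, ⟨_, 0, Nat.zero_le _, rfl⟩, ?_, ?_⟩
  · intro C hC l hl
    obtain ⟨c, -, rfl⟩ : ∃ c : ℕ, (u ++ v)[c]? = some (.inl .clause) ∧ clauseAt (u ++ v) c = C := by
      rw [← mem_clausesOf_iff, hw_clauses]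
      exact List.mem_append_left _ hC
    exact exists_nameAt_of_mem_clauseAt hl
  have hcard : B.toFinset.card = B.dedup.length := List.card_toFinset B
  -- The condition on one block of the advice.
  set P : (Literal → Prop) → Prop := fun τ =>
    (∀ C ∈ Φ.flatten.map List.toFinset ++ ψ.map List.toFinset, K τ C) ∧
      ∀ D ∈ ψ.map List.toFinset, ∃ x ∈ {x | ∃ a ≤ (u ++ v).length, nameAt (u ++ v) a = x}, ∀ s,
        Conflict {C | C ∈ Φ.flatten.map List.toFinset} (refutationBase τ D ⟨x, s⟩) with hP
  have hacc : Accepts K (u ++ v) ↔ ∀ β : List Bool, β.length = k → B.dedup.length = β.length ∧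
      P fun l => (l.var, l.positive) ∈ B.dedup.zip β := by
    have hP' : ∀ τ, P τ ↔ (∀ c : ℕ, (u ++ v)[c]? = some (.inl .clause) →
        K τ (clauseAt (u ++ v) c)) ∧ ∀ d, IsConclusion (u ++ v) d → ∃ a ≤ (u ++ v).length, ∀ s,
          Conflict (premises (u ++ v)) (refutationBase τ (clauseAt (u ++ v) d)
            ⟨nameAt (u ++ v) a, s⟩) := by
      intro τ
      rw [hP, hprem]
      refine and_congr ?_ ?_
      · rw [← hw_clauses]
        simp only [mem_clausesOf_iff]
        exact ⟨fun h c hc => h _ ⟨c, hc, rfl⟩, fun h C ⟨c, hc, e⟩ => e ▸ h c hc⟩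
      · constructor
        · intro h d hd
          obtain ⟨_, ⟨a, ha, rfl⟩, h⟩ := h _ ((hconc _).1 ⟨d, hd, rfl⟩)
          exact ⟨a, ha, h⟩
        · intro h D hD
          obtain ⟨d, hd, rfl⟩ := (hconc D).2 hD
          obtain ⟨a, ha, h⟩ := h d hd
          exact ⟨_, ⟨a, ha, rfl⟩, h⟩
    simp only [← mem_allBits, ← hw_blocks, mem_listed_iff, hP']
    constructor
    · rintro h _ ⟨p, hp, rfl⟩
      obtain ⟨h1, h2⟩ := h p hp
      rw [hw_names] at h1
      refine ⟨h1, ?_⟩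
      rw [← hw_names]
      exact h2
    · intro h p hp
      obtain ⟨h1, h2⟩ := h _ ⟨p, hp, rfl⟩
      rw [← hw_names] at h1 h2
      exact ⟨h1, h2⟩
  rw [hw, hacc, hcard]
  constructor
  · intro h
    -- The advice contains a block for every k, even k = 0, so the length test is carried out at
    -- least once.
    have hk : B.dedup.length = k := by
      have := (h (List.replicate k false) (by simp)).1
      simpa using this
    refine ⟨hk, fun θ => ?_⟩
    obtain ⟨β, hβ, e⟩ := exists_assignment_iff.2 ⟨θ, rfl⟩
    have := (h β (by omega)).2
    rw [← e] at this
    exact this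
  · rintro ⟨hk, h⟩ β hβ
    refine ⟨by omega, ?_⟩
    obtain ⟨θ, e⟩ := exists_assignment_iff.1 ⟨β, hk.trans hβ.symm, rfl⟩
    rw [e]
    exact h θ

/-- The problem is decided by the acceptance condition, for a class of formulas that is given by a
condition on the clauses. -/
theorem mem_bdimp_iff {F : Set CNF} {K : (Literal → Prop) → Clause → Prop}
    (hF : ∀ {X : Finset Var} (θ : Assignment X) {φ : CNF},
      φ.reduct θ ∈ F ↔ ∀ C ∈ φ, K θ.Sets C)
    (hK : (∀ τ C, K τ C → HornClause τ C) ∨ ∀ τ C, K τ C → KromClause τ C)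
    (x : List Symbol) (k : ℕ) : (x, k) ∈ BDIMP F ↔
      Valid (encPair (x, advice k)) ∧ Accepts K (encPair (x, advice k)) := by
  have key : ∀ Φ ψ B, Accepts K (encPair (encInst Φ ψ B, advice k)) ↔
      (⟨(Φ.map toCNF).toFinset, toCNF ψ, B.toFinset⟩ : Inst).IsStrongBackdoor F ∧
      B.toFinset.card = k ∧ Entails (Φ.map toCNF).toFinset (toCNF ψ) := by
    intro Φ ψ B
    obtain ⟨V, hne, hV, h⟩ := accepts_iff K Φ ψ B k
    rw [h]
    have hmem : ∀ {C : Clause} {φ : List (List Literal)},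
        C ∈ toCNF φ ↔ C ∈ φ.map List.toFinset := List.mem_toFinset
    have hΦ : ∀ p : Clause → Prop, (∀ φ ∈ (Φ.map toCNF).toFinset, ∀ C ∈ φ, p C) ↔
        ∀ C ∈ Φ.flatten.map List.toFinset, p C := by
      intro p
      simp only [List.mem_toFinset, List.forall_mem_map, hmem, List.mem_flatten]
      exact ⟨fun h c ⟨φ, hφ, hc⟩ => h φ hφ c hc, fun h φ hφ c hc => h c ⟨φ, hφ, hc⟩⟩
    have hback : (⟨(Φ.map toCNF).toFinset, toCNF ψ, B.toFinset⟩ : Inst).IsStrongBackdoor F ↔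
        ∀ θ : Assignment B.toFinset,
          ∀ C ∈ Φ.flatten.map List.toFinset ++ ψ.map List.toFinset, K θ.Sets C := by
      refine forall_congr' fun θ => ?_
      simp only [hF, hΦ, hmem]
      rw [← List.forall_mem_append]
    have hent : Entails (Φ.map toCNF).toFinset (toCNF ψ) ↔ ∀ v : Var → Bool,
        (∀ C ∈ {C | C ∈ Φ.flatten.map List.toFinset}, ∃ l ∈ C, l.Holds v) →
          ∀ D ∈ toCNF ψ, ∃ l ∈ D, l.Holds v := by
      refine forall_congr' fun v => imp_congr (hΦ fun C => ∃ l ∈ C, l.Holds v) Iff.rfl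
    rw [hback, forall_and, and_left_comm, hent]
    -- The criterion by unit propagation is complete only for a strong backdoor, so that part of the
    -- conjunction is assumed before the entailments are compared.
    refine and_congr_right fun hθ => and_congr_right fun _ => ?_
    rw [entails_iff_conflict (Cs := {C | C ∈ Φ.flatten.map List.toFinset}) (B := B.toFinset) hne hV]
    · simp only [hmem]
    · intro θ
      exact hK.imp (fun h C hC => h _ _ (hθ θ C (List.mem_append_left _ hC)))
        fun h C hC => h _ _ (hθ θ C (List.mem_append_left _ hC))
  rw [valid_encPair_iff]
  constructor
  · rintro ⟨⟨Φ', ψ', B'⟩, ⟨Φ, ψ, B, rfl, rfl, rfl, rfl⟩, h1, h2, h3⟩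
    exact ⟨⟨Φ, ψ, B, rfl⟩, (key Φ ψ B).2 ⟨h1, h2, h3⟩⟩
  · rintro ⟨⟨Φ, ψ, B, rfl⟩, h⟩
    exact ⟨_, ⟨Φ, ψ, B, rfl, rfl, rfl, rfl⟩, (key Φ ψ B).1 h⟩

/-- The two bits and the block marker are the three letters of the advice alphabet. The set in P is
defined by `Valid` and `Accepts`. -/
theorem isFPT_of_clauses {F : Set CNF} {K : (Literal → Prop) → Clause → Prop}
    (hF : ∀ {X : Finset Var} (θ : Assignment X) {φ : CNF},
      φ.reduct θ ∈ F ↔ ∀ C ∈ φ, K θ.Sets C)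
    (hK : (∀ τ C, K τ C → HornClause τ C) ∨ ∀ τ C, K τ C → KromClause τ C)
    (hD : DefClause K) : IsFPT (BDIMP F) :=
  ⟨3, advice, _, computable_advice, inP_of_def (Def.valid.and (Def.accepts hD)),
    mem_bdimp_iff hF hK⟩

end BackdoorImp

/-! ### The three target classes -/

theorem mainTheorem9 (F : Set BackdoorImp.CNF)
    (hF : F ∈ ({BackdoorImp.ID, BackdoorImp.Horn, BackdoorImp.Krom} :
      Set (Set BackdoorImp.CNF))) :
    BackdoorImp.IsFPT (BackdoorImp.BDIMP F) := by
  rcases hF with rfl | rfl | rfl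
  · exact BackdoorImp.isFPT_of_clauses @BackdoorImp.reduct_mem_id_iff
      (Or.inl fun _ _ h => h.hornClause) BackdoorImp.defClause_id
  · exact BackdoorImp.isFPT_of_clauses @BackdoorImp.reduct_mem_horn_iff
      (Or.inl fun _ _ h => h) BackdoorImp.defClause_horn
  · exact BackdoorImp.isFPT_of_clauses @BackdoorImp.reduct_mem_krom_iff
      (Or.inr fun _ _ h => h) BackdoorImp.defClause_krom
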